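/- **The MKT index.** Let $K=F(\sqrt D)$ be a quadratic extension of number fields and let $E$ be an elliptic curve over $F$, with quadratic twist $E_D$ (for $E: y^2=x^3+ax+b$, the curve $E_D: y^2=x^3+aD^2x+bD^3$). Let $S$ be the set of finite places of $F$ that ramify in $K$ or at which $E$ has bad reduction, let $S_0$ be the set of $v\in S$ that are ramified or inert in $K$, and for $v\in S_0$ let $w$ be the place of $K$ above $v$. The Mazur–Kramer–Tunnell index of $E$ over $K/F$ is $\delta(E,F,K)=\delta_\infty+\delta_f$, where $\delta_\infty$ is the number of real places $v$ of $F$ that ramify in $K$ and satisfy $\sigma_v(\Delta(E))>0$ ($\sigma_v$ being the corresponding real embedding), and $$\delta_f=\sum_{v\in S_0}\log_2\left(\frac{c_v\,c_{D,v}}{c_w}\left(\frac{\|\Delta_v\,\Delta_{D,v}\,d(K_w/F_v)^{-6}\|_{F_v}}{\|\Delta_w\|_{K_w}}\right)^{1/12}\right).$$ Here $c_v,c_{D,v},c_w$ are the Tamagawa factors (the index of the subgroup of points with nonsingular reduction on a minimal equation) and $\Delta_v,\Delta_{D,v},\Delta_w$ the minimal discriminants of $E/F_v$, $E_D/F_v$,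 $E/K_w$, respectively; $d(K_w/F_v)$ is the discriminant of $K_w/F_v$; and $\|a\|=(\#k)^{-\mathrm{ord}(a)}$ is the normalized absolute value, $k$ being the residue field. **Lemma 4.2.** Let $n\ne 1$ be a squarefree integer, $K=\mathbb{Q}(\sqrt n)$, and let $E=E_1$ be the elliptic curve $y^2=x^3-x$ over $\mathbb{Q}$. Let $\omega_0(n)$ be the number of odd primes dividing $n$. Then $$\delta(E_1,\mathbb{Q},K)=\begin{cases} 2\omega_0(n) & \text{if } n>0 \text{ and } n\equiv 1 \pmod 8,\\ 1+2\omega_0(n) & \text{if } n>0 \text{ and } n\equiv 5 \text{ or } 7 \pmod 8,\\ 3+2\omega_0(n) & \text{if } n>0 \text{ and } n\equiv 6 \pmod 8,\\ 2+2\omega_0(n) & \text{if } n>0 \text{ and } n\equiv 2 \text{ or } 3 \pmod 8,\\ 1+2\omega_0(n) & \text{if } n<0 \text{ and } n\equiv 1 \pmod 8,\\ 2+2\omega_0(n) & \text{if } n<0 \text{ and } n\equiv 5 \text{ or } 7 \pmod 8,\\ 3+2\omega_0(n) & \text{if } n<0 \text{ and } n\equiv 2 \text{ or } 3 \pmod 8,\\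 4+2\omega_0(n) & \text{if } n<0 \text{ and } n\equiv 6 \pmod 8. \end{cases}$$ -/

import Mathlib

open NumberField IsDedekindDomain

noncomputable section

namespace WeierstrassCurve

section Local

variable (R : Type*) [CommRing R] [IsDomain R] [IsDiscreteValuationRing R]
  {F : Type*} [Field F] [Algebra R F] [IsFractionRing R F]

open Classical in
/-- For a minimal Weierstrass equation over the fraction field of a discrete valuation ring `R`:
the subgroup `E₀` of the points whose reduction is a nonsingular point. The points without
`R`-integral affine coordinates reduce to the point at infinity, which is nonsingular, so the
condition is void for them. (The set of these points is itself a subgroup; the closure only saves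
carrying along the proof of this fact.) -/
def nonsingularReductionSubgroup (W : WeierstrassCurve F) [W.IsMinimal R] :
    AddSubgroup W.toAffine.Point :=
  AddSubgroup.closure {P | ∀ (x y : R)
    (h : W.toAffine.Nonsingular (algebraMap R F x) (algebraMap R F y)), P = .some _ _ h →
      (W.reduction R).toAffine.Nonsingular (IsLocalRing.residue R x) (IsLocalRing.residue R y)}

open Classical in
/-- The Tamagawa factor `c = (E(F) : E₀(F))`, computed on a minimal equation. -/
def tamagawaFactor (W : WeierstrassCurve F) : ℕ :=
  (nonsingularReductionSubgroup R (W.minimal R)).index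

/-- The discriminant of a minimal equation (well defined up to 12th powers of units of `R`). -/
def minimalDiscriminant (W : WeierstrassCurve F) : F := (W.minimal R).Δ

end Local

/-- The quadratic twist by `D`, over a field of characteristic different from `2`. For
`y² = x³ + a x + b` it is `y² = x³ + a D² x + b D³`. -/
def quadraticTwist {F : Type*} [Field F] (W : WeierstrassCurve F) (D : F) : WeierstrassCurve F where
  a₁ := 0
  a₂ := D * W.b₂ / 4
  a₃ := 0
  a₄ := D ^ 2 * W.b₄ / 2
  a₆ := D ^ 3 * W.b₆ / 4

end WeierstrassCurve

namespace MKT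

/-- The discriminant of a finite separable extension `L` of the fraction field `F` of a principal
ideal domain `R`: the discriminant of an `R`-basis of the integral closure of `R` in `L`
(well defined up to squares of units of `R`). -/
def extensionDiscriminant (R F L : Type*) [CommRing R] [IsDomain R] [IsPrincipalIdealRing R]
    [Field F] [Algebra R F] [IsFractionRing R F] [Field L] [Algebra F L] [Algebra R L]
    [IsScalarTower R F L] [FiniteDimensional F L] [Algebra.IsSeparable F L] : R :=
  haveI : Module.IsTorsionFree R L := .trans_faithfulSMul R F L
  haveI : IsNoetherian R (integralClosure R L) :=
    IsIntegralClosure.isNoetherian R F L (integralClosure R L)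
  haveI : Module.Free R (integralClosure R L) :=
    IsIntegralClosure.module_free R F L (integralClosure R L)
  Algebra.discr R (Module.finBasis R (integralClosure R L))

section Completion

variable {F K : Type*} [Field F] [NumberField F] [Field K] [NumberField K] [Algebra F K]
  (v : HeightOneSpectrum (𝓞 F)) (w : HeightOneSpectrum (𝓞 K)) [w.asIdeal.LiesOver v.asIdeal]

/-- The embedding `F_v → K_w` of completions, for `w` above `v`: the continuous extension of
`F → K`. -/
def completionMap : v.adicCompletion F →+* w.adicCompletion K :=
  ((HeightOneSpectrum.adicCompletion.equiv K w).symm.toRingHom.comp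
    (UniformSpace.Completion.mapRingHom
      (algebraMap (WithVal (v.valuation F)) (WithVal (w.valuation K)))
      (HeightOneSpectrum.uniformContinuous_algebraMap_liesOver F K v w).continuous)).comp
    (HeightOneSpectrum.adicCompletion.equiv F v).toRingHom

/-- `K_w` as an `F_v`-algebra. -/
abbrev completionAlgebra : Algebra (v.adicCompletion F) (w.adicCompletion K) :=
  (completionMap v w).toAlgebra

theorem continuous_completionMap : Continuous (completionMap v w) := by
  have h1 : Continuous (HeightOneSpectrum.adicCompletion.equiv F v) :=
    (HeightOneSpectrum.adicCompletion.isUniformInducing_toCompletion F v).uniformContinuous.continuous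
  have h2 : Continuous (HeightOneSpectrum.adicCompletion.equiv K w).symm :=
    (HeightOneSpectrum.adicCompletion.uniformEquiv K w).symm.continuous
  exact h2.comp (UniformSpace.Completion.continuous_map.comp h1)

theorem completionMap_algebraMap (x : F) :
    completionMap v w (algebraMap F (v.adicCompletion F) x) =
      algebraMap F (w.adicCompletion K) x := by
  apply HeightOneSpectrum.adicCompletion.ext
  rw [HeightOneSpectrum.algebraMap_adicCompletion_toCompletion]
  exact (UniformSpace.Completion.map_coe
    (HeightOneSpectrum.uniformContinuous_algebraMap_liesOver F K v w) _)

theorem finiteDimensional_completion :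
    letI := completionAlgebra v w
    FiniteDimensional (v.adicCompletion F) (w.adicCompletion K) := by
  let := completionAlgebra v w
  have : ContinuousSMul (v.adicCompletion F) (w.adicCompletion K) :=
    ⟨((continuous_completionMap v w).comp continuous_fst).mul continuous_snd⟩
  have : IsScalarTower F (v.adicCompletion F) (w.adicCompletion K) :=
    .of_algebraMap_eq fun x => (completionMap_algebraMap v w x).symm
  infer_instance

instance charZero_completion : CharZero (v.adicCompletion F) :=
  charZero_of_injective_algebraMap (algebraMap F (v.adicCompletion F)).injective

/-- The discriminant `d(K_w / F_v)`. -/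
def localDiscriminant : v.adicCompletion F :=
  letI := completionAlgebra v w
  haveI := finiteDimensional_completion v w
  algebraMap (v.adicCompletionIntegers F) (v.adicCompletion F)
    (extensionDiscriminant (v.adicCompletionIntegers F) (v.adicCompletion F) (w.adicCompletion K))

/-- The summand of the finite part of the MKT index at `v`, formed with the place `w` above `v`. The
norm on a completion is the normalized one, `‖a‖ = (#k)^(-ord a)` with `k` the residue field. -/
def localTerm (E : WeierstrassCurve F) (D : F) : ℝ :=
  Real.logb 2
    (((E.baseChange (v.adicCompletion F)).tamagawaFactor (v.adicCompletionIntegers F) : ℝ) *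
        (((E.quadraticTwist D).baseChange (v.adicCompletion F)).tamagawaFactor
          (v.adicCompletionIntegers F) : ℝ) /
        ((E.baseChange (w.adicCompletion K)).tamagawaFactor (w.adicCompletionIntegers K) : ℝ) *
      (‖(E.baseChange (v.adicCompletion F)).minimalDiscriminant (v.adicCompletionIntegers F) *
            ((E.quadraticTwist D).baseChange (v.adicCompletion F)).minimalDiscriminant
              (v.adicCompletionIntegers F) *
            localDiscriminant v w ^ (-6 : ℤ)‖ /
          ‖(E.baseChange (w.adicCompletion K)).minimalDiscriminant (w.adicCompletionIntegers K)‖) ^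
        (1 / 12 : ℝ))

end Completion

section Index

variable {F : Type*} [Field F] [NumberField F] (E : WeierstrassCurve F) (D : F)
  (K : Type*) [Field K] [NumberField K] [Algebra F K]

theorem exists_place_above (v : HeightOneSpectrum (𝓞 F)) :
    ∃ w : HeightOneSpectrum (𝓞 K), w.asIdeal.LiesOver v.asIdeal := by
  obtain ⟨P, hP, hover⟩ :=
    Ideal.exists_maximal_ideal_liesOver_of_isIntegral (S := 𝓞 K) v.asIdeal
  exact ⟨⟨P, hP.isPrime, Ideal.ne_bot_of_liesOver_of_ne_bot v.ne_bot P⟩, hover⟩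

/-- A chosen place `w` of `K` above `v`. (At the places used below there is only one.) -/
def placeAbove (v : HeightOneSpectrum (𝓞 F)) : HeightOneSpectrum (𝓞 K) :=
  (exists_place_above K v).choose

instance (v : HeightOneSpectrum (𝓞 F)) : (placeAbove K v).asIdeal.LiesOver v.asIdeal :=
  (exists_place_above K v).choose_spec

/-- `v` is ramified in `K`: the square of some prime of `K` divides `v`. -/
def IsRamifiedIn (v : HeightOneSpectrum (𝓞 F)) : Prop :=
  ∃ w : HeightOneSpectrum (𝓞 K), v.asIdeal.map (algebraMap (𝓞 F) (𝓞 K)) ≤ w.asIdeal ^ 2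

/-- `v` is inert in `K`: it stays prime. -/
def IsInertIn (v : HeightOneSpectrum (𝓞 F)) : Prop :=
  (v.asIdeal.map (algebraMap (𝓞 F) (𝓞 K))).IsPrime

/-- `E` has bad reduction at `v`. -/
def IsBadAt (v : HeightOneSpectrum (𝓞 F)) : Prop :=
  ¬ ((E.baseChange (v.adicCompletion F)).minimal (v.adicCompletionIntegers F)).HasGoodReduction
    (v.adicCompletionIntegers F)

/-- The finite places of `F` that ramify in `K` or at which `E` has bad reduction. -/
def placesS : Set (HeightOneSpectrum (𝓞 F)) := {v | IsRamifiedIn K v ∨ IsBadAt E v}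

/-- The places in `placesS` that are ramified or inert in `K`. -/
def placesS₀ : Set (HeightOneSpectrum (𝓞 F)) :=
  {v ∈ placesS E K | IsRamifiedIn K v ∨ IsInertIn K v}

/-- The number of real places of `F` that ramify in `K` and at which the discriminant of `E` is
positive. -/
def deltaInfinite : ℕ :=
  {v : InfinitePlace F | ∃ hv : v.IsReal, ¬ v.IsUnramifiedIn K ∧
    0 < InfinitePlace.embedding_of_isReal hv E.Δ}.ncard

/-- The finite part of the MKT index. -/
def deltaFinite : ℝ := ∑ᶠ v ∈ placesS₀ E K, localTerm v (placeAbove K v) E D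

/-- The Mazur–Kramer–Tunnell index `δ(E, F, K)` of an elliptic curve `E` over `F`, for
`K = F(√D)` a quadratic extension of `F`. -/
def mktIndex : ℝ := deltaInfinite E K + deltaFinite E D K

end Index

/-- The elliptic curve `y² = x³ - x` over `ℚ`. -/
def curveE₁ : WeierstrassCurve ℚ where
  a₁ := 0
  a₂ := 0
  a₃ := 0
  a₄ := -1
  a₆ := 0

/-- The number of odd prime divisors of `n`. -/
def oddPrimeCount (n : ℤ) : ℕ := (n.natAbs.primeFactors.erase 2).card

end MKT
end

/-!
The twist of `y² = x³ - x` by `n` is `y² = x³ - n²x`, so at a finite place the discriminants enter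
the local term only through `‖n‖ / ‖d(K_w/ℚ_v)‖`: the term is the base-two logarithm of
`(c_v * c_{n,v} / c_w) * √(‖n‖ / ‖d(K_w/ℚ_v)‖)`. At an odd prime dividing `n` the Tamagawa factors
are `1`, `4`, `1` and the square root is `1`, so the term is `2`. Since `Δ(E₁) > 0`, the infinite
place contributes `1` exactly when `n < 0`.

The remaining work is at `2`, when it does not split in `K`. The reduction on a minimal equation has
one singular point, the reduction of a `2`-torsion point, so the Tamagawa factor is the index of the
subgroup of points that do not reduce to it. Over `ℚ_2` and its unramified quadratic extension this
index is `2` for `E₁` and its twists by units, and over `ℚ_2` it is `4` for the twists by even `n`,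
with cosets represented by torsion points. Over a ramified `K_w` it is `4` or `2` for `E₁` according
as some point has `x - 1` a uniformizer or not. When `-1` is a square in `K_w` (`n ≡ 7` modulo `8`)
the abscissa `√-1` gives such a point, and when `n ≡ 2` modulo `8` the abscissa `1 + √n` does; when
`n ≡ 3` or `6` a congruence modulo a power of the uniformizer excludes one.
-/

namespace MKT

open HeightOneSpectrum WithZero Rat.HeightOneSpectrum WeierstrassCurve

/-! ### Changes of variables -/

section VariableChange

variable {F : Type*} [Field F] (C : VariableChange F) (W : WeierstrassCurve F)

/-- The `X`-coordinate on `W` of a point of `C • W` with `X`-coordinate `x`. -/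
def substX (x : F) : F := C.u ^ 2 * x + C.r

/-- The `Y`-coordinate on `W` of the point `(x, y)` of `C • W`. -/
def substY (x y : F) : F := C.u ^ 3 * y + C.s * C.u ^ 2 * x + C.t

/-- The partial derivative `∂f/∂X` of the Weierstrass polynomial `f` of `W`. -/
def partialX (x y : F) : F := W.a₁ * y - (3 * x ^ 2 + 2 * W.a₂ * x + W.a₄)

/-- The partial derivative `∂f/∂Y` of the Weierstrass polynomial `f` of `W`. -/
def partialY (x y : F) : F := 2 * y + W.a₁ * x + W.a₃

variable {C} in
lemma substX_inj {x x' : F} : substX C x = substX C x' ↔ x = x' := by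
  simp [substX]

variable {C} in
lemma substY_inj {x y y' : F} : substY C x y = substY C x y' ↔ y = y' := by
  simp [substY]

lemma equation_smul_iff (x y : F) :
    (C • W).toAffine.Equation x y ↔ W.toAffine.Equation (substX C x) (substY C x y) := by
  have hu : (C.u : F) ≠ 0 := C.u.ne_zero
  rw [Affine.equation_iff', Affine.equation_iff', ← mul_right_inj' (pow_ne_zero 6 hu), mul_zero]
  simp only [substX, substY, variableChange_a₁, variableChange_a₂, variableChange_a₃,
    variableChange_a₄, variableChange_a₆, Units.val_inv_eq_inv_val]
  refine Eq.congr_left ?_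
  field_simp
  ring

lemma nonsingular_iff_partial (x y : F) : W.toAffine.Nonsingular x y ↔
    W.toAffine.Equation x y ∧ ¬(partialX W x y = 0 ∧ partialY W x y = 0) := by
  rw [not_and_or]
  exact Affine.nonsingular_iff' ..

lemma partialX_smul (x y : F) : C.u ^ 4 * partialX (C • W) x y =
    partialX W (substX C x) (substY C x y) +
      C.s * partialY W (substX C x) (substY C x y) := by
  have hu : (C.u : F) ≠ 0 := C.u.ne_zero
  simp only [partialX, partialY, substX, substY, variableChange_a₁, variableChange_a₂,
    variableChange_a₄, Units.val_inv_eq_inv_val]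
  field_simp
  ring

lemma partialY_smul (x y : F) :
    C.u ^ 3 * partialY (C • W) x y = partialY W (substX C x) (substY C x y) := by
  have hu : (C.u : F) ≠ 0 := C.u.ne_zero
  simp only [partialY, substX, substY, variableChange_a₁, variableChange_a₃,
    Units.val_inv_eq_inv_val]
  field_simp
  ring

lemma nonsingular_smul_iff (x y : F) :
    (C • W).toAffine.Nonsingular x y ↔ W.toAffine.Nonsingular (substX C x) (substY C x y) := by
  have hu : (C.u : F) ≠ 0 := C.u.ne_zero
  rw [nonsingular_iff_partial, nonsingular_iff_partial, equation_smul_iff,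
    ← mul_eq_zero_iff_left (b := partialX (C • W) x y) (pow_ne_zero 4 hu),
    ← mul_eq_zero_iff_left (b := partialY (C • W) x y) (pow_ne_zero 3 hu),
    partialX_smul, partialY_smul]
  refine and_congr_right fun _ => not_congr (and_congr_left fun hY => ?_)
  rw [hY, mul_zero, add_zero]

lemma substY_negY (x y : F) :
    substY C x ((C • W).toAffine.negY x y) = W.toAffine.negY (substX C x) (substY C x y) := by
  have hu : (C.u : F) ≠ 0 := C.u.ne_zero
  simp only [substX, substY, Affine.negY, variableChange_a₁, variableChange_a₃,
    Units.val_inv_eq_inv_val]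
  field_simp
  ring

lemma eq_negY_smul_iff (x y y' : F) :
    y = (C • W).toAffine.negY x y' ↔
      substY C x y = W.toAffine.negY (substX C x) (substY C x y') := by
  rw [← substY_negY, substY_inj]

lemma slope_eq_neg_partialX_div_partialY [DecidableEq F] {x y₁ y₂ : F}
    (hy : y₁ ≠ W.toAffine.negY x y₂) :
    W.toAffine.slope x x y₁ y₂ = -partialX W x y₁ / partialY W x y₁ := by
  rw [Affine.slope_of_Y_ne rfl hy]
  congr 1
  · simp only [partialX]; ring
  · simp only [partialY, Affine.negY]; ring

lemma slope_tangent_smul [DecidableEq F] {x y : F} (hy : y ≠ (C • W).toAffine.negY x y) :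
    W.toAffine.slope (substX C x) (substX C x) (substY C x y) (substY C x y) =
      C.u * (C • W).toAffine.slope x x y y + C.s := by
  have hu : (C.u : F) ≠ 0 := C.u.ne_zero
  have hY : partialY (C • W) x y ≠ 0 := fun h => hy <| by
    rw [partialY] at h
    rw [Affine.negY]
    linear_combination h
  rw [slope_eq_neg_partialX_div_partialY _ hy,
    slope_eq_neg_partialX_div_partialY _ (mt (eq_negY_smul_iff ..).mpr hy),
    ← partialY_smul, div_eq_iff (mul_ne_zero (pow_ne_zero 3 hu) hY)]
  have hX := partialX_smul C W x y
  rw [← partialY_smul] at hX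
  generalize partialX W _ _ = p at hX ⊢
  field_simp
  linear_combination hX

lemma slope_secant_smul [DecidableEq F] {x₁ x₂ : F} (y₁ y₂ : F) (hx : x₁ ≠ x₂) :
    W.toAffine.slope (substX C x₁) (substX C x₂) (substY C x₁ y₁) (substY C x₂ y₂) =
      C.u * (C • W).toAffine.slope x₁ x₂ y₁ y₂ + C.s := by
  have hu : (C.u : F) ≠ 0 := C.u.ne_zero
  have hx' : x₁ - x₂ ≠ 0 := sub_ne_zero.mpr hx
  rw [Affine.slope_of_X_ne hx, Affine.slope_of_X_ne (mt substX_inj.mp hx), substX, substX,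
    add_sub_add_right_eq_sub, ← mul_sub, div_eq_iff (mul_ne_zero (pow_ne_zero 2 hu) hx')]
  simp only [substY]
  field_simp
  ring

lemma slope_smul [DecidableEq F] {x₁ x₂ y₁ y₂ : F}
    (h₁ : (C • W).toAffine.Equation x₁ y₁) (h₂ : (C • W).toAffine.Equation x₂ y₂)
    (hxy : ¬(x₁ = x₂ ∧ y₁ = (C • W).toAffine.negY x₂ y₂)) :
    W.toAffine.slope (substX C x₁) (substX C x₂) (substY C x₁ y₁) (substY C x₂ y₂) =
      C.u * (C • W).toAffine.slope x₁ x₂ y₁ y₂ + C.s := by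
  by_cases hx : x₁ = x₂
  · subst hx
    have hy : y₁ ≠ (C • W).toAffine.negY x₁ y₂ := fun h => hxy ⟨rfl, h⟩
    obtain rfl := Affine.Y_eq_of_Y_ne h₁ h₂ rfl hy
    exact slope_tangent_smul C W hy
  · exact slope_secant_smul C W y₁ y₂ hx

lemma substX_addX (x₁ x₂ l : F) :
    substX C ((C • W).toAffine.addX x₁ x₂ l) =
      W.toAffine.addX (substX C x₁) (substX C x₂) (C.u * l + C.s) := by
  have hu : (C.u : F) ≠ 0 := C.u.ne_zero
  simp only [substX, Affine.addX, variableChange_a₁, variableChange_a₂, Units.val_inv_eq_inv_val]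
  field_simp
  ring

lemma substY_addY (x₁ x₂ y l : F) :
    substY C ((C • W).toAffine.addX x₁ x₂ l) ((C • W).toAffine.addY x₁ x₂ y l) =
      W.toAffine.addY (substX C x₁) (substX C x₂) (substY C x₁ y) (C.u * l + C.s) := by
  rw [Affine.addY, substY_negY, Affine.addY, substX_addX]
  congr 1
  rw [Affine.negAddY, Affine.negAddY, ← substX_addX]
  simp only [substX, substY]
  ring

/-- The map `(C • W)(F) → W(F)` given by a change of variables. -/
def substPoint : (C • W).toAffine.Point → W.toAffine.Point
  | .zero => .zero
  | .some x y h => .some (substX C x) (substY C x y) ((nonsingular_smul_iff C W x y).mp h)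

lemma substPoint_injective : Function.Injective (substPoint C W) := by
  rintro (_ | ⟨x, y, h⟩) (_ | ⟨x', y', h'⟩) H
  · rfl
  · simp [substPoint] at H
  · simp [substPoint] at H
  · obtain ⟨hx, hy⟩ := Affine.Point.some.inj H
    obtain rfl := substX_inj.mp hx
    obtain rfl := substY_inj.mp hy
    rfl

lemma substPoint_surjective : Function.Surjective (substPoint C W) := by
  have hu : (C.u : F) ≠ 0 := C.u.ne_zero
  rintro (_ | ⟨x, y, h⟩)
  · exact ⟨.zero, rfl⟩
  · obtain ⟨x', rfl⟩ : ∃ x', substX C x' = x :=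
      ⟨(x - C.r) / C.u ^ 2, by rw [substX]; field_simp; ring⟩
    obtain ⟨y', rfl⟩ : ∃ y', substY C x' y' = y :=
      ⟨(y - C.s * C.u ^ 2 * x' - C.t) / C.u ^ 3, by rw [substY]; field_simp; ring⟩
    exact ⟨.some x' y' ((nonsingular_smul_iff C W x' y').mpr h), rfl⟩

lemma substPoint_add [DecidableEq F] (P Q : (C • W).toAffine.Point) :
    substPoint C W (P + Q) = substPoint C W P + substPoint C W Q := by
  rcases P, Q with ⟨_ | ⟨x₁, y₁, h₁⟩, _ | ⟨x₂, y₂, h₂⟩⟩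
  · rfl
  · rfl
  · rfl
  · by_cases hxy : x₁ = x₂ ∧ y₁ = (C • W).toAffine.negY x₂ y₂
    · rw [Affine.Point.add_of_Y_eq hxy.1 hxy.2]
      obtain ⟨rfl, hy⟩ := hxy
      exact (Affine.Point.add_of_Y_eq rfl ((eq_negY_smul_iff ..).mp hy)).symm
    · have hxy' : ¬(substX C x₁ = substX C x₂ ∧
          substY C x₁ y₁ = W.toAffine.negY (substX C x₂) (substY C x₂ y₂)) := by
        rintro ⟨hx, hy⟩
        obtain rfl := substX_inj.mp hx
        exact hxy ⟨rfl, (eq_negY_smul_iff ..).mpr hy⟩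
      rw [Affine.Point.add_some hxy, substPoint, substPoint, substPoint,
        Affine.Point.add_some hxy', Affine.Point.some.injEq, slope_smul C W h₁.1 h₂.1 hxy]
      exact ⟨substX_addX .., substY_addY ..⟩

/-- A change of variables induces an isomorphism `(C • W)(F) ≃ W(F)` of groups. -/
noncomputable def substPointEquiv [DecidableEq F] : (C • W).toAffine.Point ≃+ W.toAffine.Point :=
  AddEquiv.mk' (Equiv.ofBijective _ ⟨substPoint_injective C W, substPoint_surjective C W⟩)
    (substPoint_add C W)

lemma substPointEquiv_apply [DecidableEq F] (P : (C • W).toAffine.Point) :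
    substPointEquiv C W P = substPoint C W P := rfl

end VariableChange

/-! ### Minimal equations -/

section IntegralChange

variable {R F : Type*} [CommRing R] [IsIntegrallyClosed R] [Field F] [Algebra R F]
  [IsFractionRing R F]

lemma mem_range_of_quartic {x : F} (p q r : R)
    (h : x ^ 4 + algebraMap R F p * x ^ 2 + algebraMap R F q * x + algebraMap R F r = 0) :
    x ∈ (algebraMap R F).range := by
  refine IsIntegrallyClosed.isIntegral_iff.mp ⟨.X ^ 4 + .C p * .X ^ 2 + .C q * .X + .C r, ?_, ?_⟩
  · monicity!
  · simpa using h

lemma mem_range_of_quadratic {x : F} (p q : R)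
    (h : x ^ 2 + algebraMap R F p * x + algebraMap R F q = 0) :
    x ∈ (algebraMap R F).range := by
  refine IsIntegrallyClosed.isIntegral_iff.mp ⟨.X ^ 2 + .C p * .X + .C q, ?_, ?_⟩
  · monicity!
  · simpa using h

variable (W : WeierstrassCurve F) [hW : W.IsIntegral R] (C : VariableChange F)
  [hCW : (C • W).IsIntegral R] {u : R} (hu : algebraMap R F u = C.u)
include hW hCW hu

lemma variableChange_r_mem_range : C.r ∈ (algebraMap R F).range := by
  have hu0 : (C.u : F) ≠ 0 := C.u.ne_zero
  have hb₆ : (C.u : F) ^ 6 * (C • W).b₆ =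
      W.b₆ + 2 * C.r * W.b₄ + C.r ^ 2 * W.b₂ + 4 * C.r ^ 3 := by
    rw [variableChange_b₆, Units.val_inv_eq_inv_val]; field_simp
  have hb₈ : (C.u : F) ^ 8 * (C • W).b₈ =
      W.b₈ + 3 * C.r * W.b₆ + 3 * C.r ^ 2 * W.b₄ + C.r ^ 3 * W.b₂ + 3 * C.r ^ 4 := by
    rw [variableChange_b₈, Units.val_inv_eq_inv_val]; field_simp
  -- eliminating `C.r ^ 3 * W.b₂` between the two relations gives a monic equation
  refine mem_range_of_quartic (-(integralModel R W).b₄)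
    (-2 * (integralModel R W).b₆ - u ^ 6 * (integralModel R (C • W)).b₆)
    (u ^ 8 * (integralModel R (C • W)).b₈ - (integralModel R W).b₈) ?_
  simp only [map_neg, map_sub, map_mul, map_pow, map_ofNat, hu, integralModel_b₄_eq,
    integralModel_b₆_eq, integralModel_b₈_eq]
  linear_combination hb₈ - C.r * hb₆

lemma variableChange_s_mem_range : C.s ∈ (algebraMap R F).range := by
  have hu0 : (C.u : F) ≠ 0 := C.u.ne_zero
  obtain ⟨r, hr⟩ := variableChange_r_mem_range W C hu
  have ha₂ : (C.u : F) ^ 2 * (C • W).a₂ = W.a₂ - C.s * W.a₁ + 3 * C.r - C.s ^ 2 := by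
    rw [variableChange_a₂, Units.val_inv_eq_inv_val]; field_simp
  refine mem_range_of_quadratic (integralModel R W).a₁
    (u ^ 2 * (integralModel R (C • W)).a₂ - (integralModel R W).a₂ - 3 * r) ?_
  simp only [map_sub, map_mul, map_pow, map_ofNat, hu, hr, integralModel_a₁_eq,
    integralModel_a₂_eq]
  linear_combination ha₂

lemma variableChange_t_mem_range : C.t ∈ (algebraMap R F).range := by
  have hu0 : (C.u : F) ≠ 0 := C.u.ne_zero
  obtain ⟨r, hr⟩ := variableChange_r_mem_range W C hu
  have ha₆ : (C.u : F) ^ 6 * (C • W).a₆ = W.a₆ + C.r * W.a₄ + C.r ^ 2 * W.a₂ + C.r ^ 3 -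
      C.t * W.a₃ - C.t ^ 2 - C.r * C.t * W.a₁ := by
    rw [variableChange_a₆, Units.val_inv_eq_inv_val]; field_simp
  refine mem_range_of_quadratic ((integralModel R W).a₃ + r * (integralModel R W).a₁)
    (u ^ 6 * (integralModel R (C • W)).a₆ - (integralModel R W).a₆ - r * (integralModel R W).a₄ -
      r ^ 2 * (integralModel R W).a₂ - r ^ 3) ?_
  simp only [map_add, map_sub, map_mul, map_pow, hu, hr, integralModel_a₁_eq, integralModel_a₂_eq,
    integralModel_a₃_eq, integralModel_a₄_eq, integralModel_a₆_eq]
  linear_combination ha₆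

end IntegralChange

section MinimalModel

open HeightOneSpectrum

variable (R : Type*) [CommRing R] [IsDomain R] [IsDiscreteValuationRing R]
  {F : Type*} [Field F] [Algebra R F] [IsFractionRing R F]

local notation "𝓿" => HeightOneSpectrum.valuation F (IsDiscreteValuationRing.maximalIdeal R)

lemma valuation_le_one_iff_mem_range (x : F) : 𝓿 x ≤ 1 ↔ x ∈ (algebraMap R F).range := by
  constructor
  · exact IsDiscreteValuationRing.exists_lift_of_le_one
  · rintro ⟨r, rfl⟩
    exact valuation_le_one _ r

variable {R}

lemma valuation_Δ_smul_le (W : WeierstrassCurve F) [W.IsMinimal R] (C : VariableChange F)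
    [hC : (C • W).IsIntegral R] : 𝓿 (C • W).Δ ≤ 𝓿 W.Δ := by
  have h := (IsMinimal.val_Δ_maximal (R := R) (W := W)).2 (j := C) hC
  rw [← valuation_Δ_aux_eq_of_isIntegral, ← valuation_Δ_aux_eq_of_isIntegral, Subtype.coe_le_coe]
  simp only [one_smul] at h
  exact (le_total _ _).elim h id

lemma valuation_Δ_smul_eq (W : WeierstrassCurve F) [W.IsMinimal R] (C : VariableChange F)
    [(C • W).IsMinimal R] : 𝓿 (C • W).Δ = 𝓿 W.Δ := by
  have : (C⁻¹ • C • W).IsIntegral R := by rw [inv_smul_smul]; infer_instance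
  have h := valuation_Δ_smul_le (R := R) (C • W) C⁻¹
  rw [inv_smul_smul] at h
  exact (valuation_Δ_smul_le W C).antisymm h

lemma valuation_minimalDiscriminant (W : WeierstrassCurve F) [W.IsMinimal R] :
    𝓿 (W.minimalDiscriminant R) = 𝓿 W.Δ := by
  have : ((W.exists_isMinimal R).choose • W).IsMinimal R := (W.exists_isMinimal R).choose_spec
  exact valuation_Δ_smul_eq W _

lemma valuation_u_eq_one (W : WeierstrassCurve F) (hΔ : W.Δ ≠ 0) [W.IsMinimal R]
    (C : VariableChange F) [(C • W).IsMinimal R] : 𝓿 (C.u : F) = 1 := by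
  have h := valuation_Δ_smul_eq (R := R) W C
  rwa [variableChange_Δ, map_mul, mul_eq_right₀ ((map_ne_zero _).mpr hΔ), map_pow,
    pow_eq_one_iff_of_nonneg zero_le (by norm_num), Units.val_inv_eq_inv_val, map_inv₀,
    inv_eq_one] at h

lemma residue_eq_zero_iff_valuation (a : R) :
    IsLocalRing.residue R a = 0 ↔ 𝓿 (algebraMap R F a) < 1 := by
  rw [IsLocalRing.residue_eq_zero_iff, valuation_lt_one_iff_mem]
  rfl

lemma equation_reduction (W : WeierstrassCurve F) [W.IsMinimal R] {x y : R}
    (h : W.toAffine.Equation (algebraMap R F x) (algebraMap R F y)) :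
    (W.reduction R).toAffine.Equation (IsLocalRing.residue R x) (IsLocalRing.residue R y) := by
  refine Affine.Equation.map (W := integralModel R W) _ ?_
  rw [← Affine.map_equation _ (IsFractionRing.injective R F)]
  change (baseChange (integralModel R W) F).toAffine.Equation _ _
  rwa [baseChange_integralModel_eq R W]

lemma partialX_reduction_eq_zero_iff (W : WeierstrassCurve F) [W.IsMinimal R] (x y : R) :
    partialX (W.reduction R) (IsLocalRing.residue R x) (IsLocalRing.residue R y) = 0 ↔
      𝓿 (partialX W (algebraMap R F x) (algebraMap R F y)) < 1 := by
  have h := residue_eq_zero_iff_valuation (F := F) ((integralModel R W).a₁ * y -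
    (3 * x ^ 2 + 2 * (integralModel R W).a₂ * x + (integralModel R W).a₄))
  simp only [map_sub, map_add, map_mul, map_pow, map_ofNat, integralModel_a₁_eq,
    integralModel_a₂_eq, integralModel_a₄_eq] at h
  exact h

lemma partialY_reduction_eq_zero_iff (W : WeierstrassCurve F) [W.IsMinimal R] (x y : R) :
    partialY (W.reduction R) (IsLocalRing.residue R x) (IsLocalRing.residue R y) = 0 ↔
      𝓿 (partialY W (algebraMap R F x) (algebraMap R F y)) < 1 := by
  have h := residue_eq_zero_iff_valuation (F := F)
    (2 * y + (integralModel R W).a₁ * x + (integralModel R W).a₃)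
  simp only [map_add, map_mul, map_ofNat, integralModel_a₁_eq, integralModel_a₃_eq] at h
  exact h

lemma nonsingular_reduction_iff (W : WeierstrassCurve F) [W.IsMinimal R] {x y : R}
    (h : W.toAffine.Equation (algebraMap R F x) (algebraMap R F y)) :
    (W.reduction R).toAffine.Nonsingular (IsLocalRing.residue R x) (IsLocalRing.residue R y) ↔
      ¬(𝓿 (partialX W (algebraMap R F x) (algebraMap R F y)) < 1 ∧
        𝓿 (partialY W (algebraMap R F x) (algebraMap R F y)) < 1) := by
  rw [nonsingular_iff_partial, and_iff_right (equation_reduction W h),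
    partialX_reduction_eq_zero_iff, partialY_reduction_eq_zero_iff]

variable (R) in
/-- The point has nonsingular reduction on the integral equation `W`, read off from the valuations
of its partial derivatives; a point with non-integral coordinates reduces to infinity. -/
def HasNonsingularReduction (W : WeierstrassCurve F) : W.toAffine.Point → Prop
  | .zero => True
  | .some x y _ => 𝓿 x ≤ 1 ∧ 𝓿 y ≤ 1 → ¬(𝓿 (partialX W x y) < 1 ∧ 𝓿 (partialY W x y) < 1)

open Classical in
variable (R) in
lemma nonsingularReductionSubgroup_eq_closure (W : WeierstrassCurve F) [W.IsMinimal R] :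
    W.nonsingularReductionSubgroup R = AddSubgroup.closure {P | HasNonsingularReduction R W P} := by
  rw [nonsingularReductionSubgroup]
  congr 1
  ext P
  rcases P with _ | ⟨x, y, h⟩
  · simp [HasNonsingularReduction]
  · simp only [Set.mem_ofPred_eq, HasNonsingularReduction, valuation_le_one_iff_mem_range]
    constructor
    · rintro H ⟨⟨x, rfl⟩, ⟨y, rfl⟩⟩
      exact (nonsingular_reduction_iff W h.1).mp (H x y h rfl)
    · rintro H x' y' h' H'
      obtain ⟨rfl, rfl⟩ := Affine.Point.some.inj H'
      exact (nonsingular_reduction_iff W h.1).mpr (H ⟨⟨_, rfl⟩, ⟨_, rfl⟩⟩)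

lemma valuation_substX_substY_le_one_iff {C : VariableChange F} (hu : 𝓿 (C.u : F) = 1)
    (hr : 𝓿 C.r ≤ 1) (hs : 𝓿 C.s ≤ 1) (ht : 𝓿 C.t ≤ 1) (x y : F) :
    𝓿 (substX C x) ≤ 1 ∧ 𝓿 (substY C x y) ≤ 1 ↔ 𝓿 x ≤ 1 ∧ 𝓿 y ≤ 1 := by
  have hx : 𝓿 (C.u ^ 2 * x) = 𝓿 x := by simp [hu]
  have hy : 𝓿 (C.u ^ 3 * y) = 𝓿 y := by simp [hu]
  rw [← hx, ← hy]
  simp only [substX, substY, ← Valuation.mem_integer_iff] at *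
  rw [add_mem_cancel_right hr]
  refine and_congr_right fun h => ?_
  rw [add_mem_cancel_right ht, mul_assoc, add_mem_cancel_right (mul_mem hs h)]

lemma valuation_partial_smul_lt_one_iff (W : WeierstrassCurve F) {C : VariableChange F}
    (hu : 𝓿 (C.u : F) = 1) (hs : 𝓿 C.s ≤ 1) (x y : F) :
    𝓿 (partialX (C • W) x y) < 1 ∧ 𝓿 (partialY (C • W) x y) < 1 ↔
      𝓿 (partialX W (substX C x) (substY C x y)) < 1 ∧
        𝓿 (partialY W (substX C x) (substY C x y)) < 1 := by
  have hX : 𝓿 (C.u ^ 4 * partialX (C • W) x y) = 𝓿 (partialX (C • W) x y) := by simp [hu]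
  have hY : 𝓿 (C.u ^ 3 * partialY (C • W) x y) = 𝓿 (partialY (C • W) x y) := by simp [hu]
  rw [← hX, ← hY, partialX_smul, partialY_smul]
  refine and_congr_left fun h => ?_
  have hsY : 𝓿 (C.s * partialY W (substX C x) (substY C x y)) < 1 := by
    rw [map_mul]; exact (mul_le_of_le_one_left' hs).trans_lt h
  exact ⟨fun H => by simpa using Valuation.map_sub_lt _ H hsY,
    fun H => Valuation.map_add_lt _ H hsY⟩

lemma hasNonsingularReduction_substPoint_iff (W : WeierstrassCurve F) {C : VariableChange F}
    (hu : 𝓿 (C.u : F) = 1) (hr : 𝓿 C.r ≤ 1) (hs : 𝓿 C.s ≤ 1) (ht : 𝓿 C.t ≤ 1)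
    (P : (C • W).toAffine.Point) :
    HasNonsingularReduction R W (substPoint C W P) ↔ HasNonsingularReduction R (C • W) P := by
  rcases P with _ | ⟨x, y, h⟩
  · exact Iff.rfl
  · simp only [HasNonsingularReduction, substPoint]
    rw [valuation_substX_substY_le_one_iff hu hr hs ht, valuation_partial_smul_lt_one_iff W hu hs]

open Classical in
lemma map_substPointEquiv_closure (W : WeierstrassCurve F) (hΔ : W.Δ ≠ 0) [W.IsMinimal R]
    (C : VariableChange F) [(C • W).IsMinimal R] :
    (AddSubgroup.closure {P | HasNonsingularReduction R (C • W) P}).map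
        (substPointEquiv C W).toAddMonoidHom =
      AddSubgroup.closure {P | HasNonsingularReduction R W P} := by
  have hu := valuation_u_eq_one (R := R) W hΔ C
  obtain ⟨u, hu'⟩ := (valuation_le_one_iff_mem_range R _).mp hu.le
  have hr := (valuation_le_one_iff_mem_range R _).mpr (variableChange_r_mem_range W C hu')
  have hs := (valuation_le_one_iff_mem_range R _).mpr (variableChange_s_mem_range W C hu')
  have ht := (valuation_le_one_iff_mem_range R _).mpr (variableChange_t_mem_range W C hu')
  rw [AddMonoidHom.map_closure]
  congr 1
  ext P
  obtain ⟨Q, rfl⟩ := (substPointEquiv C W).surjective P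
  simpa [substPointEquiv_apply, (substPoint_injective C W).eq_iff] using
    (hasNonsingularReduction_substPoint_iff W hu hr hs ht Q).symm

variable (R) in
open Classical in
theorem tamagawaFactor_of_isMinimal (W : WeierstrassCurve F) (hΔ : W.Δ ≠ 0) [W.IsMinimal R] :
    W.tamagawaFactor R =
      (AddSubgroup.closure {P : W.toAffine.Point | HasNonsingularReduction R W P}).index := by
  obtain ⟨C, hC⟩ : ∃ C : VariableChange F, C = (W.exists_isMinimal R).choose := ⟨_, rfl⟩
  have : (C • W).IsMinimal R := by rw [hC]; exact (W.exists_isMinimal R).choose_spec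
  rw [tamagawaFactor, nonsingularReductionSubgroup_eq_closure, minimal, ← hC,
    ← map_substPointEquiv_closure W hΔ C]
  exact (AddSubgroup.index_map_equiv _ (substPointEquiv C W)).symm

theorem tamagawaFactor_of_valuation_Δ_eq_one (W : WeierstrassCurve F) [W.IsMinimal R]
    (hΔ : 𝓿 W.Δ = 1) : W.tamagawaFactor R = 1 := by
  classical
  have hΔ0 : W.Δ ≠ 0 := fun h => by simp [h] at hΔ
  have hgood : W.HasGoodReduction R := ⟨hΔ⟩
  have := (hasGoodReduction_iff_isElliptic_reduction R).mp hgood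
  rw [tamagawaFactor_of_isMinimal R W hΔ0, AddSubgroup.index_eq_one, eq_top_iff]
  refine fun P _ => AddSubgroup.subset_closure ?_
  rcases P with _ | ⟨x, y, h⟩
  · trivial
  · rintro ⟨hx, hy⟩
    obtain ⟨x, rfl⟩ := (valuation_le_one_iff_mem_range R x).mp hx
    obtain ⟨y, rfl⟩ := (valuation_le_one_iff_mem_range R y).mp hy
    rw [← nonsingular_reduction_iff W h.1, ← Affine.equation_iff_nonsingular]
    exact equation_reduction W h.1

end MinimalModel

/-! ### Points avoiding a singular reduction -/

section CongruentCurve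

variable {F : Type*} [Field F]

/-- The curve `y² = x³ - a² x`, which is the quadratic twist of `E₁` by `a`. -/
def congruentCurve (a : F) : WeierstrassCurve F where
  a₁ := 0
  a₂ := 0
  a₃ := 0
  a₄ := -a ^ 2
  a₆ := 0

lemma congruentCurve_Δ (a : F) : (congruentCurve a).Δ = 64 * a ^ 6 := by
  simp only [congruentCurve, Δ, b₂, b₄, b₆, b₈]
  ring

lemma congruentCurve_equation_iff {a x y : F} :
    (congruentCurve a).toAffine.Equation x y ↔ y ^ 2 = x ^ 3 - a ^ 2 * x := by
  rw [Affine.equation_iff]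
  simp [congruentCurve, sub_eq_add_neg]

lemma congruentCurve_nonsingular_iff {a x y : F} (h2 : (2 : F) ≠ 0) (ha : a ≠ 0) :
    (congruentCurve a).toAffine.Nonsingular x y ↔ y ^ 2 = x ^ 3 - a ^ 2 * x := by
  rw [← congruentCurve_equation_iff, Affine.equation_iff_nonsingular_of_Δ_ne_zero]
  rw [congruentCurve_Δ, show (64 : F) = 2 ^ 6 by norm_num]
  positivity

lemma congruentCurve_negY (a x y : F) : (congruentCurve a).toAffine.negY x y = -y := by
  simp [congruentCurve, Affine.negY]

lemma partialX_congruentCurve (a x y : F) :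
    partialX (congruentCurve a) x y = -(3 * x ^ 2 - a ^ 2) := by
  simp only [partialX, congruentCurve]
  ring

lemma partialY_congruentCurve (a x y : F) : partialY (congruentCurve a) x y = 2 * y := by
  simp only [partialY, congruentCurve]
  ring

-- The product formula is the value at `e` of the cubic cut out by the line of slope `l`.
lemma congruentCurve_add [DecidableEq F] {a e x₁ x₂ y₁ y₂ : F} (he : e ^ 3 = a ^ 2 * e)
    (h₁ : (congruentCurve a).toAffine.Nonsingular x₁ y₁)
    (h₂ : (congruentCurve a).toAffine.Nonsingular x₂ y₂) (h : ¬(x₁ = x₂ ∧ y₁ = -y₂)) :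
    ∃ (l x₃ y₃ : F) (h₃ : (congruentCurve a).toAffine.Nonsingular x₃ y₃),
      (.some x₁ y₁ h₁ + .some x₂ y₂ h₂ : (congruentCurve a).toAffine.Point) = .some x₃ y₃ h₃ ∧
      (x₁ - e) * (x₂ - e) * (x₃ - e) = (y₃ + l * (x₃ - e)) ^ 2 ∧ x₁ + x₂ + x₃ = l ^ 2 := by
  have hxy : ¬(x₁ = x₂ ∧ y₁ = (congruentCurve a).toAffine.negY x₂ y₂) := by
    rwa [congruentCurve_negY]
  refine ⟨(congruentCurve a).toAffine.slope x₁ x₂ y₁ y₂, _, _, _, Affine.Point.add_some hxy, ?_, ?_⟩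
  · have H := congrArg (Polynomial.eval e) (Affine.addPolynomial_slope h₁.1 h₂.1 hxy)
    simp only [Affine.addY, congruentCurve_negY, Affine.negAddY]
    rw [Affine.addPolynomial_eq] at H
    generalize (congruentCurve a).toAffine.slope x₁ x₂ y₁ y₂ = l at *
    generalize (congruentCurve a).toAffine.addX x₁ x₂ l = x₃ at *
    simp [Cubic.toPoly, congruentCurve] at H
    linear_combination -he - H
  · simp [Affine.addX, congruentCurve]

section Torsion

variable {a e : F} (hT : (congruentCurve a).toAffine.Nonsingular e 0)

lemma neg_torsion :
    -(.some e 0 hT : (congruentCurve a).toAffine.Point) = .some e 0 hT := by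
  rw [Affine.Point.neg_some, Affine.Point.some.injEq, congruentCurve_negY]
  simp

lemma torsion_add_self [DecidableEq F] :
    (.some e 0 hT + .some e 0 hT : (congruentCurve a).toAffine.Point) = 0 := by
  nth_rw 1 [← neg_torsion hT]
  exact neg_add_cancel _

variable (he : e ^ 3 = a ^ 2 * e)
include he

lemma ordinate_eq_zero {y : F} (h : (congruentCurve a).toAffine.Nonsingular e y) : y = 0 := by
  rw [← pow_eq_zero_iff two_ne_zero, congruentCurve_equation_iff.mp h.1, he, sub_self]

lemma add_torsion [DecidableEq F] {x y : F} (h : (congruentCurve a).toAffine.Nonsingular x y)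
    (hx : x ≠ e) :
    ∃ (x₃ y₃ : F) (h₃ : (congruentCurve a).toAffine.Nonsingular x₃ y₃),
      (.some x y h + .some e 0 hT : (congruentCurve a).toAffine.Point) = .some x₃ y₃ h₃ ∧
        (x₃ - e) * (x - e) = 3 * e ^ 2 - a ^ 2 := by
  refine ⟨_, _, _, Affine.Point.add_of_X_ne hx, ?_⟩
  have hxe : x - e ≠ 0 := sub_ne_zero.mpr hx
  have h₁ : (congruentCurve a).a₁ = 0 := rfl
  have h₂ : (congruentCurve a).a₂ = 0 := rfl
  rw [Affine.slope_of_X_ne hx]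
  simp only [Affine.addX, h₁, h₂]
  field_simp
  linear_combination congruentCurve_equation_iff.mp h.1 + he

end Torsion

lemma torsion_add_torsion [DecidableEq F] {a : F} (ha : a ≠ 0)
    (h₀ : (congruentCurve a).toAffine.Nonsingular 0 0)
    (h₁ : (congruentCurve a).toAffine.Nonsingular a 0)
    (h₂ : (congruentCurve a).toAffine.Nonsingular (-a) 0) :
    (.some a 0 h₁ + .some 0 0 h₀ : (congruentCurve a).toAffine.Point) = .some (-a) 0 h₂ := by
  obtain ⟨x₃, y₃, h₃, heq, hx₃⟩ := add_torsion h₀ (by ring) h₁ ha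
  obtain rfl : x₃ = -a := mul_right_cancel₀ ha (by linear_combination hx₃)
  obtain rfl := ordinate_eq_zero (by ring) h₃
  exact heq

end CongruentCurve

lemma one_le_valuation_of_mul_eq_sq {F Γ : Type*} [Field F] [LinearOrderedCommGroupWithZero Γ]
    (v : Valuation F Γ) {A B D y l : F} (hA : 1 ≤ v A) (hB : 1 ≤ v B) (hl : v l ^ 2 ≤ v A * v B)
    (hy : v y ^ 2 < v D) (h : A * B * D = (y + l * D) ^ 2) : 1 ≤ v D := by
  by_contra! hD
  have hD0 : 0 < v D := zero_le.trans_lt hy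
  have hAB : 1 ≤ v A * v B := one_le_mul hA hB
  have hABD : v A * v B * v D = v (y + l * D) ^ 2 := by rw [← map_pow, ← h, map_mul, map_mul]
  rcases le_total (v y) (v (l * D)) with hle | hle
  · have h₁ : v A * v B * v D ≤ (v l * v D) ^ 2 := by
      rw [hABD, ← map_mul]
      exact pow_le_pow_left' (v.map_add_le hle le_rfl) 2
    have h₂ : (v l * v D) ^ 2 ≤ v A * v B * v D * v D := by
      rw [mul_pow, sq (v D), ← mul_assoc]
      gcongr
    exact (h₁.trans h₂).not_gt
      (mul_lt_of_lt_one_right (mul_pos (zero_lt_one.trans_le hAB) hD0) hD)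
  · have h₁ : v A * v B * v D ≤ v y ^ 2 := by
      rw [hABD]
      exact pow_le_pow_left' (v.map_add_le le_rfl hle) 2
    exact (h₁.trans_lt hy).not_ge (le_mul_of_one_le_left' hAB)

section Reduction

variable {R : Type*} [CommRing R] [IsDomain R] [IsDiscreteValuationRing R]
  {F : Type*} [Field F] [Algebra R F] [IsFractionRing R F]

local notation "𝓿" => HeightOneSpectrum.valuation F (IsDiscreteValuationRing.maximalIdeal R)

lemma valuation_ofNat_le_one (n : ℕ) [n.AtLeastTwo] : 𝓿 (OfNat.ofNat n : F) ≤ 1 := by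
  rw [valuation_le_one_iff_mem_range]
  exact ofNat_mem _ n

variable (R) in
/-- The point `(e, 0)` of `y² = x³ - a² x` is integral, and its reduction is a singular point. -/
structure IsSingularRoot (a e : F) : Prop where
  root : e ^ 3 = a ^ 2 * e
  valuation_le_one : 𝓿 e ≤ 1
  valuation_deriv_lt_one : 𝓿 (3 * e ^ 2 - a ^ 2) < 1

variable (R) in
/-- The reduction of the point differs from that of `(e, 0)`. -/
def AvoidsReduction (a e : F) : (congruentCurve a).toAffine.Point → Prop
  | .zero => True
  | .some x _ _ => ¬𝓿 (x - e) < 1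

lemma avoidsReduction_neg {a e : F} {P : (congruentCurve a).toAffine.Point}
    (hP : AvoidsReduction R a e P) : AvoidsReduction R a e (-P) := by
  rcases P with _ | ⟨x, y, h⟩ <;> exact hP

variable {a e : F} (he : IsSingularRoot R a e)
include he

lemma valuation_sq_lt {x y : F} (h : y ^ 2 = x ^ 3 - a ^ 2 * x) (hx : 𝓿 (x - e) < 1)
    (hxe : x ≠ e) : 𝓿 y ^ 2 < 𝓿 (x - e) := by
  have hpos : 0 < 𝓿 (x - e) := zero_lt_iff.mpr ((map_ne_zero _).mpr (sub_ne_zero.mpr hxe))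
  have hfactor : y ^ 2 = (x - e) * ((x - e) * ((x - e) + 3 * e) + (3 * e ^ 2 - a ^ 2)) := by
    linear_combination h + he.root
  rw [← map_pow, hfactor, map_mul]
  refine mul_lt_of_lt_one_right hpos (Valuation.map_add_lt _ ?_ he.valuation_deriv_lt_one)
  rw [map_mul]
  refine (mul_le_of_le_one_right' (Valuation.map_add_le _ hx.le ?_)).trans_lt hx
  rw [map_mul]
  exact mul_le_one' (valuation_ofNat_le_one 3) he.valuation_le_one

section Subgroup

variable [DecidableEq F]

lemma not_avoidsReduction_add_torsion (hT : (congruentCurve a).toAffine.Nonsingular e 0)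
    {P : (congruentCurve a).toAffine.Point} (hP : AvoidsReduction R a e P) :
    ¬AvoidsReduction R a e (P + .some e 0 hT) := by
  rcases P with _ | ⟨x, y, h⟩
  · simp [AvoidsReduction, ← Affine.Point.zero_def]
  · have hx : x ≠ e := by rintro rfl; simp [AvoidsReduction] at hP
    obtain ⟨x₃, y₃, h₃, heq, hx₃⟩ := add_torsion hT he.root h hx
    rw [heq, AvoidsReduction, not_lt]
    intro hle
    have hlt := he.valuation_deriv_lt_one
    rw [← hx₃, map_mul] at hlt
    exact hlt.not_ge (one_le_mul hle (not_lt.mp hP))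

lemma avoidsReduction_add {P Q : (congruentCurve a).toAffine.Point}
    (hP : AvoidsReduction R a e P) (hQ : AvoidsReduction R a e Q) :
    AvoidsReduction R a e (P + Q) := by
  rcases P with _ | ⟨x₁, y₁, h₁⟩
  · exact hQ
  rcases Q with _ | ⟨x₂, y₂, h₂⟩
  · exact hP
  by_cases h : x₁ = x₂ ∧ y₁ = -y₂
  · rw [Affine.Point.add_of_Y_eq h.1 (by rw [h.2, congruentCurve_negY])]
    trivial
  obtain ⟨l, x₃, y₃, h₃, heq, hprod, hsum⟩ := congruentCurve_add he.root h₁ h₂ h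
  rw [heq]
  intro hD
  have hA := not_lt.mp hP
  have hB := not_lt.mp hQ
  have hx₃ : x₃ ≠ e := by
    rintro rfl
    obtain rfl := ordinate_eq_zero he.root h₃
    refine not_avoidsReduction_add_torsion he h₃ (avoidsReduction_neg hP) ?_
    rw [← heq, neg_add_cancel_left]
    exact hQ
  have hl : 𝓿 l ^ 2 ≤ 𝓿 (x₁ - e) * 𝓿 (x₂ - e) := by
    have hAB := one_le_mul hA hB
    rw [← map_pow, ← hsum, show x₁ + x₂ + x₃ = (x₁ - e) + (x₂ - e) + ((x₃ - e) + 3 * e) by ring]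
    refine Valuation.map_add_le _ (Valuation.map_add_le _ (le_mul_of_one_le_right' hB)
      (le_mul_of_one_le_left' hA)) (Valuation.map_add_le _ (hD.le.trans hAB) ?_)
    rw [map_mul]
    exact (mul_le_one' (valuation_ofNat_le_one 3) he.valuation_le_one).trans hAB
  exact hD.not_ge (one_le_valuation_of_mul_eq_sq _ hA hB hl
    (valuation_sq_lt he (congruentCurve_equation_iff.mp h₃.1) hD hx₃) hprod)

/-- The subgroup of the points whose reduction is not the singular point `(e, 0)`. -/
def avoidsReductionSubgroup : AddSubgroup (congruentCurve a).toAffine.Point where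
  carrier := {P | AvoidsReduction R a e P}
  zero_mem' := trivial
  add_mem' := avoidsReduction_add he
  neg_mem' := avoidsReduction_neg

lemma some_mem_avoidsReductionSubgroup {x y : F}
    (h : (congruentCurve a).toAffine.Nonsingular x y) :
    .some x y h ∈ avoidsReductionSubgroup he ↔ 1 ≤ 𝓿 (x - e) := by
  rw [← not_lt]
  exact Iff.rfl

end Subgroup

lemma valuation_lt_one_of_reduces {x y : F} (h : y ^ 2 = x ^ 3 - a ^ 2 * x)
    (hx : 𝓿 (x - e) < 1) : 𝓿 x ≤ 1 ∧ 𝓿 y < 1 ∧ 𝓿 (3 * x ^ 2 - a ^ 2) < 1 := by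
  have hvx : 𝓿 x ≤ 1 := by simpa using Valuation.map_add_le _ hx.le he.valuation_le_one
  refine ⟨hvx, ?_, ?_⟩
  · rw [← pow_lt_one_iff two_ne_zero]
    by_cases hxe : x = e
    · rw [← map_pow, h, hxe, he.root, sub_self, map_zero]
      exact zero_lt_one
    · exact (valuation_sq_lt he h hx hxe).trans hx
  · rw [show 3 * x ^ 2 - a ^ 2 = (x - e) * (3 * (x + e)) + (3 * e ^ 2 - a ^ 2) by ring]
    refine Valuation.map_add_lt _ ?_ he.valuation_deriv_lt_one
    rw [map_mul, map_mul]
    exact (mul_le_of_le_one_right' (mul_le_one' (valuation_ofNat_le_one 3)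
      (Valuation.map_add_le _ hvx he.valuation_le_one))).trans_lt hx

open Classical in
theorem tamagawaFactor_congruentCurve (hΔ : (congruentCurve a).Δ ≠ 0)
    [(congruentCurve a).IsMinimal R]
    (hsing : ∀ x y : F, y ^ 2 = x ^ 3 - a ^ 2 * x → 𝓿 x ≤ 1 → 𝓿 y ≤ 1 →
      𝓿 (3 * x ^ 2 - a ^ 2) < 1 → 𝓿 (2 * y) < 1 → 𝓿 (x - e) < 1) :
    (congruentCurve a).tamagawaFactor R = (avoidsReductionSubgroup he).index := by
  rw [tamagawaFactor_of_isMinimal R _ hΔ, ← AddSubgroup.closure_eq (avoidsReductionSubgroup he)]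
  congr 2
  ext P
  rcases P with _ | ⟨x, y, h⟩
  · exact Iff.rfl
  · have hy := congruentCurve_equation_iff.mp h.1
    change (_ → ¬(𝓿 _ < 1 ∧ 𝓿 _ < 1)) ↔ ¬𝓿 (x - e) < 1
    rw [partialX_congruentCurve, partialY_congruentCurve, Valuation.map_neg]
    constructor
    · intro H hx
      obtain ⟨hvx, hvy, hX⟩ := valuation_lt_one_of_reduces he hy hx
      refine H ⟨hvx, hvy.le⟩ ⟨hX, ?_⟩
      rw [map_mul]
      exact (mul_le_of_le_one_left' (valuation_ofNat_le_one 2)).trans_lt hvy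
    · rintro H ⟨hx, hy'⟩ ⟨h1, h2⟩
      exact H (hsing x y hy hx hy' h1 h2)

end Reduction

section SubgroupIndex

variable {G : Type*} [AddCommGroup G] (S : AddSubgroup G)

lemma index_eq_card_of_representatives {ι : Type*} [Fintype ι] (f : ι → G)
    (hinj : ∀ i j, f i - f j ∈ S → i = j) (hsurj : ∀ g, ∃ i, g - f i ∈ S) :
    S.index = Fintype.card ι := by
  rw [AddSubgroup.index, ← Nat.card_eq_fintype_card]
  refine (Nat.card_congr (Equiv.ofBijective (fun i => (f i : G ⧸ S)) ⟨fun i j h => ?_, ?_⟩)).symm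
  · refine (hinj j i ?_).symm
    rw [sub_eq_neg_add]
    exact QuotientAddGroup.eq.mp h
  · rintro ⟨g⟩
    obtain ⟨i, hi⟩ := hsurj g
    refine ⟨i, QuotientAddGroup.eq.mpr ?_⟩
    rwa [neg_add_eq_sub]

lemma index_eq_two_of_cover {A : G} (hA : A ∉ S) (hcover : ∀ g, g ∉ S → g - A ∈ S) :
    S.index = 2 := by
  rw [index_eq_card_of_representatives S ![0, A], Fintype.card_fin]
  · intro i j hij
    fin_cases i <;> fin_cases j <;> simp_all
  · intro g
    by_cases hg : g ∈ S
    · exact ⟨0, by simpa using hg⟩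
    · exact ⟨1, hcover g hg⟩

lemma index_eq_four_of_cover {A B : G} (hA : A ∉ S) (hB : B ∉ S) (hBA : B + A ∉ S)
    (hBA' : B - A ∉ S) (hcover : ∀ g, g ∉ S → g - A ∈ S ∨ g - B ∈ S ∨ g - (B + A) ∈ S) :
    S.index = 4 := by
  rw [index_eq_card_of_representatives S ![0, A, B, B + A], Fintype.card_fin]
  · have key : ∀ i j : Fin 4, i < j → ![0, A, B, B + A] j - ![0, A, B, B + A] i ∉ S := by
      intro i j hij
      fin_cases i <;> fin_cases j <;> simp_all
    intro i j hij
    rcases lt_trichotomy i j with h | h | h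
    · exact absurd (by simpa using neg_mem hij) (key i j h)
    · exact h
    · exact absurd hij (key j i h)
  · intro g
    by_cases hg : g ∈ S
    · exact ⟨0, by simpa using hg⟩
    · rcases hcover g hg with h | h | h
      exacts [⟨1, h⟩, ⟨2, h⟩, ⟨3, h⟩]

end SubgroupIndex

section ValueGroup

lemma sq_ne_exp_of_odd (g : WithZero (Multiplicative ℤ)) {k : ℤ} (hk : Odd k) :
    g ^ 2 ≠ exp k := by
  intro h
  have hlog := congrArg log h
  simp only [log_pow, log_exp, nsmul_eq_mul, Nat.cast_ofNat] at hlog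
  exact Int.not_even_iff_odd.mpr hk ⟨log g, by omega⟩

lemma lt_one_iff_le_exp_neg_one (g : WithZero (Multiplicative ℤ)) : g < 1 ↔ g ≤ exp (-1) := by
  rcases eq_or_ne g 0 with rfl | hg
  · simp
  · rw [← exp_log hg, ← exp_zero, exp_lt_exp, exp_le_exp]
    omega

lemma eq_exp_neg_one_or_le {g : WithZero (Multiplicative ℤ)} (h : g < 1) :
    g = exp (-1) ∨ g ≤ exp (-2) := by
  rcases eq_or_ne g 0 with rfl | hg
  · simp
  · rw [← exp_log hg, ← exp_zero, exp_lt_exp] at h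
    rw [← exp_log hg, exp_le_exp, exp_inj]
    omega

end ValueGroup

section Index

variable {R : Type*} [CommRing R] [IsDomain R] [IsDiscreteValuationRing R]
  {F : Type*} [Field F] [DecidableEq F] [Algebra R F] [IsFractionRing R F]

local notation "𝓿" => HeightOneSpectrum.valuation F (IsDiscreteValuationRing.maximalIdeal R)

variable {a e : F} (he : IsSingularRoot R a e)

lemma torsion_notMem (hT : (congruentCurve a).toAffine.Nonsingular e 0) :
    .some e 0 hT ∉ avoidsReductionSubgroup he := by
  simp [some_mem_avoidsReductionSubgroup]

lemma sub_torsion_mem {x y f : F} (hf : f ^ 3 = a ^ 2 * f) (hfe : 𝓿 (f - e) < 1)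
    (h : (congruentCurve a).toAffine.Nonsingular x y)
    (hT : (congruentCurve a).toAffine.Nonsingular f 0) (hx : 𝓿 (x - f) ≤ 𝓿 (3 * f ^ 2 - a ^ 2)) :
    .some x y h - .some f 0 hT ∈ avoidsReductionSubgroup he := by
  rw [sub_eq_add_neg, neg_torsion]
  by_cases hxf : x = f
  · subst hxf
    obtain rfl := ordinate_eq_zero hf h
    rw [torsion_add_self]
    exact zero_mem _
  · obtain ⟨x₃, y₃, h₃, heq, hx₃⟩ := add_torsion hT hf h hxf
    rw [heq, some_mem_avoidsReductionSubgroup]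
    have hpos : 0 < 𝓿 (x - f) := zero_lt_iff.mpr ((map_ne_zero _).mpr (sub_ne_zero.mpr hxf))
    have hle : 1 ≤ 𝓿 (x₃ - f) := by
      rw [← hx₃, map_mul] at hx
      by_contra! hlt
      exact hx.not_gt (mul_lt_of_lt_one_left hpos hlt)
    rwa [show x₃ - e = (x₃ - f) + (f - e) by ring,
      Valuation.map_add_eq_of_lt_left _ (hfe.trans_le hle)]

lemma index_avoidsReductionSubgroup_eq_two (hT : (congruentCurve a).toAffine.Nonsingular e 0)
    (H : ∀ x y : F, y ^ 2 = x ^ 3 - a ^ 2 * x → 𝓿 (x - e) < 1 →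
      𝓿 (x - e) ≤ 𝓿 (3 * e ^ 2 - a ^ 2)) :
    (avoidsReductionSubgroup he).index = 2 := by
  refine index_eq_two_of_cover _ (torsion_notMem he hT) ?_
  rintro (_ | ⟨x, y, h⟩) hg
  · exact absurd (zero_mem _) hg
  · rw [some_mem_avoidsReductionSubgroup, not_le] at hg
    exact sub_torsion_mem he he.root (by simp) h hT
      (H x y (congruentCurve_equation_iff.mp h.1) hg)

omit [DecidableEq F] in
lemma ne_of_valuation_sub_eq_exp {x : F} {k : ℤ} (hx : 𝓿 (x - e) = exp k) : x ≠ e := by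
  rintro rfl
  rw [sub_self, map_zero] at hx
  exact exp_ne_zero hx.symm

lemma add_torsion_notMem (hT : (congruentCurve a).toAffine.Nonsingular e 0)
    (hc : 𝓿 (3 * e ^ 2 - a ^ 2) = exp (-2)) {x y : F}
    (h : (congruentCurve a).toAffine.Nonsingular x y) (hx : 𝓿 (x - e) = exp (-1)) :
    .some x y h + .some e 0 hT ∉ avoidsReductionSubgroup he := by
  obtain ⟨x₃, y₃, h₃, heq, hx₃⟩ := add_torsion hT he.root h (ne_of_valuation_sub_eq_exp hx)
  rw [heq, some_mem_avoidsReductionSubgroup, not_le]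
  have hmul := congrArg 𝓿 hx₃
  rw [map_mul, hc, hx, show exp (-2 : ℤ) = exp (-1) * exp (-1) by rw [← exp_add]; rfl] at hmul
  rw [mul_right_cancel₀ exp_ne_zero hmul, ← exp_zero, exp_lt_exp]
  norm_num

include he in
-- The product of the three valuations would be a square of odd order.
lemma add_ne_of_valuation_sub_eq_exp_neg_one {x₁ x₂ x₃ y₁ y₂ y₃ : F}
    (h₁ : (congruentCurve a).toAffine.Nonsingular x₁ y₁)
    (h₂ : (congruentCurve a).toAffine.Nonsingular x₂ y₂)
    (h₃ : (congruentCurve a).toAffine.Nonsingular x₃ y₃) (hx₁ : 𝓿 (x₁ - e) = exp (-1))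
    (hx₂ : 𝓿 (x₂ - e) = exp (-1)) (hx₃ : 𝓿 (x₃ - e) = exp (-1)) :
    (.some x₁ y₁ h₁ + .some x₂ y₂ h₂ : (congruentCurve a).toAffine.Point) ≠ .some x₃ y₃ h₃ := by
  intro hsum
  have hne : ¬(x₁ = x₂ ∧ y₁ = -y₂) := by
    rintro ⟨hx, hy⟩
    rw [Affine.Point.add_of_Y_eq hx (by rw [hy, congruentCurve_negY])] at hsum
    exact Affine.Point.some_ne_zero h₃ hsum.symm
  obtain ⟨l, x, y, h, heq, hprod, -⟩ := congruentCurve_add he.root h₁ h₂ hne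
  obtain ⟨rfl, -⟩ := Affine.Point.some.inj (hsum.symm.trans heq)
  have hsq := congrArg 𝓿 hprod
  rw [map_mul, map_mul, hx₁, hx₂, hx₃, map_pow, ← exp_add, ← exp_add] at hsq
  exact sq_ne_exp_of_odd _ (by decide) hsq.symm

lemma sub_torsion_mem_or_eq_exp_neg_one (hT : (congruentCurve a).toAffine.Nonsingular e 0)
    (hc : 𝓿 (3 * e ^ 2 - a ^ 2) = exp (-2)) {P : (congruentCurve a).toAffine.Point}
    (hP : P ∉ avoidsReductionSubgroup he) :
    P - .some e 0 hT ∈ avoidsReductionSubgroup he ∨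
      ∃ x y h, P = .some x y h ∧ 𝓿 (x - e) = exp (-1) := by
  rcases P with _ | ⟨x, y, h⟩
  · exact absurd (zero_mem _) hP
  · rw [some_mem_avoidsReductionSubgroup, not_le] at hP
    refine (eq_exp_neg_one_or_le hP).symm.imp (fun hx => ?_) fun hx => ⟨x, y, h, rfl, hx⟩
    exact sub_torsion_mem he he.root (by simp) h hT (hx.trans_eq hc.symm)

lemma index_avoidsReductionSubgroup_eq_four (hT : (congruentCurve a).toAffine.Nonsingular e 0)
    (hc : 𝓿 (3 * e ^ 2 - a ^ 2) = exp (-2)) {x₀ y₀ : F}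
    (h₀ : (congruentCurve a).toAffine.Nonsingular x₀ y₀) (hx₀ : 𝓿 (x₀ - e) = exp (-1)) :
    (avoidsReductionSubgroup he).index = 4 := by
  have hsum := add_torsion_notMem he hT hc h₀ hx₀
  refine index_eq_four_of_cover _ (A := .some e 0 hT) (B := .some x₀ y₀ h₀)
    (torsion_notMem he hT) ?_ hsum (by rwa [sub_eq_add_neg, neg_torsion]) fun P hP => ?_
  · rw [some_mem_avoidsReductionSubgroup, hx₀, ← exp_zero, exp_le_exp]
    norm_num
  · rcases sub_torsion_mem_or_eq_exp_neg_one he hT hc hP with hP | ⟨x, y, h, rfl, hx⟩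
    · exact .inl hP
    · refine .inr (or_iff_not_imp_left.mpr fun hQ => ?_)
      rw [← sub_sub]
      refine (sub_torsion_mem_or_eq_exp_neg_one he hT hc hQ).resolve_right ?_
      rintro ⟨x', y', h', hQ', hx'⟩
      exact add_ne_of_valuation_sub_eq_exp_neg_one he h' h₀ h hx' hx₀ hx
        (eq_add_of_sub_eq hQ').symm

lemma index_avoidsReductionSubgroup_zero_eq_four (h2 : (2 : F) ≠ 0) (ha0 : a ≠ 0)
    (h0 : IsSingularRoot R a 0) (ha : 𝓿 a < 1)
    (H : ∀ x y : F, y ^ 2 = x ^ 3 - a ^ 2 * x → 𝓿 x < 1 →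
      𝓿 x ≤ 𝓿 (a ^ 2) ∨ 𝓿 (x - a) ≤ 𝓿 (2 * a ^ 2) ∨ 𝓿 (x + a) ≤ 𝓿 (2 * a ^ 2)) :
    (avoidsReductionSubgroup h0).index = 4 := by
  have h₀ := (congruentCurve_nonsingular_iff h2 ha0 (x := 0) (y := 0)).mpr (by ring)
  have h₁ := (congruentCurve_nonsingular_iff h2 ha0 (x := a) (y := 0)).mpr (by ring)
  have h₂ := (congruentCurve_nonsingular_iff h2 ha0 (x := -a) (y := 0)).mpr (by ring)
  have hsum := torsion_add_torsion ha0 h₀ h₁ h₂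
  have hmem : .some (-a) 0 h₂ ∉ avoidsReductionSubgroup h0 := by
    rwa [some_mem_avoidsReductionSubgroup, not_le, sub_zero, Valuation.map_neg]
  refine index_eq_four_of_cover _ (A := .some 0 0 h₀) (B := .some a 0 h₁)
    (torsion_notMem h0 h₀) ?_ (hsum ▸ hmem) (by rwa [sub_eq_add_neg, neg_torsion, hsum]) ?_
  · rwa [some_mem_avoidsReductionSubgroup, not_le, sub_zero]
  · rintro (_ | ⟨x, y, h⟩) hg
    · exact absurd (zero_mem _) hg
    rw [some_mem_avoidsReductionSubgroup, not_le, sub_zero] at hg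
    rw [hsum]
    refine (H x y (congruentCurve_equation_iff.mp h.1) hg).imp (fun hx => ?_)
      (.imp (fun hx => ?_) fun hx => ?_)
    · exact sub_torsion_mem h0 (by ring) (by simp) h h₀ (by simpa using hx)
    · refine sub_torsion_mem h0 (by ring) (by simpa using ha) h h₁ ?_
      rwa [show 3 * a ^ 2 - a ^ 2 = 2 * a ^ 2 by ring]
    · refine sub_torsion_mem h0 (by ring) (by simpa using ha) h h₂ ?_
      rwa [show 3 * (-a) ^ 2 - a ^ 2 = 2 * a ^ 2 by ring, sub_neg_eq_add]

end Index

/-! ### Tamagawa factors of `y² = x³ - a²x` -/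

section ValueGroup

lemma exp_lt_one {k : ℤ} (hk : k < 0) : exp k < 1 := by rwa [← exp_zero, exp_lt_exp]

lemma ne_zero_of_valuation_eq_exp {F : Type*} [Field F]
    {v : Valuation F (WithZero (Multiplicative ℤ))} {x : F} {k : ℤ} (h : v x = exp k) : x ≠ 0 := by
  rintro rfl
  rw [map_zero] at h
  exact exp_ne_zero h.symm

lemma valuation_three {F : Type*} [Field F] {Γ : Type*} [LinearOrderedCommGroupWithZero Γ]
    {v : Valuation F Γ} (h2 : v (2 : F) < 1) : v (3 : F) = 1 := by
  rw [show (3 : F) = 1 + 2 by norm_num, Valuation.map_one_add_of_lt _ h2]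

end ValueGroup

section CongruencesModTwo

variable {R : Type*} [CommRing R]

lemma sixteen_dvd_c₄ (h2 : Prime (2 : R)) (W : WeierstrassCurve R) (h : 2 ∣ W.c₄) :
    16 ∣ W.c₄ := by
  have ha₁ : 2 ∣ W.a₁ := by
    refine h2.dvd_of_dvd_pow (n := 4) ?_
    have hc₄ : W.a₁ ^ 4 = W.c₄ - 2 * (4 * (W.a₁ ^ 2 * W.a₂ + 2 * W.a₂ ^ 2 - 6 * W.a₄ -
        3 * (W.a₁ * W.a₃))) := by
      simp only [c₄, b₂, b₄]; ring
    exact hc₄ ▸ dvd_sub h (dvd_mul_right 2 _)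
  obtain ⟨z, hz⟩ := ha₁
  exact ⟨(z ^ 2 + W.a₂) ^ 2 - 3 * (W.a₄ + z * W.a₃), by simp only [c₄, b₂, b₄, hz]; ring⟩

lemma four_dvd_sq_add_one [IsDomain R] {r σ t : R} (h2 : (2 : R) ≠ 0) (ht : t * 3 = 1)
    (hσ : r ^ 2 - 1 = 2 * σ) (h : 16 ∣ 3 * (r ^ 2 - 1) ^ 2 - 4) : 4 ∣ σ ^ 2 + 1 := by
  obtain ⟨z, hz⟩ := h
  have hσz : 3 * σ ^ 2 - 1 = 4 * z := by
    refine mul_left_cancel₀ (pow_ne_zero 2 h2) ?_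
    rw [hσ] at hz
    linear_combination hz
  exact ⟨(z + 1) * t, by linear_combination (-(σ ^ 2 + 1)) * ht + t * hσz⟩

end CongruencesModTwo

section Minimality

variable {R : Type*} [CommRing R] [IsDomain R] [IsDiscreteValuationRing R]
  {F : Type*} [Field F] [Algebra R F] [IsFractionRing R F]

local notation "𝓿" => HeightOneSpectrum.valuation F (IsDiscreteValuationRing.maximalIdeal R)

lemma dvd_iff_valuation_le {x y : R} :
    y ∣ x ↔ 𝓿 (algebraMap R F x) ≤ 𝓿 (algebraMap R F y) := by
  constructor
  · rintro ⟨z, rfl⟩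
    rw [map_mul, map_mul]
    exact mul_le_of_le_one_right' (valuation_le_one _ z)
  · intro h
    have hy := IsFractionRing.to_map_eq_zero_iff (K := F) (x := y)
    by_cases hy0 : y = 0
    · rw [hy.mpr hy0, map_zero, le_zero_iff, map_eq_zero,
        IsFractionRing.to_map_eq_zero_iff] at h
      exact h ▸ dvd_zero y
    · obtain ⟨z, hz⟩ := (valuation_le_one_iff_mem_range R (algebraMap R F x / algebraMap R F y)).mp
        (by rw [map_div₀]; exact div_le_one_of_le₀ h zero_le)
      refine ⟨z, IsFractionRing.injective R F ?_⟩
      rw [map_mul, hz, mul_div_cancel₀ _ (hy.not.mpr hy0)]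

lemma prime_of_valuation_eq {π : R} (hπ : 𝓿 (algebraMap R F π) = exp (-1)) : Prime π := by
  have hdvd (x : R) : π ∣ x ↔ 𝓿 (algebraMap R F x) < 1 := by
    rw [dvd_iff_valuation_le (F := F), hπ, lt_one_iff_le_exp_neg_one]
  refine ⟨fun h => ?_, fun h => ?_, fun x y hxy => ?_⟩
  · exact ne_zero_of_valuation_eq_exp hπ (by rw [h, map_zero])
  · simpa using (hdvd 1).mp h.dvd
  · by_contra! H
    rw [hdvd, hdvd, not_lt, not_lt] at H
    rw [hdvd, map_mul, map_mul] at hxy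
    exact hxy.not_ge (one_le_mul H.1 H.2)

lemma isMinimal_of_forall (W : WeierstrassCurve F) [hW : W.IsIntegral R]
    (H : ∀ C : VariableChange F, (C • W).IsIntegral R → ¬𝓿 (C.u : F) < 1) : W.IsMinimal R := by
  refine ⟨⟨by simpa using hW, fun C hC _ => ?_⟩⟩
  have hC' : (C • W).IsIntegral R := hC
  rw [← Subtype.coe_le_coe]
  simp only [one_smul]
  rw [valuation_Δ_aux_eq_of_isIntegral, valuation_Δ_aux_eq_of_isIntegral, variableChange_Δ, map_mul,
    map_pow, Units.val_inv_eq_inv_val, map_inv₀]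
  exact mul_le_of_le_one_left' (pow_le_one' (inv_le_one_of_one_le₀ (not_lt.mp (H C hC))) 12)

lemma valuation_Δ_le_pow (W : WeierstrassCurve F) (C : VariableChange F)
    [(C • W).IsIntegral R] : 𝓿 W.Δ ≤ 𝓿 (C.u : F) ^ 12 := by
  have hΔ : W.Δ = (C.u : F) ^ 12 * (C • W).Δ := by
    have hu : (C.u : F) ≠ 0 := C.u.ne_zero
    rw [variableChange_Δ, Units.val_inv_eq_inv_val]
    field_simp
  rw [hΔ, map_mul, map_pow]
  exact mul_le_of_le_one_right' ((valuation_le_one_iff_mem_range R _).mpr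
    (Δ_integral_of_isIntegral R (C • W)))

lemma isMinimal_of_exp_lt_valuation_Δ (W : WeierstrassCurve F) [W.IsIntegral R]
    (h : exp (-12) < 𝓿 W.Δ) : W.IsMinimal R := by
  refine isMinimal_of_forall W fun C hC hu => ?_
  have hpow : 𝓿 (C.u : F) ^ 12 ≤ exp (-1) ^ 12 :=
    pow_le_pow_left' ((lt_one_iff_le_exp_neg_one _).mp hu) 12
  rw [← exp_nsmul] at hpow
  exact (h.trans_le ((valuation_Δ_le_pow W C).trans hpow)).false

lemma valuation_u_eq_exp_neg_one {W : WeierstrassCurve F} (h : 𝓿 W.Δ = exp (-12))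
    (C : VariableChange F) [(C • W).IsIntegral R] (hu : 𝓿 (C.u : F) < 1) :
    𝓿 (C.u : F) = exp (-1) := by
  have hpow := valuation_Δ_le_pow (R := R) W C
  refine le_antisymm ((lt_one_iff_le_exp_neg_one _).mp hu) ?_
  rw [h, show exp (-12 : ℤ) = exp (-1) ^ 12 by rw [← exp_nsmul]; rfl] at hpow
  exact le_of_pow_le_pow_left₀ (by norm_num) zero_le hpow

lemma isIntegral_congruentCurve {a : F} (ha : 𝓿 a ≤ 1) : (congruentCurve a).IsIntegral R := by
  obtain ⟨b, rfl⟩ := (valuation_le_one_iff_mem_range R a).mp ha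
  exact isIntegral_of_exists_lift R ⟨0, by simp [congruentCurve]⟩ ⟨0, by simp [congruentCurve]⟩
    ⟨0, by simp [congruentCurve]⟩ ⟨-b ^ 2, by simp [congruentCurve]⟩ ⟨0, by simp [congruentCurve]⟩

lemma valuation_congruentCurve_Δ (a : F) : 𝓿 (congruentCurve a).Δ = (𝓿 2 * 𝓿 a) ^ 6 := by
  rw [congruentCurve_Δ, show (64 : F) * a ^ 6 = (2 * a) ^ 6 by ring, map_pow, map_mul]

lemma valuation_congruentCurve_Δ_eq_exp {a : F} (h : 𝓿 2 * 𝓿 a = exp (-2)) :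
    𝓿 (congruentCurve a).Δ = exp (-12) := by
  rw [valuation_congruentCurve_Δ, h, ← exp_nsmul]
  rfl

lemma isMinimal_congruentCurve_of_exp_lt {a : F} (ha : 𝓿 a ≤ 1) (h : exp (-2) < 𝓿 2 * 𝓿 a) :
    (congruentCurve a).IsMinimal R := by
  have := isIntegral_congruentCurve (R := R) ha
  refine isMinimal_of_exp_lt_valuation_Δ _ ?_
  rw [valuation_congruentCurve_Δ, show exp (-12 : ℤ) = exp (-2) ^ 6 by rw [← exp_nsmul]; rfl]
  exact pow_lt_pow_left₀ h zero_le (by norm_num)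

lemma valuation_c₄_le (h2 : 𝓿 (2 : F) = exp (-1)) (W : WeierstrassCurve F) [W.IsIntegral R]
    (h : 𝓿 W.c₄ < 1) : 𝓿 W.c₄ ≤ exp (-4) := by
  rw [← integralModel_c₄_eq R W] at h ⊢
  rw [lt_one_iff_le_exp_neg_one, ← h2, ← map_ofNat (algebraMap R F), ← dvd_iff_valuation_le] at h
  have h16 := dvd_iff_valuation_le (F := F) |>.mp (sixteen_dvd_c₄
    (prime_of_valuation_eq (F := F) (by rwa [map_ofNat])) _ h)
  rwa [map_ofNat, show (16 : F) = 2 ^ 4 by norm_num, map_pow, h2, ← exp_nsmul] at h16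

lemma valuation_smul_congruentCurve_c₄ {a : F} (h2 : 𝓿 (2 : F) = exp (-1)) (ha : 𝓿 a = exp (-1))
    {C : VariableChange F} (hu : 𝓿 (C.u : F) = exp (-1)) :
    𝓿 (C • congruentCurve a).c₄ = exp (-2) := by
  have hc₄ : (congruentCurve a).c₄ = 3 * 2 ^ 4 * a ^ 2 := by
    simp only [c₄, b₂, b₄, congruentCurve]; ring
  rw [variableChange_c₄, hc₄, Units.val_inv_eq_inv_val]
  simp only [map_mul, map_pow, map_inv₀, hu, h2, ha, one_mul,
    valuation_three (h2 ▸ exp_lt_one (by norm_num) : 𝓿 (2 : F) < 1)]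
  rw [← exp_neg, ← exp_nsmul, ← exp_nsmul, ← exp_nsmul, ← exp_add, ← exp_add]
  rfl

-- On a smaller integral model `c₄` would have order `2`, but `c₄` is a fourth power modulo `2`.
lemma isMinimal_congruentCurve_of_two_mul {a : F} (h2 : 𝓿 (2 : F) = exp (-1))
    (ha : 𝓿 a = exp (-1)) : (congruentCurve a).IsMinimal R := by
  have := isIntegral_congruentCurve (R := R) (ha ▸ (exp_lt_one (by norm_num)).le : 𝓿 a ≤ 1)
  refine isMinimal_of_forall _ fun C hC hu => ?_
  have hΔ := valuation_congruentCurve_Δ_eq_exp (a := a) (by rw [h2, ha, ← exp_add]; rfl)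
  have hc₄ := valuation_smul_congruentCurve_c₄ h2 ha (valuation_u_eq_exp_neg_one hΔ C hu)
  have hle := valuation_c₄_le h2 (C • congruentCurve a) (hc₄ ▸ exp_lt_one (by norm_num))
  rw [hc₄, exp_le_exp] at hle
  norm_num at hle

lemma congruentCurve_b₈ (C : VariableChange F) :
    (C.u : F) ^ 8 * (C • congruentCurve (1 : F)).b₈ = 3 * C.r ^ 4 - 6 * C.r ^ 2 - 1 := by
  have hu : (C.u : F) ≠ 0 := C.u.ne_zero
  rw [variableChange_b₈, Units.val_inv_eq_inv_val]
  simp only [b₂, b₄, b₆, b₈, congruentCurve]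
  field_simp
  ring

lemma exists_mul_three_eq_one (h2 : 𝓿 (2 : F) < 1) : ∃ t : R, t * 3 = 1 := by
  have h3 := valuation_three h2
  obtain ⟨t, ht⟩ := (valuation_le_one_iff_mem_range R (3⁻¹ : F)).mp (by rw [map_inv₀, h3, inv_one])
  refine ⟨t, IsFractionRing.injective R F ?_⟩
  have h30 : (3 : F) ≠ 0 := fun h => by simp [h] at h3
  rw [map_mul, ht, map_ofNat, map_one, inv_mul_cancel₀ h30]

lemma exists_sixteen_dvd (h2 : 𝓿 (2 : F) = exp (-2)) {C : VariableChange F}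
    [(C • congruentCurve (1 : F)).IsIntegral R] (hu : 𝓿 (C.u : F) = exp (-1)) :
    ∃ r : R, 16 ∣ 3 * (r ^ 2 - 1) ^ 2 - 4 := by
  have := isIntegral_congruentCurve (R := R) (a := (1 : F)) (map_one _).le
  obtain ⟨u, hu'⟩ := (valuation_le_one_iff_mem_range R (C.u : F)).mp
    (hu ▸ (exp_lt_one (by norm_num)).le)
  obtain ⟨r, hr⟩ := variableChange_r_mem_range (congruentCurve (1 : F)) C hu'
  refine ⟨r, (dvd_iff_valuation_le (F := F)).mpr ?_⟩
  have hb₈ : algebraMap R F (3 * (r ^ 2 - 1) ^ 2 - 4) =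
      (C.u : F) ^ 8 * (C • congruentCurve (1 : F)).b₈ := by
    simp only [congruentCurve_b₈, ← hr, map_sub, map_mul, map_pow, map_one, map_ofNat]
    ring
  rw [hb₈, map_ofNat, show (16 : F) = 2 ^ 4 by norm_num, map_mul, map_pow, map_pow, hu, h2,
    ← exp_nsmul, ← exp_nsmul]
  exact mul_le_of_le_one_right'
    ((valuation_le_one_iff_mem_range R _).mpr ⟨_, integralModel_b₈_eq R _⟩)

lemma two_dvd_of_sixteen_dvd {x t : R} (ht : t * 3 = 1) (h : 16 ∣ 3 * x ^ 2 - 4) : 2 ∣ x := by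
  obtain ⟨z, hz⟩ := h
  rw [dvd_iff_valuation_le (F := FractionRing R)]
  refine le_of_pow_le_pow_left₀ two_ne_zero zero_le ?_
  rw [← map_pow, ← map_pow, ← map_pow, ← map_pow, ← dvd_iff_valuation_le]
  exact ⟨(1 + 4 * z) * t, by linear_combination (-x ^ 2) * ht + t * hz⟩

-- `r` is the abscissa of the origin of a smaller integral model.
lemma isMinimal_congruentCurve_one (h2 : 𝓿 (2 : F) = exp (-2))
    (H : ¬∃ r σ : R, r ^ 2 = 1 + 2 * σ ∧ 4 ∣ σ ^ 2 + 1) :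
    (congruentCurve (1 : F)).IsMinimal R := by
  have := isIntegral_congruentCurve (R := R) (a := (1 : F)) (map_one _).le
  refine isMinimal_of_forall _ fun C hC hu => H ?_
  have hΔ := valuation_congruentCurve_Δ_eq_exp (a := (1 : F)) (by rw [map_one, mul_one, h2])
  obtain ⟨r, hr⟩ := exists_sixteen_dvd (R := R) h2 (valuation_u_eq_exp_neg_one hΔ C hu)
  obtain ⟨t, ht⟩ := exists_mul_three_eq_one (R := R) (h2 ▸ exp_lt_one (by norm_num))
  obtain ⟨σ, hσ⟩ := two_dvd_of_sixteen_dvd ht hr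
  have h20 : (2 : R) ≠ 0 := fun h => ne_zero_of_valuation_eq_exp h2 (by
    rw [← map_ofNat (algebraMap R F), h, map_zero])
  exact ⟨r, σ, by linear_combination hσ, four_dvd_sq_add_one h20 ht hσ hr⟩

end Minimality

section Tamagawa

variable {R : Type*} [CommRing R] [IsDomain R] [IsDiscreteValuationRing R]
  {F : Type*} [Field F] [Algebra R F] [IsFractionRing R F]

local notation "𝓿" => HeightOneSpectrum.valuation F (IsDiscreteValuationRing.maximalIdeal R)

lemma congruentCurve_Δ_ne_zero {a : F} (h20 : (2 : F) ≠ 0) (ha0 : a ≠ 0) :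
    (congruentCurve a).Δ ≠ 0 := by
  rw [congruentCurve_Δ, show (64 : F) = 2 ^ 6 by norm_num]
  positivity

lemma isSingularRoot_self {a : F} (h2 : 𝓿 (2 : F) < 1) (ha : 𝓿 a ≤ 1) : IsSingularRoot R a a where
  root := by ring
  valuation_le_one := ha
  valuation_deriv_lt_one := by
    rw [show 3 * a ^ 2 - a ^ 2 = 2 * a ^ 2 by ring, map_mul, map_pow]
    exact (mul_le_of_le_one_right' (pow_le_one' ha 2)).trans_lt h2

lemma isSingularRoot_zero {a : F} (ha : 𝓿 a < 1) : IsSingularRoot R a 0 where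
  root := by ring
  valuation_le_one := by simp
  valuation_deriv_lt_one := by simpa [pow_lt_one_iff] using ha

lemma valuation_sub_lt_one_of_singular {a x : F} (h2 : 𝓿 (2 : F) < 1) (ha : 𝓿 a ≤ 1)
    (hx : 𝓿 x ≤ 1) (h : 𝓿 (3 * x ^ 2 - a ^ 2) < 1) : 𝓿 (x - a) < 1 := by
  rw [← pow_lt_one_iff two_ne_zero, ← map_pow,
    show (x - a) ^ 2 = (3 * x ^ 2 - a ^ 2) - 2 * (x ^ 2 + a * x - a ^ 2) by ring]
  refine Valuation.map_sub_lt _ h ?_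
  rw [map_mul]
  refine (mul_le_of_le_one_right' ?_).trans_lt h2
  rw [valuation_le_one_iff_mem_range] at *
  exact sub_mem (add_mem (pow_mem hx 2) (mul_mem ha hx)) (pow_mem ha 2)

lemma valuation_lt_one_of_singular {a x y : F} (ha : 𝓿 a < 1) (hxy : y ^ 2 = x ^ 3 - a ^ 2 * x)
    (hx : 𝓿 x ≤ 1) (hy : 𝓿 y ≤ 1) (h : 𝓿 (3 * x ^ 2 - a ^ 2) < 1) (h' : 𝓿 (2 * y) < 1) :
    𝓿 x < 1 := by
  have hasq : 𝓿 (a ^ 2) < 1 := by rw [map_pow]; exact pow_lt_one' ha two_ne_zero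
  rcases lt_or_eq_of_le (valuation_ofNat_le_one 2 : 𝓿 (2 : F) ≤ 1) with h2 | h2
  · have hthree : 𝓿 (3 * x ^ 2) < 1 := by
      rw [show 3 * x ^ 2 = (3 * x ^ 2 - a ^ 2) + a ^ 2 by ring]
      exact Valuation.map_add_lt _ h hasq
    rwa [map_mul, valuation_three h2, one_mul, map_pow, pow_lt_one_iff two_ne_zero] at hthree
  · rw [map_mul, h2, one_mul] at h'
    rw [← pow_lt_one_iff three_ne_zero, ← map_pow,
      show x ^ 3 = y * y + a ^ 2 * x by linear_combination -hxy]
    refine Valuation.map_add_lt _ ?_ ?_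
    · rw [map_mul]; exact (mul_le_of_le_one_right' hy).trans_lt h'
    · rw [map_mul]; exact (mul_le_of_le_one_right' hx).trans_lt hasq

open Classical in
lemma tamagawaFactor_eq_index_self {a : F} (h20 : (2 : F) ≠ 0) (ha0 : a ≠ 0)
    (h2 : 𝓿 (2 : F) < 1) (ha : 𝓿 a ≤ 1) [(congruentCurve a).IsMinimal R] :
    (congruentCurve a).tamagawaFactor R =
      (avoidsReductionSubgroup (isSingularRoot_self (R := R) h2 ha)).index :=
  tamagawaFactor_congruentCurve _ (congruentCurve_Δ_ne_zero h20 ha0) fun _ _ _ hx _ h _ =>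
    valuation_sub_lt_one_of_singular h2 ha hx h

open Classical in
lemma tamagawaFactor_eq_index_zero {a : F} (h20 : (2 : F) ≠ 0) (ha0 : a ≠ 0) (ha : 𝓿 a < 1)
    [(congruentCurve a).IsMinimal R] :
    (congruentCurve a).tamagawaFactor R =
      (avoidsReductionSubgroup (isSingularRoot_zero (R := R) ha)).index :=
  tamagawaFactor_congruentCurve _ (congruentCurve_Δ_ne_zero h20 ha0) fun x _ hxy hx hy h h' => by
    simpa using valuation_lt_one_of_singular ha hxy hx hy h h'

lemma isMinimal_congruentCurve_of_unit {a : F} (h2 : 𝓿 (2 : F) = exp (-1)) (ha : 𝓿 a = 1) :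
    (congruentCurve a).IsMinimal R :=
  isMinimal_congruentCurve_of_exp_lt ha.le
    (by rw [h2, ha, mul_one, exp_lt_exp]; norm_num)

lemma isMinimal_congruentCurve_of_odd {a : F} (h2 : 𝓿 (2 : F) = 1) (ha : 𝓿 a = exp (-1)) :
    (congruentCurve a).IsMinimal R :=
  isMinimal_congruentCurve_of_exp_lt (ha ▸ (exp_lt_one (by norm_num)).le)
    (by rw [h2, ha, one_mul, exp_lt_exp]; norm_num)

lemma isMinimal_congruentCurve_of_good {a : F} (h2 : 𝓿 (2 : F) = 1) (ha : 𝓿 a = 1) :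
    (congruentCurve a).IsMinimal R :=
  isMinimal_congruentCurve_of_exp_lt ha.le (by rw [h2, ha, mul_one]; exact exp_lt_one (by norm_num))

theorem tamagawaFactor_congruentCurve_of_good {a : F} (h2 : 𝓿 (2 : F) = 1) (ha : 𝓿 a = 1) :
    (congruentCurve a).tamagawaFactor R = 1 := by
  have := isMinimal_congruentCurve_of_good h2 ha
  refine tamagawaFactor_of_valuation_Δ_eq_one _ ?_
  rw [valuation_congruentCurve_Δ, h2, ha, one_mul, one_pow]

theorem tamagawaFactor_congruentCurve_of_unit {a : F} (h2 : 𝓿 (2 : F) = exp (-1))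
    (ha : 𝓿 a = 1) : (congruentCurve a).tamagawaFactor R = 2 := by
  classical
  have := isMinimal_congruentCurve_of_unit h2 ha
  have h20 := ne_zero_of_valuation_eq_exp h2
  have ha0 : a ≠ 0 := fun h => by simp [h] at ha
  rw [tamagawaFactor_eq_index_self h20 ha0 (h2 ▸ exp_lt_one (by norm_num)) ha.le]
  refine index_avoidsReductionSubgroup_eq_two _
    ((congruentCurve_nonsingular_iff h20 ha0).mpr (by ring)) fun x y _ h => ?_
  rw [show 3 * a ^ 2 - a ^ 2 = 2 * a ^ 2 by ring, map_mul, map_pow, ha, h2, one_pow, mul_one]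
  exact (lt_one_iff_le_exp_neg_one _).mp h

theorem tamagawaFactor_congruentCurve_one_eq_two (h2 : 𝓿 (2 : F) = exp (-2))
    [(congruentCurve (1 : F)).IsMinimal R]
    (H : ∀ x y : F, y ^ 2 = x ^ 3 - x → 𝓿 (x - 1) ≠ exp (-1)) :
    (congruentCurve (1 : F)).tamagawaFactor R = 2 := by
  classical
  have h20 := ne_zero_of_valuation_eq_exp h2
  rw [tamagawaFactor_eq_index_self h20 one_ne_zero (h2 ▸ exp_lt_one (by norm_num)) (by simp)]
  refine index_avoidsReductionSubgroup_eq_two _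
    ((congruentCurve_nonsingular_iff h20 one_ne_zero).mpr (by ring)) fun x y hxy h => ?_
  rw [show (3 * 1 ^ 2 - 1 ^ 2 : F) = 2 by norm_num, h2]
  exact (eq_exp_neg_one_or_le h).resolve_left (H x y (by linear_combination hxy))

theorem tamagawaFactor_congruentCurve_one_eq_four (h2 : 𝓿 (2 : F) = exp (-2))
    [(congruentCurve (1 : F)).IsMinimal R] {x y : F} (hxy : y ^ 2 = x ^ 3 - x)
    (hx : 𝓿 (x - 1) = exp (-1)) : (congruentCurve (1 : F)).tamagawaFactor R = 4 := by
  classical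
  have h20 := ne_zero_of_valuation_eq_exp h2
  rw [tamagawaFactor_eq_index_self h20 one_ne_zero (h2 ▸ exp_lt_one (by norm_num)) (by simp)]
  refine index_avoidsReductionSubgroup_eq_four _
    ((congruentCurve_nonsingular_iff h20 one_ne_zero).mpr (by ring)) ?_
    ((congruentCurve_nonsingular_iff (y := y) h20 one_ne_zero).mpr (by rw [hxy]; ring)) hx
  rw [show (3 * 1 ^ 2 - 1 ^ 2 : F) = 2 by norm_num, h2]

lemma valuation_mul_lt_one {x y : F} (hx : 𝓿 x ≤ 1) (hy : 𝓿 y ≤ 1) (h : 𝓿 (x * y) < 1) :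
    𝓿 x < 1 ∨ 𝓿 y < 1 := by
  by_contra! H
  rw [map_mul, le_antisymm hx H.1, le_antisymm hy H.2, mul_one] at h
  exact h.false

lemma valuation_le_one_of_mul {a b : F} (ha : 𝓿 a = exp (-1)) (hab : 𝓿 (a * b) < 1) :
    𝓿 b ≤ 1 := by
  rw [lt_one_iff_le_exp_neg_one, map_mul, ha] at hab
  by_contra! hlt
  exact hab.not_gt (lt_mul_of_one_lt_right exp_pos hlt)

lemma valuation_mul_le_mul {a c z : F} (ha : 𝓿 a = exp (-1)) (hz : 𝓿 z < 1) :
    𝓿 (c * z) ≤ 𝓿 (c * a) := by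
  rw [map_mul, map_mul, ha]
  gcongr
  exact (lt_one_iff_le_exp_neg_one _).mp hz

lemma valuation_lt_one_of_equation {a ξ y : F} (ha : 𝓿 a = exp (-1)) (hξ : 𝓿 ξ ≤ 1)
    (hy : y ^ 2 = (a * ξ) ^ 3 - a ^ 2 * (a * ξ)) : 𝓿 (ξ * ((ξ - 1) * (ξ + 1))) < 1 := by
  refine lt_of_le_of_ne ?_ fun h => ?_
  · rw [valuation_le_one_iff_mem_range] at *
    exact mul_mem hξ (mul_mem (sub_mem hξ (one_mem _)) (add_mem hξ (one_mem _)))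
  · have hsq := congrArg 𝓿 (show y ^ 2 = a ^ 3 * (ξ * ((ξ - 1) * (ξ + 1))) by rw [hy]; ring)
    rw [map_mul, h, mul_one, map_pow, map_pow, ha, ← exp_nsmul] at hsq
    exact sq_ne_exp_of_odd _ (by decide) hsq

lemma valuation_trichotomy {a ξ y : F} (ha : 𝓿 a = exp (-1)) (hξ : 𝓿 ξ ≤ 1)
    (hy : y ^ 2 = (a * ξ) ^ 3 - a ^ 2 * (a * ξ)) :
    𝓿 ξ < 1 ∨ 𝓿 (ξ - 1) < 1 ∨ 𝓿 (ξ + 1) < 1 := by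
  have hsub : 𝓿 (ξ - 1) ≤ 1 := Valuation.map_sub_le _ hξ (by simp)
  have hadd : 𝓿 (ξ + 1) ≤ 1 := Valuation.map_add_le _ hξ (by simp)
  refine (valuation_mul_lt_one hξ (by rw [map_mul]; exact mul_le_one' hsub hadd)
    (valuation_lt_one_of_equation ha hξ hy)).imp_right (valuation_mul_lt_one hsub hadd)

lemma valuation_lt_one_or_of_dyadic {a ξ y k : F} (h2 : 𝓿 (2 : F) = exp (-1))
    (ha : 𝓿 a = exp (-1)) (h : 𝓿 ξ = 1) (hy : y ^ 2 = (a * ξ) ^ 3 - a ^ 2 * (a * ξ))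
    (hk : ξ - 1 = 2 * k) : 𝓿 k < 1 ∨ 𝓿 (k + 1) < 1 := by
  have h21 : 𝓿 (2 : F) < 1 := h2 ▸ exp_lt_one (by norm_num)
  have hlt : 𝓿 (ξ - 1) < 1 := by
    rcases valuation_trichotomy ha h.le hy with h' | h' | h'
    · exact absurd h h'.ne
    · exact h'
    · rw [show ξ - 1 = (ξ + 1) - 2 by ring]; exact Valuation.map_sub_lt _ h' h21
  have hk1 : 𝓿 k ≤ 1 := valuation_le_one_of_mul h2 (hk ▸ hlt)
  have hk2 : 𝓿 (k + 1) ≤ 1 := Valuation.map_add_le _ hk1 (by simp)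
  refine valuation_mul_lt_one hk1 hk2 (lt_of_le_of_ne ?_ fun hkk => ?_)
  · rw [map_mul]; exact mul_le_one' hk1 hk2
  · have hsq := congrArg 𝓿 (show y ^ 2 = a ^ 3 * 2 ^ 2 * ξ * (k * (k + 1)) by
      rw [hy]; linear_combination a ^ 3 * ξ * ((ξ + 1) + 2 * k) * hk)
    rw [map_mul, hkk, mul_one, map_mul, h, mul_one, map_mul, map_pow, map_pow, map_pow, ha, h2,
      ← exp_nsmul, ← exp_nsmul, ← exp_add] at hsq
    exact sq_ne_exp_of_odd _ (by decide) hsq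

lemma valuation_sub_torsion_le_of_odd {a x y : F} (h2 : 𝓿 (2 : F) = 1) (ha : 𝓿 a = exp (-1))
    (hxy : y ^ 2 = x ^ 3 - a ^ 2 * x) (hx : 𝓿 x < 1) :
    𝓿 x ≤ 𝓿 (a ^ 2) ∨ 𝓿 (x - a) ≤ 𝓿 (2 * a ^ 2) ∨ 𝓿 (x + a) ≤ 𝓿 (2 * a ^ 2) := by
  have ha0 := ne_zero_of_valuation_eq_exp ha
  obtain ⟨ξ, rfl⟩ : ∃ ξ, x = a * ξ := ⟨x / a, by field_simp⟩
  have hξ := valuation_le_one_of_mul ha hx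
  rw [map_mul _ 2, h2, one_mul, sq, show a * ξ - a = a * (ξ - 1) by ring,
    show a * ξ + a = a * (ξ + 1) by ring]
  exact (valuation_trichotomy ha hξ hxy).imp (valuation_mul_le_mul ha)
    (.imp (valuation_mul_le_mul ha) (valuation_mul_le_mul ha))

lemma valuation_sub_torsion_le_of_dyadic {a x y : F} (h2 : 𝓿 (2 : F) = exp (-1))
    (ha : 𝓿 a = exp (-1)) (hxy : y ^ 2 = x ^ 3 - a ^ 2 * x) (hx : 𝓿 x < 1) :
    𝓿 x ≤ 𝓿 (a ^ 2) ∨ 𝓿 (x - a) ≤ 𝓿 (2 * a ^ 2) ∨ 𝓿 (x + a) ≤ 𝓿 (2 * a ^ 2) := by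
  have ha0 := ne_zero_of_valuation_eq_exp ha
  have h20 := ne_zero_of_valuation_eq_exp h2
  obtain ⟨ξ, rfl⟩ : ∃ ξ, x = a * ξ := ⟨x / a, by field_simp⟩
  have hξ := valuation_le_one_of_mul ha hx
  rcases lt_or_eq_of_le hξ with hlt | heq
  · exact .inl (sq a ▸ valuation_mul_le_mul ha hlt)
  obtain ⟨k, hk⟩ : ∃ k, ξ - 1 = 2 * k := ⟨(ξ - 1) / 2, by field_simp⟩
  rw [show a * ξ - a = 2 * a * k by linear_combination a * hk,
    show a * ξ + a = 2 * a * (k + 1) by linear_combination a * hk,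
    show 2 * a ^ 2 = 2 * a * a by ring]
  exact .inr ((valuation_lt_one_or_of_dyadic h2 ha heq hxy hk).imp (valuation_mul_le_mul ha)
    (valuation_mul_le_mul ha))

theorem tamagawaFactor_congruentCurve_of_odd {a : F} (h2 : 𝓿 (2 : F) = 1)
    (ha : 𝓿 a = exp (-1)) : (congruentCurve a).tamagawaFactor R = 4 := by
  classical
  have := isMinimal_congruentCurve_of_odd h2 ha
  have h20 : (2 : F) ≠ 0 := fun h => by simp [h] at h2
  have ha0 := ne_zero_of_valuation_eq_exp ha
  have ha1 : 𝓿 a < 1 := ha ▸ exp_lt_one (by norm_num)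
  rw [tamagawaFactor_eq_index_zero h20 ha0 ha1]
  exact index_avoidsReductionSubgroup_zero_eq_four h20 ha0 _ ha1 fun x y hxy hx =>
    valuation_sub_torsion_le_of_odd h2 ha hxy hx

theorem tamagawaFactor_congruentCurve_of_two_mul {a : F} (h2 : 𝓿 (2 : F) = exp (-1))
    (ha : 𝓿 a = exp (-1)) : (congruentCurve a).tamagawaFactor R = 4 := by
  classical
  have := isMinimal_congruentCurve_of_two_mul h2 ha
  have h20 := ne_zero_of_valuation_eq_exp h2
  have ha0 := ne_zero_of_valuation_eq_exp ha
  have ha1 : 𝓿 a < 1 := ha ▸ exp_lt_one (by norm_num)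
  rw [tamagawaFactor_eq_index_zero h20 ha0 ha1]
  exact index_avoidsReductionSubgroup_zero_eq_four h20 ha0 _ ha1 fun x y hxy hx =>
    valuation_sub_torsion_le_of_dyadic h2 ha hxy hx

end Tamagawa

/-! ### Tamagawa factors of `y² = x³ - x` over ramified dyadic fields -/

/-- `π` is a uniformizer over which `2` is ramified of index two, with `2 = ε π²` for a unit
`ε`. -/
structure IsRamifiedDyadic {R : Type*} [CommRing R] (π : R) (ε : Rˣ) : Prop where
  prime : Prime π
  two_eq : (2 : R) = ε * π ^ 2

lemma dvd_sq_sub_self {R : Type*} [CommRing R] {π : R} (hres : ∀ z : R, π ∣ z ∨ π ∣ z - 1) (t : R) :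
    π ∣ t ^ 2 - t := by
  rw [show t ^ 2 - t = t * (t - 1) by ring]
  exact (hres t).elim (dvd_mul_of_dvd_left · _) (dvd_mul_of_dvd_right · _)

namespace IsRamifiedDyadic

variable {R : Type*} [CommRing R] {π : R} {ε : Rˣ} (h : IsRamifiedDyadic π ε)

include h

lemma not_dvd_of_isUnit {u : R} (hu : IsUnit u) : ¬π ∣ u := fun hd =>
  h.prime.not_isUnit (isUnit_of_dvd_unit hd hu)

lemma four_eq : (4 : R) = ε ^ 2 * π ^ 4 := by linear_combination (2 + ε * π ^ 2) * h.two_eq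

lemma not_dvd_add_sq_add (hres : ∀ z : R, π ∣ z ∨ π ∣ z - 1) (a : R) : ¬π ∣ ε + a ^ 2 + a := by
  rintro ⟨c, hc⟩
  obtain ⟨b, hb⟩ := dvd_sq_sub_self hres a
  exact h.not_dvd_of_isUnit ε.isUnit
    ⟨c - b - ε * π * a, by linear_combination hc - hb - a * h.two_eq⟩

variable [IsDomain R]

lemma two_dvd_of_four_dvd {d s : R} (hd : 4 ∣ d * (d + 2 * s)) : 2 ∣ d := by
  obtain ⟨j, hj⟩ := hd
  obtain ⟨e, rfl⟩ : π ∣ d := h.prime.dvd_of_dvd_pow (n := 2)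
    ⟨ε * π * (2 * j - s * d), by linear_combination hj + (2 * j - s * d) * h.two_eq⟩
  have he : e * (e + π * (ε * s)) = π * (ε ^ 2 * π * j) := by
    refine mul_left_cancel₀ (pow_ne_zero 2 h.prime.ne_zero) ?_
    linear_combination hj + j * h.four_eq - s * π * e * h.two_eq
  obtain ⟨f, rfl⟩ : π ∣ e := (h.prime.dvd_or_dvd ⟨_, he⟩).elim id
    ((dvd_add_left (dvd_mul_right π _)).mp ·)
  exact ⟨↑ε⁻¹ * f, by linear_combination -π ^ 2 * f * ε.mul_inv - ↑ε⁻¹ * f * h.two_eq⟩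

lemma sq_ne_one_add_sq_add {r m : R} : r ^ 2 ≠ 1 + π ^ 2 + 4 * m := by
  intro hr
  obtain ⟨κ, hκ⟩ : π ∣ r - 1 := h.prime.dvd_of_dvd_pow (n := 2)
    ⟨π + ε * π * (2 * m - (r - 1)), by linear_combination hr + (2 * m - (r - 1)) * h.two_eq⟩
  have hκ2 : κ ^ 2 + ε * π * κ - 1 = ε ^ 2 * π ^ 2 * m := by
    refine mul_left_cancel₀ (pow_ne_zero 2 h.prime.ne_zero) ?_
    linear_combination hr - (r + 1 + π * κ) * hκ + m * h.four_eq - π * κ * h.two_eq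
  obtain ⟨μ, hμ⟩ : π ∣ κ - 1 := h.prime.dvd_of_dvd_pow (n := 2)
    ⟨ε ^ 2 * π * m - ε * κ - ε * π * (κ - 1), by linear_combination hκ2 - (κ - 1) * h.two_eq⟩
  obtain rfl : κ = 1 + π * μ := by linear_combination hμ
  refine h.not_dvd_of_isUnit ε.isUnit ⟨ε ^ 2 * m - μ ^ 2 - ε * π * μ - ε * μ, ?_⟩
  refine mul_left_cancel₀ h.prime.ne_zero ?_
  linear_combination hκ2 - π * μ * h.two_eq

lemma not_exists_congruence_of_one_add_sqrt {s k : R} (hs : s ^ 2 = -1 + 4 * k)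
    (hπ : π = 1 + s) : ¬∃ r σ : R, r ^ 2 = 1 + 2 * σ ∧ 4 ∣ σ ^ 2 + 1 := by
  rintro ⟨r, σ, hr, j, hj⟩
  obtain ⟨d, hd⟩ : 2 ∣ σ - s :=
    h.two_dvd_of_four_dvd (s := s) ⟨j - k, by linear_combination hj - hs⟩
  exact h.sq_ne_one_add_sq_add (r := r) (m := d - k)
    (by linear_combination hr - hs + 2 * hd - (π + 1 + s) * hπ)

lemma not_exists_congruence_of_sqrt {k : R} (hk : (↑ε⁻¹ : R) = 1 + 2 * k) :
    ¬∃ r σ : R, r ^ 2 = 1 + 2 * σ ∧ 4 ∣ σ ^ 2 + 1 := by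
  rintro ⟨-, σ, -, j, hj⟩
  have hε : (ε : R) = 1 - 2 * k * ε := by linear_combination ε.mul_inv - ε * hk
  obtain ⟨η, hη⟩ : π ∣ σ - 1 := h.prime.dvd_of_dvd_pow (n := 2)
    ⟨ε * π * (2 * j - σ), by linear_combination hj + (2 * j - σ) * h.two_eq⟩
  obtain rfl : σ = 1 + π * η := by linear_combination hη
  have hη2 : η ^ 2 = 2 * ε * j - ε * (1 + π * η) := by
    refine mul_left_cancel₀ (pow_ne_zero 2 h.prime.ne_zero) ?_
    linear_combination hj + (2 * j - (1 + π * η)) * h.two_eq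
  obtain ⟨μ, hμ⟩ : π ∣ η + 1 := by
    refine h.prime.dvd_of_dvd_pow (n := 2) ⟨ε * π * (ε * j + k * ε * (1 + π * η) + η) - η, ?_⟩
    linear_combination hη2 - (1 + π * η) * hε + (ε * j + k * ε * (1 + π * η) + η) * h.two_eq
  refine h.not_dvd_of_isUnit isUnit_one
    ⟨μ - (ε * (ε * j + k * ε * (1 + π * η) + η) - μ ^ 2), ?_⟩
  refine mul_left_cancel₀ h.prime.ne_zero ?_
  linear_combination π * hμ - hη2 + (1 + π * η) * hε -
    (ε * j + k * ε * (1 + π * η) + η) * h.two_eq + (η + 1 + π * μ) * hμ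

lemma exists_of_equation {y α : R} (hα : IsUnit α)
    (hxy : y ^ 2 = (1 + π * α) ^ 3 - (1 + π * α)) :
    ∃ τ : R, α ^ 2 + ε + ε * π * α = α * (π * τ ^ 2 + ε * π ^ 2 * τ) := by
  obtain ⟨γ, hγ⟩ := hα.exists_left_inv
  obtain ⟨β, rfl⟩ : π ∣ y := by
    refine h.prime.dvd_of_dvd_pow (n := 2) ⟨π * ((1 + π * α) * (α ^ 2 + ε * π * α)), ?_⟩
    linear_combination hxy + (1 + π * α) * π * α * h.two_eq
  have hβ : β ^ 2 = (1 + π * α) * (α ^ 2 + ε * π * α) := by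
    refine mul_left_cancel₀ (pow_ne_zero 2 h.prime.ne_zero) ?_
    linear_combination hxy + (1 + π * α) * π * α * h.two_eq
  have hθ : (β * γ) ^ 2 = 1 + π * (α + ε * γ + ε * π) := by
    linear_combination γ ^ 2 * hβ + (1 + π * α) * (γ * α + 1 + ε * π * γ) * hγ + ε * π ^ 2 * hγ
  obtain ⟨τ, hτ⟩ : π ∣ β * γ - 1 := by
    refine h.prime.dvd_of_dvd_pow (n := 2) ⟨α + ε * γ + ε * π - ε * π * (β * γ - 1), ?_⟩
    linear_combination hθ - (β * γ - 1) * h.two_eq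
  refine ⟨τ, mul_left_cancel₀ h.prime.ne_zero ?_⟩
  rw [show β * γ = 1 + π * τ by linear_combination hτ] at hθ
  linear_combination -α * hθ - π * ε * hγ + α * π * τ * h.two_eq

lemma sq_ne_cube_sub_of_one_add_sqrt (hres : ∀ z : R, π ∣ z ∨ π ∣ z - 1) {k y α : R}
    (hε : (↑ε⁻¹ : R) = 1 + π + 4 * k) (hα : IsUnit α) :
    y ^ 2 ≠ (1 + π * α) ^ 3 - (1 + π * α) := by
  intro hxy
  obtain ⟨τ, hτ⟩ := h.exists_of_equation hα hxy
  have hπα := h.not_dvd_of_isUnit hα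
  obtain ⟨a, ha⟩ := (hres α).resolve_left hπα
  obtain rfl : α = 1 + π * a := by linear_combination ha
  obtain ⟨X, hX⟩ : ∃ X, X = ε + ε * a + ε * π * a + a ^ 2 + ε ^ 2 * π * k * (1 + π * a) ^ 2 :=
    ⟨_, rfl⟩
  have hτ' : π * (ε + a ^ 2 + a + π * X) = (1 + π * a) * (↑ε⁻¹ * τ ^ 2 + π * τ) := by
    refine mul_left_cancel₀ h.prime.ne_zero ?_
    linear_combination ↑ε⁻¹ * hτ + (-1 - π * (1 + π * a) + (1 + π * a) * π ^ 2 * τ) * ε.mul_inv -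
      (1 + π * a) ^ 2 * hε - k * (1 + π * a) ^ 2 * h.four_eq + π ^ 3 * hX -
      (1 + π + π * a + π ^ 2 * a) * h.two_eq
  obtain ⟨t, rfl⟩ : π ∣ τ := by
    have hdvd := (h.prime.dvd_or_dvd ⟨_, hτ'.symm⟩).resolve_left hπα
    rw [dvd_add_left (dvd_mul_right π τ)] at hdvd
    exact h.prime.dvd_of_dvd_pow
      ((h.prime.dvd_or_dvd hdvd).resolve_left (h.not_dvd_of_isUnit ε⁻¹.isUnit))
  refine h.not_dvd_add_sq_add hres a ⟨(1 + π * a) * (↑ε⁻¹ * t ^ 2 + t) - X, ?_⟩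
  refine mul_left_cancel₀ h.prime.ne_zero ?_
  linear_combination hτ'

lemma reduced_equation_ne (hres : ∀ z : R, π ∣ z ∨ π ∣ z - 1) {k a t : R}
    (hk : (↑ε⁻¹ : R) = -1 + 4 * k) :
    1 + π * a - 2 * a - π * a ^ 2 + ε ^ 2 * π ^ 3 * k * (1 + π * a) ^ 2 ≠
      (1 + π * a) * (↑ε⁻¹ * (1 + π * t) ^ 2 + π * (1 + π * t)) := by
  intro hat
  have h1π := h.not_dvd_of_isUnit isUnit_one
  obtain ⟨Y, hY⟩ : ∃ Y, Y = ε + ε * π * a - ε * a - a + (1 + π * a) * (t ^ 2 - t) +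
      ε * π * t * (1 + π * a) + ε ^ 2 * π * k * (1 + π * a) ^ 2 -
      ε ^ 2 * π ^ 2 * k * (1 + π * a) * (1 + π * t) ^ 2 := ⟨_, rfl⟩
  have haY : a ^ 2 + 1 = π * Y := by
    refine mul_left_cancel₀ h.prime.ne_zero ?_
    linear_combination -hat - (1 + π * a) * (1 + π * t) ^ 2 * hk -
      k * (1 + π * a) * (1 + π * t) ^ 2 * h.four_eq - π ^ 2 * hY +
      (1 + π * a - a + π * t * (1 + π * a)) * h.two_eq
  obtain ⟨b, hb⟩ : π ∣ a - 1 := by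
    refine (hres a).resolve_left fun ⟨b, hb⟩ => h1π ⟨Y - b * a, ?_⟩
    linear_combination haY - a * hb
  have hYb : Y = π * (ε + ε * π * b + b ^ 2) := by
    refine mul_left_cancel₀ h.prime.ne_zero ?_
    obtain rfl : a = 1 + π * b := by linear_combination hb
    linear_combination -haY + (1 + π * b) * h.two_eq
  obtain ⟨c, hc⟩ := dvd_sq_sub_self hres t
  refine h1π ⟨ε * a - ε * b - b + (1 + π * a) * c + ε * t * (1 + π * a) +
    ε ^ 2 * k * (1 + π * a) ^ 2 - ε ^ 2 * π * k * (1 + π * a) * (1 + π * t) ^ 2 -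
    (ε + ε * π * b + b ^ 2), ?_⟩
  linear_combination hY - hYb + (1 + π * a) * hc - (1 + ε) * hb

lemma sq_ne_cube_sub_of_sqrt (hres : ∀ z : R, π ∣ z ∨ π ∣ z - 1) {k y α : R}
    (hk : (↑ε⁻¹ : R) = -1 + 4 * k) (hα : IsUnit α) :
    y ^ 2 ≠ (1 + π * α) ^ 3 - (1 + π * α) := by
  intro hxy
  obtain ⟨τ, hτ⟩ := h.exists_of_equation hα hxy
  obtain ⟨a, ha⟩ := (hres α).resolve_left (h.not_dvd_of_isUnit hα)
  obtain rfl : α = 1 + π * a := by linear_combination ha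
  have hτ' : 1 + π * a - 2 * a - π * a ^ 2 + ε ^ 2 * π ^ 3 * k * (1 + π * a) ^ 2 =
      (1 + π * a) * (↑ε⁻¹ * τ ^ 2 + π * τ) := by
    refine mul_left_cancel₀ h.prime.ne_zero ?_
    linear_combination ↑ε⁻¹ * hτ + (-1 - π * (1 + π * a) + (1 + π * a) * π ^ 2 * τ) * ε.mul_inv -
      (1 + π * a) ^ 2 * hk - k * (1 + π * a) ^ 2 * h.four_eq
  obtain ⟨t, ht⟩ : π ∣ τ - 1 := by
    refine (hres τ).resolve_left ?_
    rintro ⟨t, rfl⟩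
    refine h.not_dvd_of_isUnit isUnit_one ⟨(1 + π * a) * (↑ε⁻¹ * π * t ^ 2 + π * t) - a +
      ε * π * a + a ^ 2 - ε ^ 2 * π ^ 2 * k * (1 + π * a) ^ 2, ?_⟩
    linear_combination hτ' + a * h.two_eq
  obtain rfl : τ = 1 + π * t := by linear_combination ht
  exact h.reduced_equation_ne hres hk hτ'

end IsRamifiedDyadic

lemma valuation_intCast_le_one {R F : Type*} [CommRing R] [IsDedekindDomain R] [Field F]
    [Algebra R F] [IsFractionRing R F] (v : HeightOneSpectrum R) (j : ℤ) :
    v.valuation F (j : F) ≤ 1 := by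
  simpa using v.valuation_le_one (K := F) (j : R)

section RamifiedDyadic

variable {R : Type*} [CommRing R] [IsDomain R] [IsDiscreteValuationRing R]
  {F : Type*} [Field F] [Algebra R F] [IsFractionRing R F]

local notation "𝓿" => HeightOneSpectrum.valuation F (IsDiscreteValuationRing.maximalIdeal R)

lemma valuation_intCast_of_odd (h2 : 𝓿 (2 : F) < 1) {j : ℤ} (hj : Odd j) : 𝓿 (j : F) = 1 := by
  obtain ⟨k, rfl⟩ := hj
  rw [add_comm]
  push_cast
  refine Valuation.map_one_add_of_lt _ ?_
  rw [map_mul]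
  exact (mul_le_of_le_one_right' (valuation_intCast_le_one _ k)).trans_lt h2

lemma valuation_units_eq_one (u : Rˣ) : 𝓿 (algebraMap R F u) = 1 := by
  refine le_antisymm (valuation_le_one _ _) (not_lt.mp fun h => ?_)
  rw [← residue_eq_zero_iff_valuation, IsLocalRing.residue_eq_zero_iff] at h
  exact h u.isUnit

lemma exists_units_lift {x : F} (hx : 𝓿 x = 1) : ∃ u : Rˣ, algebraMap R F u = x := by
  obtain ⟨u, rfl⟩ := (valuation_le_one_iff_mem_range R _).mp hx.le
  refine ⟨IsUnit.unit (a := u) ?_, rfl⟩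
  by_contra h
  rw [← mem_nonunits_iff, ← IsLocalRing.mem_maximalIdeal, ← IsLocalRing.residue_eq_zero_iff,
    residue_eq_zero_iff_valuation (F := F)] at h
  exact h.ne hx

lemma valuation_eq_exp_neg_one_of_sq {x : F} (h : 𝓿 (x ^ 2) = exp (-2)) : 𝓿 x = exp (-1) := by
  rw [map_pow, show (-2 : ℤ) = (-1) + (-1) by rfl, exp_add, ← sq] at h
  exact (pow_left_inj₀ zero_le zero_le two_ne_zero).mp h

lemma valuation_eq_one_of_sq {x : F} (h : 𝓿 (x ^ 2) = 1) : 𝓿 x = 1 := by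
  rw [map_pow] at h
  exact (pow_eq_one_iff_of_nonneg zero_le two_ne_zero).mp h

namespace IsRamifiedDyadic

variable {π : R} {ε : Rˣ}

lemma valuation_eq (h : IsRamifiedDyadic π ε) (h2 : 𝓿 (2 : F) = exp (-2)) :
    𝓿 (algebraMap R F π) = exp (-1) := by
  refine valuation_eq_exp_neg_one_of_sq ?_
  rw [← h2, ← map_pow, ← map_ofNat (algebraMap R F), h.two_eq, map_mul, map_mul,
    valuation_units_eq_one, one_mul]

lemma dvd_iff_valuation_lt_one (h : IsRamifiedDyadic π ε) (h2 : 𝓿 (2 : F) = exp (-2)) (z : R) :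
    π ∣ z ↔ 𝓿 (algebraMap R F z) < 1 := by
  rw [dvd_iff_valuation_le (F := F), h.valuation_eq h2, lt_one_iff_le_exp_neg_one]

lemma dvd_or_dvd_sub_one (h : IsRamifiedDyadic π ε) (h2 : 𝓿 (2 : F) = exp (-2))
    (hres : ∀ z : F, 𝓿 z ≤ 1 → 𝓿 z < 1 ∨ 𝓿 (z - 1) < 1) (z : R) : π ∣ z ∨ π ∣ z - 1 := by
  rw [h.dvd_iff_valuation_lt_one h2, h.dvd_iff_valuation_lt_one h2, map_sub, map_one]
  exact hres _ (valuation_le_one _ z)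

lemma valuation_sub_one_ne (h : IsRamifiedDyadic π ε) (h2 : 𝓿 (2 : F) = exp (-2))
    (H : ∀ y α : R, IsUnit α → y ^ 2 ≠ (1 + π * α) ^ 3 - (1 + π * α)) (x y : F)
    (hxy : y ^ 2 = x ^ 3 - x) : 𝓿 (x - 1) ≠ exp (-1) := by
  intro hx
  have hπ := h.valuation_eq h2
  obtain ⟨α, hα⟩ := exists_units_lift (R := R) (x := (x - 1) / algebraMap R F π) (by
    rw [map_div₀, hπ, hx, div_self exp_ne_zero])
  rw [eq_div_iff (ne_zero_of_valuation_eq_exp hπ)] at hα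
  obtain rfl : x = algebraMap R F (1 + π * α) := by
    rw [map_add, map_mul, map_one]; linear_combination -hα
  obtain ⟨Y, rfl⟩ : y ∈ (algebraMap R F).range :=
    mem_range_of_quadratic 0 (-((1 + π * α) ^ 3 - (1 + π * α))) (by rw [hxy]; simp)
  exact H Y α α.isUnit (IsFractionRing.injective R F (by simpa using hxy))

end IsRamifiedDyadic

lemma exists_isRamifiedDyadic (h2 : 𝓿 (2 : F) = exp (-2)) {z u : F} (hu : 𝓿 u = 1)
    (hz : z ^ 2 = 2 * u) : ∃ (π : R) (ε : Rˣ), IsRamifiedDyadic π ε ∧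
      algebraMap R F π = z ∧ algebraMap R F ↑ε⁻¹ = u := by
  have hz' : 𝓿 z = exp (-1) :=
    valuation_eq_exp_neg_one_of_sq (by rw [hz, map_mul, h2, hu, mul_one])
  obtain ⟨π, rfl⟩ := (valuation_le_one_iff_mem_range R _).mp
    (hz'.trans_le (exp_lt_one (by norm_num)).le)
  obtain ⟨w, rfl⟩ := exists_units_lift hu
  refine ⟨π, w⁻¹, ⟨prime_of_valuation_eq hz', ?_⟩, rfl, by rw [inv_inv]⟩
  have hπ : π ^ 2 = 2 * w := IsFractionRing.injective R F (by simpa [map_ofNat] using hz)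
  linear_combination -↑w⁻¹ * hπ - 2 * w.inv_mul

lemma one_add_sqrt_sq {s : F} {j : ℤ} (hs : s ^ 2 = ((3 + 4 * j : ℤ) : F)) :
    (1 + s) ^ 2 = 2 * (s + 2 * (1 + j : ℤ)) := by
  push_cast at hs ⊢
  linear_combination hs

lemma valuation_sqrt_add (h2 : 𝓿 (2 : F) < 1) {s : F} {j : ℤ}
    (hs : s ^ 2 = ((3 + 4 * j : ℤ) : F)) : 𝓿 (s + 2 * (1 + j : ℤ)) = 1 := by
  have hs1 : 𝓿 s = 1 := valuation_eq_one_of_sq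
    (by rw [hs, valuation_intCast_of_odd h2 ⟨1 + 2 * j, by ring⟩])
  rw [Valuation.map_add_eq_of_lt_left, hs1]
  rw [hs1, map_mul]
  exact (mul_le_of_le_one_right' (valuation_intCast_le_one _ _)).trans_lt h2

lemma valuation_one_add_sqrt (h2 : 𝓿 (2 : F) = exp (-2)) {s : F} {j : ℤ}
    (hs : s ^ 2 = ((3 + 4 * j : ℤ) : F)) : 𝓿 (1 + s) = exp (-1) :=
  valuation_eq_exp_neg_one_of_sq (by rw [one_add_sqrt_sq hs, map_mul, h2,
    valuation_sqrt_add (h2 ▸ exp_lt_one (by norm_num)) hs, mul_one])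

lemma exists_isRamifiedDyadic_one_add (h2 : 𝓿 (2 : F) = exp (-2)) {s : F} {j : ℤ}
    (hs : s ^ 2 = ((3 + 4 * j : ℤ) : F)) : ∃ (π : R) (ε : Rˣ), IsRamifiedDyadic π ε ∧
      (π - 1) ^ 2 = -1 + 4 * (1 + j) ∧ ↑ε⁻¹ = 1 + π + 2 * j := by
  obtain ⟨π, ε, h, hπ, hε⟩ := exists_isRamifiedDyadic (R := R) h2
    (valuation_sqrt_add (h2 ▸ exp_lt_one (by norm_num)) hs) (one_add_sqrt_sq hs)
  refine ⟨π, ε, h, IsFractionRing.injective R F ?_, IsFractionRing.injective R F ?_⟩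
  · simp only [map_pow, map_sub, hπ, map_one, map_add, map_neg, map_mul, map_intCast, map_ofNat]
    push_cast at hs
    linear_combination hs
  · simp only [map_add, hπ, hε, map_one, map_mul, map_ofNat, map_intCast]
    push_cast
    ring

lemma exists_isRamifiedDyadic_sqrt (h2 : 𝓿 (2 : F) = exp (-2)) {s : F} {j : ℤ}
    (hs : s ^ 2 = ((2 * (1 + 2 * j) : ℤ) : F)) : ∃ (π : R) (ε : Rˣ), IsRamifiedDyadic π ε ∧
      algebraMap R F π = s ∧ ↑ε⁻¹ = 1 + 2 * (j : R) := by
  obtain ⟨π, ε, h, hπ, hε⟩ := exists_isRamifiedDyadic (R := R) (z := s) h2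
    (valuation_intCast_of_odd (h2 ▸ exp_lt_one (by norm_num)) (j := 1 + 2 * j) ⟨j, by ring⟩)
    (by rw [hs]; push_cast; ring)
  exact ⟨π, ε, h, hπ, IsFractionRing.injective R F (by simp [hε, map_ofNat])⟩

lemma valuation_sqrt_of_two_mul (h2 : 𝓿 (2 : F) = exp (-2)) {s : F} {j : ℤ}
    (hs : s ^ 2 = ((2 * (1 + 2 * j) : ℤ) : F)) : 𝓿 s = exp (-1) := by
  obtain ⟨π, ε, h, rfl, -⟩ := exists_isRamifiedDyadic_sqrt (R := R) h2 hs
  exact h.valuation_eq h2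

theorem isMinimal_congruentCurve_one_of_three_mod_four (h2 : 𝓿 (2 : F) = exp (-2)) {s : F} {j : ℤ}
    (hs : s ^ 2 = ((3 + 4 * j : ℤ) : F)) : (congruentCurve (1 : F)).IsMinimal R := by
  obtain ⟨π, ε, h, hπ, -⟩ := exists_isRamifiedDyadic_one_add (R := R) h2 hs
  exact isMinimal_congruentCurve_one h2
    (h.not_exists_congruence_of_one_add_sqrt hπ (add_sub_cancel 1 π).symm)

theorem isMinimal_congruentCurve_one_of_two_mod_four (h2 : 𝓿 (2 : F) = exp (-2)) {s : F} {j : ℤ}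
    (hs : s ^ 2 = ((2 * (1 + 2 * j) : ℤ) : F)) : (congruentCurve (1 : F)).IsMinimal R := by
  obtain ⟨π, ε, h, -, hε⟩ := exists_isRamifiedDyadic_sqrt (R := R) h2 hs
  exact isMinimal_congruentCurve_one h2 (h.not_exists_congruence_of_sqrt hε)

theorem tamagawaFactor_congruentCurve_one_of_three_mod_eight (h2 : 𝓿 (2 : F) = exp (-2))
    (hres : ∀ z : F, 𝓿 z ≤ 1 → 𝓿 z < 1 ∨ 𝓿 (z - 1) < 1) {s : F} {j : ℤ}
    (hs : s ^ 2 = ((3 + 8 * j : ℤ) : F)) : (congruentCurve (1 : F)).tamagawaFactor R = 2 := by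
  have hs' : s ^ 2 = ((3 + 4 * (2 * j) : ℤ) : F) := by rw [hs]; push_cast; ring
  have := isMinimal_congruentCurve_one_of_three_mod_four (R := R) h2 hs'
  obtain ⟨π, ε, h, -, hε⟩ := exists_isRamifiedDyadic_one_add (R := R) h2 hs'
  have hε' : (↑ε⁻¹ : R) = 1 + π + 4 * j := by rw [hε]; push_cast; ring
  exact tamagawaFactor_congruentCurve_one_eq_two h2 (h.valuation_sub_one_ne h2 fun _ _ =>
    h.sq_ne_cube_sub_of_one_add_sqrt (h.dvd_or_dvd_sub_one h2 hres) hε')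

theorem tamagawaFactor_congruentCurve_one_of_six_mod_eight (h2 : 𝓿 (2 : F) = exp (-2))
    (hres : ∀ z : F, 𝓿 z ≤ 1 → 𝓿 z < 1 ∨ 𝓿 (z - 1) < 1) {s : F} {j : ℤ}
    (hs : s ^ 2 = ((6 + 8 * j : ℤ) : F)) : (congruentCurve (1 : F)).tamagawaFactor R = 2 := by
  have hs' : s ^ 2 = ((2 * (1 + 2 * (1 + 2 * j)) : ℤ) : F) := by rw [hs]; push_cast; ring
  have := isMinimal_congruentCurve_one_of_two_mod_four (R := R) h2 hs'
  obtain ⟨π, ε, h, -, hε⟩ := exists_isRamifiedDyadic_sqrt (R := R) h2 hs'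
  have hε' : (↑ε⁻¹ : R) = -1 + 4 * (1 + j) := by rw [hε]; push_cast; ring
  exact tamagawaFactor_congruentCurve_one_eq_two h2 (h.valuation_sub_one_ne h2 fun _ _ =>
    h.sq_ne_cube_sub_of_sqrt (h.dvd_or_dvd_sub_one h2 hres) hε')

lemma tamagawaFactor_congruentCurve_one_of_sq_eq_neg_one (h2 : 𝓿 (2 : F) = exp (-2))
    [(congruentCurve (1 : F)).IsMinimal R] {i : F} (hi : i ^ 2 = -1) :
    (congruentCurve (1 : F)).tamagawaFactor R = 4 := by
  have hi1 : 𝓿 i = 1 := valuation_eq_one_of_sq (by rw [hi, Valuation.map_neg, map_one])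
  refine tamagawaFactor_congruentCurve_one_eq_four h2 (x := i) (y := 1 - i)
    (by linear_combination (1 - i) * hi) (valuation_eq_exp_neg_one_of_sq ?_)
  rw [show (i - 1) ^ 2 = -(2 * i) by linear_combination hi, Valuation.map_neg, map_mul, h2, hi1,
    mul_one]

theorem tamagawaFactor_congruentCurve_one_of_seven_mod_eight (h2 : 𝓿 (2 : F) = exp (-2))
    (hsq : ∀ c : F, 𝓿 c < 1 → ∃ q : F, q ^ 2 = 1 + 4 * c) {s : F} {j : ℤ}
    (hs : s ^ 2 = ((7 + 8 * j : ℤ) : F)) : (congruentCurve (1 : F)).tamagawaFactor R = 4 := by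
  have h2' : 𝓿 (2 : F) < 1 := h2 ▸ exp_lt_one (by norm_num)
  have := isMinimal_congruentCurve_one_of_three_mod_four (R := R) h2 (s := s) (j := 1 + 2 * j)
    (by rw [hs]; push_cast; ring)
  obtain ⟨q, hq⟩ := hsq (2 * ((-1 - j : ℤ) : F)) (by
    rw [map_mul]; exact (mul_le_of_le_one_right' (valuation_intCast_le_one _ _)).trans_lt h2')
  have hqs : q ^ 2 = -s ^ 2 := by rw [hq, hs]; push_cast; ring
  have hs0 : s ≠ 0 := by
    rintro rfl
    have hodd := valuation_intCast_of_odd (R := R) h2' (j := 7 + 8 * j) ⟨3 + 4 * j, by ring⟩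
    simp [← hs] at hodd
  exact tamagawaFactor_congruentCurve_one_of_sq_eq_neg_one h2 (i := q / s)
    (by rw [div_pow, hqs, neg_div, div_self (pow_ne_zero 2 hs0)])

-- The point has `x = 1 + s`: then `x³ - x` is `(s (1 + s))²` times an element of `1 + 4𝔪`.
theorem tamagawaFactor_congruentCurve_one_of_two_mod_eight (h2 : 𝓿 (2 : F) = exp (-2))
    (hsq : ∀ c : F, 𝓿 c < 1 → ∃ q : F, q ^ 2 = 1 + 4 * c) {s : F} {j : ℤ}
    (hs : s ^ 2 = ((2 + 8 * j : ℤ) : F)) : (congruentCurve (1 : F)).tamagawaFactor R = 4 := by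
  have h2' : 𝓿 (2 : F) < 1 := h2 ▸ exp_lt_one (by norm_num)
  have hs' : s ^ 2 = ((2 * (1 + 2 * (2 * j)) : ℤ) : F) := by rw [hs]; push_cast; ring
  have := isMinimal_congruentCurve_one_of_two_mod_four (R := R) h2 hs'
  have hs1 := valuation_sqrt_of_two_mul (R := R) h2 hs'
  have hs1' : 𝓿 s < 1 := hs1 ▸ exp_lt_one (by norm_num)
  have hm := valuation_intCast_of_odd (R := R) h2' (j := 1 + 4 * j) ⟨2 * j, by ring⟩
  have h1s : 𝓿 (1 + s) = 1 := Valuation.map_one_add_of_lt _ hs1'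
  have hm0 : ((1 + 4 * j : ℤ) : F) ≠ 0 := fun h => by simp [h] at hm
  have hs0 : (1 + s) ≠ 0 := fun h => by simp [h] at h1s
  obtain ⟨q, hq⟩ := hsq (-(j * s) / ((1 + 4 * j : ℤ) * (1 + s))) (by
    rw [map_div₀, map_mul, Valuation.map_neg, map_mul, h1s, hm, mul_one, div_one]
    exact (mul_le_of_le_one_left' (valuation_intCast_le_one _ _)).trans_lt hs1')
  refine tamagawaFactor_congruentCurve_one_eq_four h2 (x := 1 + s) (y := s * (1 + s) * q) ?_
    (by rwa [add_sub_cancel_left])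
  rw [mul_pow, hq]
  push_cast at hs hm0 ⊢
  field_simp
  linear_combination s * hs

end RamifiedDyadic

/-! ### Completions -/

section Completion

lemma valuation_eq_of_isEquiv {F : Type*} [Field F]
    {v₁ v₂ : Valuation F (WithZero (Multiplicative ℤ))} (h : v₁.IsEquiv v₂)
    (h₁ : ∃ x, v₁ x = exp (-1)) (h₂ : ∃ x, v₂ x = exp (-1)) : v₁ = v₂ := by
  obtain ⟨a, ha⟩ := h₁
  obtain ⟨b, hb⟩ := h₂
  have ha' : v₂ a = exp (-1) := by
    refine le_antisymm ?_ ?_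
    · rw [← lt_one_iff_le_exp_neg_one, ← h.lt_one_iff_lt_one, ha]
      exact exp_lt_one (by norm_num)
    · rw [← hb, ← h.le_iff_le, ha, ← lt_one_iff_le_exp_neg_one, h.lt_one_iff_lt_one, hb]
      exact exp_lt_one (by norm_num)
  ext x
  rcases eq_or_ne x 0 with rfl | hx
  · simp only [map_zero]
  obtain ⟨k, hk⟩ : ∃ k : ℤ, v₁ x = v₁ (a ^ k) :=
    ⟨-log (v₁ x), by rw [map_zpow₀, ha, ← exp_zsmul, smul_eq_mul, neg_mul_neg, mul_one,
      exp_log (v₁.ne_zero_iff.mpr hx)]⟩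
  rw [h.eq_iff.mp hk, hk, map_zpow₀, map_zpow₀, ha, ha']

variable {K : Type*} [Field K] [NumberField K] (v : HeightOneSpectrum (𝓞 K))

lemma valued_algebraMap (x : K) :
    Valued.v (algebraMap K (v.adicCompletion K) x) = v.valuation K x :=
  valuedAdicCompletion_eq_valuation' v x

lemma valued_intCast (j : ℤ) : Valued.v (j : v.adicCompletion K) = v.valuation K j := by
  rw [← valued_algebraMap, map_intCast (algebraMap K (v.adicCompletion K))]

lemma valuation_maximalIdeal_eq_valued :
    (IsDiscreteValuationRing.maximalIdeal (v.adicCompletionIntegers K)).valuation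
      (v.adicCompletion K) = Valued.v := by
  refine valuation_eq_of_isEquiv (Valuation.isEquiv_of_val_le_one fun x => ?_)
    (valuation_exists_uniformizer _ _) ?_
  · rw [valuation_le_one_iff_mem_range]
    exact ⟨fun ⟨y, hy⟩ => hy ▸ y.2, fun h => ⟨⟨x, h⟩, rfl⟩⟩
  · obtain ⟨y, hy⟩ := v.valuation_exists_uniformizer K
    exact ⟨algebraMap K _ y, by rw [valued_algebraMap, hy]⟩

lemma norm_eq_of_valued_eq {x : v.adicCompletion K} {k : ℤ} (h : Valued.v x = exp k) :
    ‖x‖ = (Ideal.absNorm v.asIdeal : ℝ) ^ k := by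
  rw [FinitePlace.norm_def, h, WithZeroMulInt.toNNReal_neg_apply _ exp_ne_zero, NNReal.coe_zpow]
  rfl

lemma norm_le_norm_iff {x y : v.adicCompletion K} : ‖x‖ ≤ ‖y‖ ↔ Valued.v x ≤ Valued.v y := by
  rw [FinitePlace.norm_def, FinitePlace.norm_def, NNReal.coe_le_coe,
    (WithZeroMulInt.toNNReal_strictMono (HeightOneSpectrum.one_lt_absNorm_nnreal v)).le_iff_le]

lemma norm_lt_norm_iff {x y : v.adicCompletion K} : ‖x‖ < ‖y‖ ↔ Valued.v x < Valued.v y :=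
  lt_iff_lt_of_le_iff_le (norm_le_norm_iff v)

lemma norm_eq_norm_iff {x y : v.adicCompletion K} : ‖x‖ = ‖y‖ ↔ Valued.v x = Valued.v y := by
  simp only [le_antisymm_iff, norm_le_norm_iff]

lemma norm_sub_le_max (x y : v.adicCompletion K) : ‖x - y‖ ≤ max ‖x‖ ‖y‖ := by
  simp only [le_max_iff, norm_le_norm_iff]
  exact le_max_iff.mp (Valuation.map_sub _ x y)

/-- Writing `q = 1 + 2 * t`, the equation becomes `t = c - t ^ 2`, and `t ↦ c - t ^ 2` contracts the
closed ball of radius `‖c‖ < 1`. -/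
lemma exists_sq_eq_one_add_four_mul {c : v.adicCompletion K} (hc : Valued.v c < 1) :
    ∃ q : v.adicCompletion K, q ^ 2 = 1 + 4 * c := by
  have hc1 : ‖c‖ < 1 := by rwa [← norm_one (α := v.adicCompletion K), norm_lt_norm_iff, map_one]
  let B : Set (v.adicCompletion K) := Metric.closedBall 0 ‖c‖
  have hmaps : Set.MapsTo (fun t => c - t ^ 2) B B := fun t ht => by
    simp only [B, mem_closedBall_zero_iff] at ht ⊢
    refine (norm_sub_le_max v c _).trans (max_le le_rfl ?_)
    rw [norm_pow, sq]
    exact (mul_le_of_le_one_left (norm_nonneg _) (ht.trans hc1.le)).trans ht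
  have hcontr : ContractingWith ‖c‖₊ (hmaps.restrict (fun t => c - t ^ 2) _ _) := by
    refine ⟨hc1, LipschitzWith.of_dist_le_mul fun ⟨t, ht⟩ ⟨t', ht'⟩ => ?_⟩
    simp only [B, mem_closedBall_zero_iff] at ht ht'
    simp only [Subtype.dist_eq, Set.MapsTo.val_restrict_apply, dist_eq_norm]
    rw [show c - t ^ 2 - (c - t' ^ 2) = (-t' - t) * (t - t') by ring, norm_mul]
    refine mul_le_mul_of_nonneg_right ((norm_sub_le_max v _ _).trans ?_) (norm_nonneg _)
    exact max_le (norm_neg t' ▸ ht') ht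
  obtain ⟨t, -, ht, -⟩ := hcontr.exists_fixedPoint' Metric.isClosed_closedBall.isComplete hmaps
    (Metric.mem_closedBall_self (norm_nonneg c)) (edist_ne_top _ _)
  have hfix : c - t ^ 2 = t := ht
  exact ⟨1 + 2 * t, by linear_combination -4 * hfix⟩

lemma exists_valued_sub_lt_one {z : v.adicCompletion K} (hz : Valued.v z ≤ 1) :
    ∃ r : 𝓞 K, Valued.v (z - algebraMap K _ (algebraMap (𝓞 K) K r)) < 1 := by
  have hopen : IsOpen {y : v.adicCompletion K | ‖y - z‖ < ‖(1 : v.adicCompletion K)‖} :=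
    isOpen_lt (by fun_prop) continuous_const
  obtain ⟨q, hq⟩ := (v.denseRange_algebraMap K).exists_mem_open hopen ⟨z, by simp⟩
  rw [Set.mem_ofPred_eq, norm_lt_norm_iff, map_one] at hq
  have hq1 : v.valuation K q ≤ 1 := by
    rw [← valued_algebraMap, ← sub_add_cancel (algebraMap K (v.adicCompletion K) q) z]
    exact Valuation.map_add_le _ hq.le hz
  obtain ⟨r, hr⟩ := v.exists_valuation_sub_lt_of_integer hq1 1
  rw [Units.val_one, ← valued_algebraMap, map_sub] at hr
  refine ⟨r, ?_⟩
  rw [← sub_sub_sub_cancel_right _ _ (algebraMap K (v.adicCompletion K) q)]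
  exact Valuation.map_sub_lt _ (by rwa [Valuation.map_sub_swap]) hr

lemma pow_absNorm_sub_mem (x : 𝓞 K) : x ^ Ideal.absNorm v.asIdeal - x ∈ v.asIdeal := by
  have := v.isPrime.isMaximal v.ne_bot
  let : Field (𝓞 K ⧸ v.asIdeal) := Ideal.Quotient.field _
  have : Finite (𝓞 K ⧸ v.asIdeal) := v.asIdeal.finiteQuotientOfFreeOfNeBot v.ne_bot
  have := Fintype.ofFinite (𝓞 K ⧸ v.asIdeal)
  rw [← Ideal.Quotient.eq, map_pow, Ideal.absNorm_apply, Submodule.cardQuot_apply,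
    Nat.card_eq_fintype_card, FiniteField.pow_card]

lemma valued_lt_one_or_of_absNorm_eq_two (h : Ideal.absNorm v.asIdeal = 2)
    {z : v.adicCompletion K} (hz : Valued.v z ≤ 1) : Valued.v z < 1 ∨ Valued.v (z - 1) < 1 := by
  obtain ⟨r, hr⟩ := exists_valued_sub_lt_one v hz
  have key {x : 𝓞 K} (hx : x ∈ v.asIdeal) :
      Valued.v (algebraMap K (v.adicCompletion K) (algebraMap (𝓞 K) K x)) < 1 := by
    rwa [valued_algebraMap, valuation_lt_one_iff_mem]
  have hmem : r * (r - 1) ∈ v.asIdeal := by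
    simpa [h, mul_sub, sq] using pow_absNorm_sub_mem v r
  refine (v.isPrime.mem_or_mem hmem).imp (fun h0 => ?_) fun h1 => ?_
  · simpa using Valuation.map_add_lt _ hr (key h0)
  · simpa using Valuation.map_add_lt _ hr (key h1)

end Completion

section CompletionMap

variable {F K : Type*} [Field F] [NumberField F] [Field K] [NumberField K] [Algebra F K]
  (v : HeightOneSpectrum (𝓞 F)) (w : HeightOneSpectrum (𝓞 K)) [w.asIdeal.LiesOver v.asIdeal]

/-- By density this reduces to elements of `F`. -/
lemma valued_completionMap (x : v.adicCompletion F) :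
    Valued.v (completionMap v w x) = Valued.v x ^ v.asIdeal.ramificationIdx' w.asIdeal := by
  rcases eq_or_ne x 0 with rfl | hx
  · rw [map_zero, map_zero, map_zero, zero_pow]
    exact Ideal.IsDedekindDomain.ramificationIdx'_ne_zero_of_liesOver w.asIdeal v.ne_bot
  have hcont := continuous_completionMap v w
  have hopen : IsOpen {y : v.adicCompletion F | ‖y - x‖ < ‖x‖ ∧
      ‖completionMap v w y - completionMap v w x‖ < ‖completionMap v w x‖} :=
    (isOpen_lt (f := fun y => ‖y - x‖) (by fun_prop) continuous_const).inter
      (isOpen_lt (f := fun y => ‖completionMap v w y - completionMap v w x‖) (by fun_prop)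
        continuous_const)
  obtain ⟨q, hqx, hqx'⟩ :=
    (v.denseRange_algebraMap F).exists_mem_open hopen ⟨x, by
    simpa [Valuation.pos_iff] using hx⟩
  rw [norm_lt_norm_iff] at hqx hqx'
  rw [← Valuation.map_eq_of_sub_lt _ hqx', ← Valuation.map_eq_of_sub_lt _ hqx,
    completionMap_algebraMap, IsScalarTower.algebraMap_apply F K, valued_algebraMap,
    valued_algebraMap, valuation_liesOver K]

lemma valued_completionMap_le_one {x : v.adicCompletion F} (hx : Valued.v x ≤ 1) :
    Valued.v (completionMap v w x) ≤ 1 :=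
  valued_completionMap v w x ▸ pow_le_one₀ zero_le hx

lemma valued_completionMap_eq_pow {p : F} (hp : v.valuation F p = exp (-1)) {e : ℕ}
    (he : w.valuation K (algebraMap F K p) = exp (-e : ℤ)) (x : v.adicCompletion F) :
    Valued.v (completionMap v w x) = Valued.v x ^ e := by
  rw [← valuation_liesOver K v w, hp, ← exp_nsmul, exp_inj, nsmul_eq_mul, mul_neg_one,
    neg_inj, Nat.cast_inj] at he
  rw [valued_completionMap, he]

lemma norm_completionMap {e f : ℕ} (he : ∀ x, Valued.v (completionMap v w x) = Valued.v x ^ e)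
    (hf : Ideal.absNorm w.asIdeal = Ideal.absNorm v.asIdeal ^ f) (he0 : e ≠ 0) (hf0 : f ≠ 0)
    (x : v.adicCompletion F) : ‖completionMap v w x‖ = ‖x‖ ^ (e * f) := by
  rcases eq_or_ne x 0 with rfl | hx
  · rw [map_zero, norm_zero, norm_zero, zero_pow (mul_ne_zero he0 hf0)]
  have hv : Valued.v x = exp (log (Valued.v x)) := (exp_log ((Valuation.ne_zero_iff _).mpr hx)).symm
  rw [norm_eq_of_valued_eq v hv, norm_eq_of_valued_eq w ((he x).trans (hv ▸ (exp_nsmul _ _).symm)),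
    hf]
  push_cast
  rw [← zpow_natCast, ← zpow_natCast, ← zpow_mul, ← zpow_mul]
  congr 1
  push_cast
  ring

open scoped Valued in
lemma exists_eq_completionMap_add_mul {s : K}
    (hs : ∀ x : K, ∃ a b : F, x = algebraMap F K a + algebraMap F K b * s)
    (z : w.adicCompletion K) : ∃ a b : v.adicCompletion F,
      z = completionMap v w a + completionMap v w b * algebraMap K (w.adicCompletion K) s := by
  let := completionAlgebra v w
  have : ContinuousSMul (v.adicCompletion F) (w.adicCompletion K) :=
    ⟨((continuous_completionMap v w).comp continuous_fst).mul continuous_snd⟩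
  let S : Submodule (v.adicCompletion F) (w.adicCompletion K) :=
    .span _ {1, algebraMap K (w.adicCompletion K) s}
  have mem_S (z : w.adicCompletion K) : z ∈ S ↔ ∃ a b : v.adicCompletion F,
      completionMap v w a + completionMap v w b * algebraMap K (w.adicCompletion K) s = z := by
    simp only [S, Submodule.mem_span_pair, Algebra.smul_def, mul_one, RingHom.algebraMap_toAlgebra]
  have : FiniteDimensional (v.adicCompletion F) S :=
    FiniteDimensional.span_of_finite _ (Set.toFinite _)
  -- `S` is closed, being finite-dimensional, and contains the dense subfield `K`
  have hS : (S : Set (w.adicCompletion K)) = Set.univ := by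
    rw [← S.closed_of_finiteDimensional.closure_eq]
    refine ((w.denseRange_algebraMap K).mono ?_).closure_eq
    rintro _ ⟨x, rfl⟩
    obtain ⟨a, b, rfl⟩ := hs x
    refine (mem_S _).mpr ⟨algebraMap F _ a, algebraMap F _ b, ?_⟩
    rw [completionMap_algebraMap, completionMap_algebraMap, map_add, map_mul,
      ← IsScalarTower.algebraMap_apply, ← IsScalarTower.algebraMap_apply]
  obtain ⟨a, b, h⟩ := (mem_S z).mp (hS.ge (Set.mem_univ z))
  exact ⟨a, b, h.symm⟩

end CompletionMap

/-! ### Local discriminants -/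

section Discriminant

section BasisFinTwo

variable {A S : Type*} [CommRing A] [CommRing S] [Algebra A S] (b : Module.Basis (Fin 2) A S)
  (h0 : b 0 = 1) {t N : A} (h1 : b 1 ^ 2 = t • b 1 - N • b 0)
include h0 h1

lemma trace_of_basis_fin_two : Algebra.trace A S (b 1) = t := by
  rw [Algebra.trace_eq_matrix_trace b, Matrix.trace_fin_two, Algebra.leftMulMatrix_eq_repr_mul,
    Algebra.leftMulMatrix_eq_repr_mul, ← sq, h1, h0, mul_one, ← h0]
  simp

lemma discr_of_basis_fin_two : Algebra.discr A b = t ^ 2 - 4 * N := by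
  have trace_zero : Algebra.trace A S (b 0) = 2 := by
    simpa [h0] using Algebra.trace_algebraMap_of_basis b (1 : A)
  have trace_one := trace_of_basis_fin_two b h0 h1
  rw [Algebra.discr_def, Matrix.det_fin_two]
  simp only [Algebra.traceMatrix_apply, Algebra.traceForm_apply]
  rw [← sq (b 1), h1, map_sub, map_smul, map_smul, trace_one, h0, one_mul, one_mul, mul_one, ← h0,
    trace_zero, trace_one, smul_eq_mul, smul_eq_mul]
  ring

end BasisFinTwo

lemma exists_discr_eq_unit_sq_mul_discr {A S ι κ : Type*} [CommRing A] [Nontrivial A] [CommRing S]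
    [Algebra A S] [Fintype ι] [DecidableEq ι] [Fintype κ] [DecidableEq κ]
    (b : Module.Basis ι A S) (c : Module.Basis κ A S) :
    ∃ u : Aˣ, Algebra.discr A c = u ^ 2 * Algebra.discr A b := by
  let e := c.indexEquiv b
  obtain ⟨u, hu⟩ := b.isUnit_det (c.reindex e)
  refine ⟨u, ?_⟩
  rw [← Algebra.discr_reindex A c e, hu, Module.Basis.det_apply, ← Algebra.discr_of_matrix_vecMul,
    Module.Basis.toMatrix_map_vecMul, Module.Basis.coe_reindex]

lemma exists_basis_integralClosure {R L : Type*} [CommRing R] [Field L] [Algebra R L] {π : L}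
    (hπ : IsIntegral R π)
    (hspan : ∀ x : L, IsIntegral R x → ∃ c d : R, x = algebraMap R L c + algebraMap R L d * π)
    (hind : ∀ c d : R, algebraMap R L c + algebraMap R L d * π = 0 → c = 0 ∧ d = 0) :
    ∃ b : Module.Basis (Fin 2) R (integralClosure R L), b 0 = 1 ∧ (b 1 : L) = π := by
  let g : Fin 2 → integralClosure R L := ![1, ⟨π, hπ⟩]
  have hli : LinearIndependent R g := by
    refine LinearIndependent.pair_iff.mpr fun c d h => hind c d ?_
    simpa [Algebra.smul_def] using congrArg (Subtype.val : integralClosure R L → L) h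
  have hsp : ⊤ ≤ Submodule.span R (Set.range g) := by
    rintro ⟨x, hx⟩ -
    obtain ⟨c, d, rfl⟩ := hspan x hx
    rw [Matrix.range_cons_cons_empty, Submodule.mem_span_pair]
    exact ⟨c, d, Subtype.ext (by simp [Algebra.smul_def])⟩
  exact ⟨.mk hli hsp, by simp [g], by simp [g]⟩

lemma isIntegral_of_sq_eq {R L : Type*} [CommRing R] [CommRing L] [Algebra R L] {π : L} {t N : R}
    (hπ : π ^ 2 = algebraMap R L t * π - algebraMap R L N) : IsIntegral R π := by
  refine ⟨.X ^ 2 - .C t * .X + .C N, by monicity!, ?_⟩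
  simp only [Polynomial.eval₂_add, Polynomial.eval₂_sub, Polynomial.eval₂_mul,
    Polynomial.eval₂_pow, Polynomial.eval₂_X, Polynomial.eval₂_C]
  linear_combination hπ

theorem exists_extensionDiscriminant_eq (R F L : Type*) [CommRing R] [IsDomain R]
    [IsPrincipalIdealRing R] [Field F] [Algebra R F] [IsFractionRing R F] [Field L] [Algebra F L]
    [Algebra R L] [IsScalarTower R F L] [FiniteDimensional F L] [Algebra.IsSeparable F L]
    {π : L} {t N : R} (hπ : π ^ 2 = algebraMap R L t * π - algebraMap R L N)
    (hspan : ∀ x : L, IsIntegral R x → ∃ c d : R, x = algebraMap R L c + algebraMap R L d * π)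
    (hind : ∀ c d : R, algebraMap R L c + algebraMap R L d * π = 0 → c = 0 ∧ d = 0) :
    ∃ u : Rˣ, extensionDiscriminant R F L = u ^ 2 * (t ^ 2 - 4 * N) := by
  obtain ⟨b, hb0, hb1⟩ := exists_basis_integralClosure (isIntegral_of_sq_eq hπ) hspan hind
  have hdiscr : Algebra.discr R b = t ^ 2 - 4 * N :=
    discr_of_basis_fin_two b hb0 (Subtype.ext (by simpa [hb0, hb1, Algebra.smul_def] using hπ))
  have : Module.IsTorsionFree R L := .trans_faithfulSMul R F L
  have : IsNoetherian R (integralClosure R L) :=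
    IsIntegralClosure.isNoetherian R F L (integralClosure R L)
  have : Module.Free R (integralClosure R L) :=
    IsIntegralClosure.module_free R F L (integralClosure R L)
  exact hdiscr ▸ exists_discr_eq_unit_sq_mul_discr b _

end Discriminant

open HeightOneSpectrum WithZero

section LocalDiscriminant

variable {F K : Type*} [Field F] [NumberField F] [Field K] [NumberField K] [Algebra F K]
  (v : HeightOneSpectrum (𝓞 F)) (w : HeightOneSpectrum (𝓞 K)) [w.asIdeal.LiesOver v.asIdeal]

lemma valued_le_one_of_isIntegral {x : w.adicCompletion K}
    (hx : letI := completionAlgebra v w; IsIntegral (v.adicCompletionIntegers F) x) :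
    Valued.v x ≤ 1 := by
  let := completionAlgebra v w
  obtain ⟨P, hP, h⟩ := hx
  let g : v.adicCompletionIntegers F →+* w.adicCompletionIntegers K :=
    ((completionMap v w).comp (v.adicCompletionIntegers F).subtype).codRestrict
      (w.adicCompletionIntegers K).toSubring fun y => valued_completionMap_le_one v w y.2
  have hint : IsIntegral (w.adicCompletionIntegers K) x :=
    ⟨P.map g, hP.map g, by rw [Polynomial.eval₂_map]; exact h⟩
  obtain ⟨y, rfl⟩ := IsIntegrallyClosed.isIntegral_iff.mp hint
  exact y.2

lemma eq_zero_of_forall_valued_mul_le_one {x : v.adicCompletion F}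
    (h : ∀ c, Valued.v (c * x) ≤ 1) : x = 0 := by
  obtain ⟨y, hy⟩ := valuedAdicCompletion_surjective F v (exp 1)
  by_contra hx
  have := h (y / x)
  rw [div_mul_cancel₀ y hx, hy, ← exp_zero, exp_le_exp] at this
  norm_num at this

lemma eq_zero_of_completionMap_add_mul_eq_zero {θ : w.adicCompletion K}
    (hval : ∀ a b, Valued.v (completionMap v w a + completionMap v w b * θ) ≤ 1 →
      Valued.v a ≤ 1 ∧ Valued.v b ≤ 1)
    {a b : v.adicCompletion F} (h : completionMap v w a + completionMap v w b * θ = 0) :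
    a = 0 ∧ b = 0 := by
  have bounded (c) : Valued.v (c * a) ≤ 1 ∧ Valued.v (c * b) ≤ 1 := by
    refine hval _ _ ?_
    rw [map_mul, map_mul, mul_assoc, ← mul_add, h, mul_zero, map_zero]
    exact zero_le
  exact ⟨eq_zero_of_forall_valued_mul_le_one v fun c => (bounded c).1,
    eq_zero_of_forall_valued_mul_le_one v fun c => (bounded c).2⟩

theorem valued_localDiscriminant {θ : w.adicCompletion K} {t N : v.adicCompletion F}
    (ht : Valued.v t ≤ 1) (hN : Valued.v N ≤ 1)
    (hθ : θ ^ 2 = completionMap v w t * θ - completionMap v w N)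
    (hspan : ∀ z, ∃ a b, z = completionMap v w a + completionMap v w b * θ)
    (hval : ∀ a b, Valued.v (completionMap v w a + completionMap v w b * θ) ≤ 1 →
      Valued.v a ≤ 1 ∧ Valued.v b ≤ 1) :
    Valued.v (localDiscriminant v w) = Valued.v (t ^ 2 - 4 * N) := by
  let := completionAlgebra v w
  have := finiteDimensional_completion v w
  obtain ⟨u, hu⟩ := exists_extensionDiscriminant_eq (v.adicCompletionIntegers F)
    (v.adicCompletion F) (w.adicCompletion K) (π := θ) (t := ⟨t, ht⟩) (N := ⟨N, hN⟩) hθ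
    (fun x hx => by
      obtain ⟨a, b, rfl⟩ := hspan x
      obtain ⟨ha, hb⟩ := hval a b (valued_le_one_of_isIntegral v w hx)
      exact ⟨⟨a, ha⟩, ⟨b, hb⟩, rfl⟩)
    (fun c d h => (eq_zero_of_completionMap_add_mul_eq_zero v w hval h).imp Subtype.ext Subtype.ext)
  have valued_u : Valued.v ((u : v.adicCompletionIntegers F) : v.adicCompletion F) = 1 :=
    adicCompletionIntegers.isUnit_iff_valued_eq_one.mp u.isUnit
  have discr_eq : localDiscriminant v w =
      ((u : v.adicCompletionIntegers F) : v.adicCompletion F) ^ 2 * (t ^ 2 - 4 * N) :=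
    congrArg (algebraMap (v.adicCompletionIntegers F) (v.adicCompletion F)) hu
  rw [discr_eq, map_mul, map_pow, valued_u, one_pow, one_mul]

lemma le_one_of_sq_mul_exp_neg_one_le_one {g : WithZero (Multiplicative ℤ)}
    (h : g ^ 2 * exp (-1) ≤ 1) : g ≤ 1 := by
  rcases eq_or_ne g 0 with rfl | h0
  · exact zero_le
  · rw [← exp_log h0, ← exp_nsmul, ← exp_add, ← exp_zero, exp_le_exp, nsmul_eq_mul] at h
    rw [← exp_log h0, ← exp_zero, exp_le_exp]
    push_cast at h
    lia

lemma valued_le_one_of_ramified (he : ∀ x, Valued.v (completionMap v w x) = Valued.v x ^ 2)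
    {θ : w.adicCompletion K} (hθ : Valued.v θ = exp (-1)) (a b : v.adicCompletion F)
    (h : Valued.v (completionMap v w a + completionMap v w b * θ) ≤ 1) :
    Valued.v a ≤ 1 ∧ Valued.v b ≤ 1 := by
  have hb : Valued.v (completionMap v w b * θ) = Valued.v b ^ 2 * exp (-1) := by
    rw [map_mul, he, hθ]
  rcases eq_or_ne b 0 with rfl | hb0
  · rw [map_zero, zero_mul, add_zero, he, pow_le_one_iff_of_nonneg zero_le two_ne_zero] at h
    exact ⟨h, by rw [map_zero]; exact zero_le⟩
  -- the two terms have valuations of different parity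
  have hne : Valued.v (completionMap v w a) ≠ Valued.v (completionMap v w b * θ) := fun hab => by
    rw [he, hb] at hab
    refine sq_ne_exp_of_odd (Valued.v a / Valued.v b) (k := -1) (by decide) ?_
    rw [div_pow, hab, mul_div_cancel_left₀ _ (pow_ne_zero 2 (Valued.v.ne_zero_iff.mpr hb0))]
  rw [Valuation.map_add_of_distinct_val _ hne, max_le_iff, he, hb] at h
  exact ⟨(pow_le_one_iff_of_nonneg zero_le two_ne_zero).mp h.1,
    le_one_of_sq_mul_exp_neg_one_le_one h.2⟩

/-- The hypothesis on `θ` says that its residue class generates the residue field extension. -/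
lemma valued_le_one_of_unramified (he : ∀ x, Valued.v (completionMap v w x) = Valued.v x)
    {θ : w.adicCompletion K}
    (hθ : ∀ u, Valued.v u ≤ 1 → Valued.v (completionMap v w u + θ) = 1) (a b : v.adicCompletion F)
    (h : Valued.v (completionMap v w a + completionMap v w b * θ) ≤ 1) :
    Valued.v a ≤ 1 ∧ Valued.v b ≤ 1 := by
  have hθ1 : Valued.v θ = 1 := by simpa using hθ 0 (by simp)
  rcases le_or_gt (Valued.v a) (Valued.v b) with hab | hab
  · rcases eq_or_ne b 0 with rfl | hb
    · rw [map_zero] at hab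
      rw [map_zero]
      exact ⟨hab.trans zero_le, zero_le⟩
    have h1 := hθ (a / b) (by rw [map_div₀]; exact div_le_one_of_le₀ hab zero_le)
    have hb' : completionMap v w b ≠ 0 := (map_ne_zero _).mpr hb
    have factor : completionMap v w a + completionMap v w b * θ =
        completionMap v w b * (completionMap v w (a / b) + θ) := by
      rw [map_div₀]
      field_simp
    rw [factor, map_mul, h1, mul_one, he] at h
    exact ⟨hab.trans h, h⟩
  · rw [Valuation.map_add_eq_of_lt_left, he] at h
    · exact ⟨h, hab.le.trans h⟩
    · rwa [map_mul, he, he, hθ1, mul_one]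

end LocalDiscriminant

/-! ### Rational primes in quadratic fields -/

section RationalPlaces

variable (v : HeightOneSpectrum (𝓞 ℚ))

lemma intCast_mem_asIdeal_iff (j : ℤ) : (j : 𝓞 ℚ) ∈ v.asIdeal ↔ (natGenerator v : ℤ) ∣ j := by
  rw [← Ideal.mem_span_singleton, span_natGenerator,
    ← Ideal.apply_mem_of_equiv_iff (f := Rat.IsIntegralClosure.intEquiv (𝓞 ℚ)), map_intCast]
  rfl

lemma exists_intCast_eq (x : 𝓞 ℚ) : ∃ j : ℤ, x = j := by
  obtain ⟨j, hj⟩ := Rat.int_algebraMap_surjective (𝓞 ℚ) x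
  exact ⟨j, by rw [← hj]; simp⟩

lemma asIdeal_eq_span : v.asIdeal = Ideal.span {(natGenerator v : 𝓞 ℚ)} := by
  ext x
  obtain ⟨j, rfl⟩ := exists_intCast_eq x
  rw [intCast_mem_asIdeal_iff, Ideal.mem_span_singleton]
  constructor
  · rintro ⟨k, rfl⟩
    exact ⟨k, by push_cast; rfl⟩
  · rintro ⟨x, hx⟩
    obtain ⟨k, rfl⟩ := exists_intCast_eq x
    exact ⟨k, by exact_mod_cast hx⟩

lemma valuation_intCast_lt_one_iff (j : ℤ) :
    v.valuation ℚ (j : ℚ) < 1 ↔ (natGenerator v : ℤ) ∣ j := by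
  rw [← intCast_mem_asIdeal_iff, ← v.valuation_lt_one_iff_mem (K := ℚ)]
  simp

lemma valuation_intCast_eq_one {j : ℤ} (h : ¬ (natGenerator v : ℤ) ∣ j) :
    v.valuation ℚ (j : ℚ) = 1 :=
  le_antisymm (valuation_intCast_le_one v j)
    (not_lt.mp fun h' => h ((valuation_intCast_lt_one_iff v j).mp h'))

lemma valuation_natGenerator : v.valuation ℚ (natGenerator v : ℚ) = exp (-1) := by
  have h : (natGenerator v : 𝓞 ℚ) ≠ 0 := by exact_mod_cast (prime_natGenerator v).ne_zero
  have := v.valuation_of_algebraMap (K := ℚ) (natGenerator v : 𝓞 ℚ)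
  rw [v.intValuation_singleton h (asIdeal_eq_span v)] at this
  simpa using this

lemma absNorm_asIdeal : Ideal.absNorm v.asIdeal = natGenerator v := by
  rw [asIdeal_eq_span, Ideal.absNorm_span_natCast, RingOfIntegers.rank, Module.finrank_self,
    pow_one]

lemma natGenerator_injective :
    Function.Injective (natGenerator : HeightOneSpectrum (𝓞 ℚ) → ℕ) := fun v v' h =>
  HeightOneSpectrum.ext (by rw [asIdeal_eq_span, asIdeal_eq_span, h])

lemma exists_natGenerator_eq {p : ℕ} (hp : p.Prime) :
    ∃ v : HeightOneSpectrum (𝓞 ℚ), natGenerator v = p :=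
  ⟨primesEquiv.symm ⟨p, hp⟩, congrArg Subtype.val (primesEquiv.apply_symm_apply ⟨p, hp⟩)⟩

end RationalPlaces

section PlacesAbove

variable {K : Type*} [Field K] [NumberField K] (v : HeightOneSpectrum (𝓞 ℚ))
  (w : HeightOneSpectrum (𝓞 K))

lemma map_asIdeal_eq_span : v.asIdeal.map (algebraMap (𝓞 ℚ) (𝓞 K)) =
    Ideal.span {(natGenerator v : 𝓞 K)} := by
  rw [asIdeal_eq_span, Ideal.map_span, Set.image_singleton, map_natCast]

lemma natGenerator_mem [w.asIdeal.LiesOver v.asIdeal] : (natGenerator v : 𝓞 K) ∈ w.asIdeal := by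
  have : (natGenerator v : 𝓞 ℚ) ∈ v.asIdeal := by
    rw [asIdeal_eq_span]; exact Ideal.mem_span_singleton_self _
  rw [Ideal.mem_of_liesOver w.asIdeal v.asIdeal, map_natCast] at this
  exact this

lemma intCast_mem_iff [w.asIdeal.LiesOver v.asIdeal] (j : ℤ) :
    (j : 𝓞 K) ∈ w.asIdeal ↔ (natGenerator v : ℤ) ∣ j := by
  rw [← intCast_mem_asIdeal_iff, Ideal.mem_of_liesOver w.asIdeal v.asIdeal, map_intCast]

variable (hK : Module.finrank ℚ K = 2)

include hK in
lemma absNorm_of_sq_mem (h : (natGenerator v : 𝓞 K) ∈ w.asIdeal ^ 2) :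
    Ideal.absNorm w.asIdeal = natGenerator v := by
  rw [← Ideal.dvd_span_singleton] at h
  have h1 := map_dvd Ideal.absNorm h
  rw [map_pow, Ideal.absNorm_span_natCast, RingOfIntegers.rank, hK,
    Nat.pow_dvd_pow_iff two_ne_zero] at h1
  exact ((Nat.dvd_prime (prime_natGenerator v)).mp h1).resolve_left
    (HeightOneSpectrum.one_lt_absNorm w).ne'

include hK in
lemma valuation_natGenerator_of_sq_mem (h : (natGenerator v : 𝓞 K) ∈ w.asIdeal ^ 2) :
    w.valuation K (algebraMap ℚ K (natGenerator v)) = exp (-(2 : ℕ) : ℤ) := by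
  have h0 : w.valuation K (natGenerator v : K) = w.intValuation (natGenerator v : 𝓞 K) := by
    simpa using w.valuation_of_algebraMap (K := K) (natGenerator v : 𝓞 K)
  rw [map_natCast (algebraMap ℚ K)]
  refine h0.trans <| le_antisymm ((w.intValuation_le_pow_iff_mem _ 2).mpr h) <|
    not_lt.mp fun hlt => ?_
  have h3 : w.intValuation (natGenerator v : 𝓞 K) ≤ exp (-(3 : ℕ) : ℤ) := by
    have hne : w.intValuation (natGenerator v : 𝓞 K) ≠ 0 := by
      refine w.intValuation_ne_zero _ ?_
      exact_mod_cast (prime_natGenerator v).ne_zero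
    rw [← exp_log hne, exp_lt_exp] at hlt
    rw [← exp_log hne, exp_le_exp]
    push_cast at hlt ⊢
    omega
  rw [w.intValuation_le_pow_iff_dvd] at h3
  have h1 := map_dvd Ideal.absNorm h3
  rw [map_pow, Ideal.absNorm_span_natCast, RingOfIntegers.rank, hK, absNorm_of_sq_mem v w hK h,
    Nat.pow_dvd_pow_iff_le_right (prime_natGenerator v).one_lt] at h1
  omega

lemma asIdeal_eq_span_of_isInertIn [w.asIdeal.LiesOver v.asIdeal] (h : IsInertIn K v) :
    w.asIdeal = Ideal.span {(natGenerator v : 𝓞 K)} := by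
  rw [IsInertIn, map_asIdeal_eq_span] at h
  have h0 : Ideal.span {(natGenerator v : 𝓞 K)} ≠ ⊥ := by
    rw [Ne, Ideal.span_singleton_eq_bot]
    exact_mod_cast (prime_natGenerator v).ne_zero
  refine ((h.isMaximal h0).eq_of_le w.isPrime.ne_top ?_).symm
  rw [Ideal.span_singleton_le_iff_mem]
  exact natGenerator_mem v w

include hK in
lemma absNorm_of_isInertIn [w.asIdeal.LiesOver v.asIdeal] (h : IsInertIn K v) :
    Ideal.absNorm w.asIdeal = natGenerator v ^ 2 := by
  rw [asIdeal_eq_span_of_isInertIn v w h, Ideal.absNorm_span_natCast, RingOfIntegers.rank, hK]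

lemma valuation_natGenerator_of_isInertIn [w.asIdeal.LiesOver v.asIdeal] (h : IsInertIn K v) :
    w.valuation K (algebraMap ℚ K (natGenerator v)) = exp (-(1 : ℕ) : ℤ) := by
  have h0 : (natGenerator v : 𝓞 K) ≠ 0 := by exact_mod_cast (prime_natGenerator v).ne_zero
  have := w.valuation_of_algebraMap (K := K) (natGenerator v : 𝓞 K)
  rw [w.intValuation_singleton h0 (asIdeal_eq_span_of_isInertIn v w h)] at this
  simpa using this

lemma liesOver_of_natGenerator_mem (h : (natGenerator v : 𝓞 K) ∈ w.asIdeal) :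
    w.asIdeal.LiesOver v.asIdeal := by
  refine ⟨(v.isPrime.isMaximal v.ne_bot).eq_of_le Ideal.IsPrime.ne_top' ?_⟩
  rw [asIdeal_eq_span, Ideal.span_singleton_le_iff_mem]
  simpa [Ideal.mem_comap] using h

lemma isRamifiedIn_of_mem_sq (h : (natGenerator v : 𝓞 K) ∈ w.asIdeal ^ 2) : IsRamifiedIn K v :=
  ⟨w, by rwa [map_asIdeal_eq_span, Ideal.span_singleton_le_iff_mem]⟩

include hK in
lemma isInertIn_of_absNorm_ne [w.asIdeal.LiesOver v.asIdeal]
    (h : Ideal.absNorm w.asIdeal ≠ natGenerator v) : IsInertIn K v := by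
  rw [IsInertIn, map_asIdeal_eq_span]
  obtain ⟨J, hJ⟩ := Ideal.dvd_span_singleton.mpr (natGenerator_mem v w)
  have hmul := congrArg Ideal.absNorm hJ
  rw [Ideal.absNorm_span_natCast, RingOfIntegers.rank, hK, map_mul] at hmul
  have hJ1 : Ideal.absNorm J = 1 := by
    by_contra hJ1
    exact h (((prime_natGenerator v).mul_eq_prime_sq_iff (one_lt_absNorm w).ne' hJ1).mp
      hmul.symm).1
  rw [hJ, Ideal.absNorm_eq_one_iff.mp hJ1, Ideal.mul_top]
  exact w.isPrime

end PlacesAbove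

section QuadraticField

variable {K : Type*} [Field K] [NumberField K]

lemma sqrt_notMem_range {n : ℤ} (hn : Squarefree n) (hn1 : n ≠ 1) {s : K} (hs : s ^ 2 = n) :
    s ∉ (algebraMap ℚ K).range := by
  rintro ⟨q, rfl⟩
  have hq : (n : ℚ) = q * q :=
    (algebraMap ℚ K).injective (by rw [map_mul, ← sq, hs, map_intCast])
  obtain ⟨z, rfl⟩ := Rat.isSquare_intCast_iff.mp ⟨q, hq⟩
  rcases Int.isUnit_iff.mp (hn z dvd_rfl) with rfl | rfl <;> exact hn1 rfl

section Basis

variable (hK : Module.finrank ℚ K = 2) {x : K} (hx : x ∉ (algebraMap ℚ K).range)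
include hK hx

lemma exists_basis_one_self : ∃ b : Module.Basis (Fin 2) ℚ K, b 0 = 1 ∧ b 1 = x := by
  have hli : LinearIndependent ℚ ![1, x] := (LinearIndependent.pair_iff' one_ne_zero).mpr
    fun a ha => hx ⟨a, by rw [← ha, Algebra.smul_def, mul_one]⟩
  exact ⟨basisOfLinearIndependentOfCardEqFinrank hli (by simp [hK]), by simp, by simp⟩

lemma exists_eq_add_mul (y : K) : ∃ a b : ℚ, y = algebraMap ℚ K a + algebraMap ℚ K b * x := by
  obtain ⟨b, h0, h1⟩ := exists_basis_one_self hK hx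
  refine ⟨b.repr y 0, b.repr y 1, ?_⟩
  conv_lhs => rw [← b.sum_repr y]
  rw [Fin.sum_univ_two, h0, h1, Algebra.smul_def, Algebra.smul_def, mul_one]

end Basis

section IntegralGenerator

variable (hK : Module.finrank ℚ K = 2) {x : 𝓞 K} {t N : ℤ} (hx : x ^ 2 = t * x - N)
  (hxQ : (x : K) ∉ (algebraMap ℚ K).range)
include hx hxQ

lemma minpoly_eq_of_sq_eq : minpoly ℤ x = .X ^ 2 - .C t * .X + .C N := by
  have hint : IsIntegral ℤ x := RingOfIntegers.isIntegral x
  have hmon : (.X ^ 2 - .C t * .X + .C N : Polynomial ℤ).Monic := by monicity!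
  refine (Polynomial.eq_of_monic_of_dvd_of_natDegree_le (minpoly.monic hint) hmon
    (minpoly.isIntegrallyClosed_dvd hint ?_) ?_).symm
  · simp only [map_add, map_sub, map_mul, map_pow, Polynomial.aeval_X, Polynomial.aeval_C, hx]
    simp
  · have h2 : (.X ^ 2 - .C t * .X + .C N : Polynomial ℤ).natDegree = 2 := by compute_degree!
    rw [h2, minpoly.two_le_natDegree_iff hint]
    rintro ⟨y, rfl⟩
    exact hxQ ⟨y, by simp⟩

include hK

lemma trace_eq_of_sq_eq : Algebra.trace ℤ (𝓞 K) x = t := by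
  obtain ⟨b, h0, h1⟩ := exists_basis_one_self hK hxQ
  have hx' := congrArg (algebraMap (𝓞 K) K) hx
  have htr := trace_of_basis_fin_two b h0 (t := (t : ℚ)) (N := N) <| by
    rw [h1, h0]
    simpa [Algebra.smul_def] using hx'
  rw [h1, ← Algebra.coe_trace_int] at htr
  exact_mod_cast htr

lemma two_mul_sub_mem_of_sq_mem (w : HeightOneSpectrum (𝓞 K)) {p : ℕ} (hp : p.Prime)
    (h : (p : 𝓞 K) ∈ w.asIdeal ^ 2) : 2 * x - t ∈ w.asIdeal := by
  have hadj : Algebra.adjoin ℚ {algebraMap (𝓞 K) K x} = ⊤ := by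
    refine eq_top_iff.mpr fun y _ => ?_
    obtain ⟨a, b, rfl⟩ := exists_eq_add_mul hK hxQ y
    exact add_mem (Subalgebra.algebraMap_mem _ _)
      (mul_mem (Subalgebra.algebraMap_mem _ _) (Algebra.self_mem_adjoin_singleton ℚ _))
  have : (Ideal.span {(p : ℤ)}).IsMaximal :=
    PrincipalIdealRing.isMaximal_of_irreducible (Nat.prime_iff_prime_int.mp hp).irreducible
  have hdvd : w.asIdeal ^ (2 - 1) ∣ differentIdeal ℤ (𝓞 K) :=
    pow_sub_one_dvd_differentIdeal ℤ (p := Ideal.span {(p : ℤ)}) w.asIdeal 2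
      (by simp [hp.ne_zero])
      (by rwa [Ideal.map_span, Set.image_singleton, map_natCast, Ideal.dvd_span_singleton])
  have hd := Ideal.le_of_dvd hdvd (aeval_derivative_mem_differentIdeal ℤ ℚ K x hadj)
  rw [minpoly_eq_of_sq_eq hx hxQ] at hd
  simpa [map_ofNat] using hd

lemma not_isRamifiedIn (v : HeightOneSpectrum (𝓞 ℚ))
    (h : ¬ (natGenerator v : ℤ) ∣ t ^ 2 - 4 * N) : ¬ IsRamifiedIn K v := by
  rintro ⟨w, hw⟩
  rw [map_asIdeal_eq_span, Ideal.span_singleton_le_iff_mem] at hw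
  have := liesOver_of_natGenerator_mem v w (Ideal.pow_le_self two_ne_zero hw)
  rw [← intCast_mem_iff v w] at h
  refine h ?_
  rw [show ((t ^ 2 - 4 * N : ℤ) : 𝓞 K) = (2 * x - t) * (2 * x - t) by
    push_cast; linear_combination -4 * hx]
  exact Ideal.mul_mem_right _ _
    (two_mul_sub_mem_of_sq_mem hK hx hxQ w (prime_natGenerator v) hw)

end IntegralGenerator

omit [NumberField K] in
lemma not_two_dvd_of_odd_trace {x : 𝓞 K} (h : Odd (Algebra.trace ℤ (𝓞 K) x)) : ¬ 2 ∣ x := by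
  rintro ⟨y, rfl⟩
  rw [two_mul, map_add, ← two_mul] at h
  exact Int.not_even_iff_odd.mpr h (even_two_mul _)

variable (v : HeightOneSpectrum (𝓞 ℚ)) (w : HeightOneSpectrum (𝓞 K))

lemma natGenerator_mem_sq_of_dvd [w.asIdeal.LiesOver v.asIdeal] {n : ℤ} (hn : Squarefree n)
    {S : 𝓞 K} (hS : S ^ 2 = n) (h : (natGenerator v : ℤ) ∣ n) :
    (natGenerator v : 𝓞 K) ∈ w.asIdeal ^ 2 := by
  have hSw : S ∈ w.asIdeal := by
    refine w.isPrime.mem_of_pow_mem 2 ?_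
    rw [hS, intCast_mem_iff v w]
    exact h
  obtain ⟨m, hm⟩ := h
  have hp := Nat.prime_iff_prime_int.mp (prime_natGenerator v)
  have hcop : IsCoprime (natGenerator v : ℤ) m := by
    refine hp.irreducible.coprime_iff_not_dvd.mpr fun ⟨k, hk⟩ => hp.not_isUnit (hn _ ⟨k, ?_⟩)
    rw [hm, hk, mul_assoc]
  obtain ⟨x, y, hxy⟩ := hcop
  have : (natGenerator v : 𝓞 K) = x * (natGenerator v : 𝓞 K) ^ 2 + y * S ^ 2 := by
    rw [hS, hm]
    have := congrArg (Int.cast : ℤ → 𝓞 K) hxy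
    push_cast at this ⊢
    linear_combination -(natGenerator v : 𝓞 K) * this
  rw [this]
  exact add_mem (Ideal.mul_mem_left _ _ (Ideal.pow_mem_pow (natGenerator_mem v w) 2))
    (Ideal.mul_mem_left _ _ (Ideal.pow_mem_pow hSw 2))

lemma natGenerator_mem_sq_of_three_mod_four [w.asIdeal.LiesOver v.asIdeal] (h2 : natGenerator v = 2)
    {j : ℤ} {S : 𝓞 K} (hS : S ^ 2 = (3 + 4 * j : ℤ)) :
    (natGenerator v : 𝓞 K) ∈ w.asIdeal ^ 2 := by
  have h2w := natGenerator_mem v w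
  rw [h2] at h2w ⊢
  push_cast at h2w hS ⊢
  have h1 : 1 + S ∈ w.asIdeal := by
    refine w.isPrime.mem_of_pow_mem 2 ?_
    rw [show (1 + S) ^ 2 = 2 * (S + 2 + 2 * j) by linear_combination hS]
    exact Ideal.mul_mem_right _ _ h2w
  have : (2 : 𝓞 K) = 2 ^ 2 * (2 + 2 * j + (1 + j) * S) - (1 + S) ^ 2 * S := by
    linear_combination (2 + S) * hS
  rw [this]
  exact sub_mem (Ideal.mul_mem_right _ _ (Ideal.pow_mem_pow h2w 2))
    (Ideal.mul_mem_right _ _ (Ideal.pow_mem_pow h1 2))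

lemma isInertIn_of_five_mod_eight (hK : Module.finrank ℚ K = 2) (h2 : natGenerator v = 2) {N : ℤ}
    (hN : Odd N) {Θ : 𝓞 K} (hΘ : Θ ^ 2 = Θ + N) : IsInertIn K v := by
  refine isInertIn_of_absNorm_ne v (placeAbove K v) hK fun h => Int.not_even_iff_odd.mpr hN ?_
  have hmem := pow_absNorm_sub_mem (placeAbove K v) Θ
  rwa [h, h2, hΘ, add_sub_cancel_left, intCast_mem_iff v, h2, Nat.cast_ofNat,
    ← even_iff_two_dvd] at hmem

lemma not_isInertIn_of_one_mod_eight (hK : Module.finrank ℚ K = 2) (h2 : natGenerator v = 2) {N : ℤ}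
    (hN : Even N) {Θ : 𝓞 K} (hΘ : Θ ^ 2 = Θ + N) (hΘQ : (Θ : K) ∉ (algebraMap ℚ K).range) :
    ¬ IsInertIn K v := by
  intro h
  rw [IsInertIn, map_asIdeal_eq_span, h2, Nat.cast_ofNat,
    Ideal.span_singleton_prime two_ne_zero] at h
  have htr : Algebra.trace ℤ (𝓞 K) Θ = 1 :=
    trace_eq_of_sq_eq hK (N := -N) (by push_cast; linear_combination hΘ) hΘQ
  have hdvd : 2 ∣ Θ * (Θ - 1) := by
    rw [show Θ * (Θ - 1) = N by linear_combination hΘ]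
    exact_mod_cast Int.cast_dvd_cast 2 N hN.two_dvd
  rcases h.dvd_or_dvd hdvd with h | h
  · exact not_two_dvd_of_odd_trace (htr ▸ odd_one) h
  · refine not_two_dvd_of_odd_trace ?_ h
    rw [map_sub, htr, ← map_one (algebraMap ℤ (𝓞 K)), Algebra.trace_algebraMap,
      RingOfIntegers.rank, hK]
    decide

end QuadraticField

/-! ### Local terms of the index -/

section LocalTerm

lemma baseChange_curveE₁ {L : Type*} [Field L] {_ : Algebra ℚ L} :
    curveE₁.baseChange L = congruentCurve 1 := by
  ext <;> simp [curveE₁, congruentCurve, WeierstrassCurve.baseChange, WeierstrassCurve.map]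

lemma quadraticTwist_curveE₁ (D : ℚ) : curveE₁.quadraticTwist D = congruentCurve D := by
  ext <;> simp [curveE₁, congruentCurve, quadraticTwist, WeierstrassCurve.b₂, WeierstrassCurve.b₄,
    WeierstrassCurve.b₆]
  ring

lemma baseChange_congruentCurve_intCast {L : Type*} [Field L] {_ : Algebra ℚ L} (n : ℤ) :
    (congruentCurve (n : ℚ)).baseChange L = congruentCurve (n : L) := by
  ext <;> simp [congruentCurve, WeierstrassCurve.baseChange, WeierstrassCurve.map]

section TamagawaFactor

variable {K : Type*} [Field K] [NumberField K] (v : HeightOneSpectrum (𝓞 K))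

/-- The Tamagawa factor of `y² = x³ - a²x` over the completion at `v`. -/
noncomputable abbrev localTamagawaFactor (a : v.adicCompletion K) : ℕ :=
  (congruentCurve a).tamagawaFactor (v.adicCompletionIntegers K)

lemma norm_minimalDiscriminant_congruentCurve (a : v.adicCompletion K)
    [(congruentCurve a).IsMinimal (v.adicCompletionIntegers K)] :
    ‖(congruentCurve a).minimalDiscriminant (v.adicCompletionIntegers K)‖ =
      (‖(2 : v.adicCompletion K)‖ * ‖a‖) ^ 6 := by
  have h := (valuation_minimalDiscriminant (R := v.adicCompletionIntegers K)
    (congruentCurve a)).trans (valuation_congruentCurve_Δ a)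
  rw [valuation_maximalIdeal_eq_valued, ← map_mul, ← map_pow] at h
  rw [(norm_eq_norm_iff v).mpr h, norm_pow, norm_mul]

end TamagawaFactor

variable {K : Type*} [Field K] [NumberField K] (v : HeightOneSpectrum (𝓞 ℚ))
  (w : HeightOneSpectrum (𝓞 K)) [w.asIdeal.LiesOver v.asIdeal]
  [(congruentCurve (1 : v.adicCompletion ℚ)).IsMinimal (v.adicCompletionIntegers ℚ)]
  [(congruentCurve (1 : w.adicCompletion K)).IsMinimal (w.adicCompletionIntegers K)]
  {n : ℤ} [(congruentCurve (n : v.adicCompletion ℚ)).IsMinimal (v.adicCompletionIntegers ℚ)]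
  (h2 : ‖(2 : w.adicCompletion K)‖ = ‖(2 : v.adicCompletion ℚ)‖ ^ 2)
include h2

lemma localTerm_curveE₁_eq : localTerm v w curveE₁ n = Real.logb 2
    (localTamagawaFactor v 1 * localTamagawaFactor v n / localTamagawaFactor w 1 *
      √(‖(n : v.adicCompletion ℚ)‖ / ‖localDiscriminant v w‖)) := by
  have norm_two_ne_zero : ‖(2 : v.adicCompletion ℚ)‖ ≠ 0 := norm_ne_zero_iff.mpr two_ne_zero
  rw [localTerm, quadraticTwist_curveE₁, baseChange_congruentCurve_intCast, baseChange_curveE₁,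
    baseChange_curveE₁, norm_mul, norm_mul, norm_minimalDiscriminant_congruentCurve,
    norm_minimalDiscriminant_congruentCurve, norm_minimalDiscriminant_congruentCurve, norm_zpow,
    norm_one, norm_one, h2]
  generalize ‖(2 : v.adicCompletion ℚ)‖ = A at *
  generalize hB : ‖(n : v.adicCompletion ℚ)‖ = B
  generalize hC : ‖localDiscriminant v w‖ = C
  have hBC : 0 ≤ B / C := div_nonneg (hB ▸ norm_nonneg _) (hC ▸ norm_nonneg _)
  have discriminants :
      (A * 1) ^ 6 * (A * B) ^ 6 * C ^ (-6 : ℤ) / (A ^ 2 * 1) ^ 6 = (B / C) ^ 6 := by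
    rw [show C ^ (-6 : ℤ) = (C ^ 6)⁻¹ from zpow_neg_coe_of_pos C (by norm_num)]
    field_simp
  rw [discriminants, ← Real.rpow_natCast, ← Real.rpow_mul hBC, Real.sqrt_eq_rpow]
  norm_num

lemma localTerm_curveE₁_of_ramified (hn : n ≠ 0)
    (hd : Valued.v (localDiscriminant v w) = Valued.v (4 * n : v.adicCompletion ℚ)) :
    localTerm v w curveE₁ n = Real.logb 2 (localTamagawaFactor v 1 * localTamagawaFactor v n /
      localTamagawaFactor w 1 / ‖(2 : v.adicCompletion ℚ)‖) := by
  have hn' : ‖(n : v.adicCompletion ℚ)‖ ≠ 0 := norm_ne_zero_iff.mpr (by exact_mod_cast hn)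
  rw [localTerm_curveE₁_eq v w h2, (norm_eq_norm_iff v).mpr hd,
    show (4 : v.adicCompletion ℚ) * n = 2 ^ 2 * n by norm_num, norm_mul, norm_pow,
    div_mul_cancel_right₀ hn', Real.sqrt_inv, Real.sqrt_sq (norm_nonneg _), div_eq_mul_inv _ ‖_‖]

end LocalTerm

section LocalDiscriminantOfGenerator

variable {F K : Type*} [Field F] [NumberField F] [Field K] [NumberField K] [Algebra F K]
  {v : HeightOneSpectrum (𝓞 F)} {w : HeightOneSpectrum (𝓞 K)} [w.asIdeal.LiesOver v.asIdeal]

lemma valued_intCast_le_one (v : HeightOneSpectrum (𝓞 F)) (j : ℤ) :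
    Valued.v (j : v.adicCompletion F) ≤ 1 :=
  valued_intCast v j ▸ valuation_intCast_le_one v j

section Ramified

variable (he : ∀ x, Valued.v (completionMap v w x) = Valued.v x ^ 2) {n : ℤ}
  {s : w.adicCompletion K} (hs : s ^ 2 = n)
  (hspan : ∀ z, ∃ a b, z = completionMap v w a + completionMap v w b * s)
include he hs hspan

lemma valued_localDiscriminant_of_sqrt (hs1 : Valued.v s = exp (-1)) :
    Valued.v (localDiscriminant v w) = Valued.v (4 * n : v.adicCompletion F) := by
  rw [valued_localDiscriminant v w (t := 0) (N := ((-n : ℤ) : v.adicCompletion F)) (by simp)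
    (valued_intCast_le_one v _) (by rw [hs]; simp) hspan (valued_le_one_of_ramified v w he hs1)]
  congr 1
  push_cast
  ring

lemma valued_localDiscriminant_of_one_add_sqrt (hs1 : Valued.v (1 + s) = exp (-1)) :
    Valued.v (localDiscriminant v w) = Valued.v (4 * n : v.adicCompletion F) := by
  rw [valued_localDiscriminant v w (t := ((2 : ℤ) : v.adicCompletion F))
    (N := ((1 - n : ℤ) : v.adicCompletion F)) (θ := 1 + s) (valued_intCast_le_one v _)
    (valued_intCast_le_one v _) ?_ (fun z => ?_) (valued_le_one_of_ramified v w he hs1)]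
  · congr 1
    push_cast
    ring
  · rw [map_intCast, map_intCast]
    push_cast
    linear_combination hs
  · obtain ⟨a, b, rfl⟩ := hspan z
    exact ⟨a - b, b, by rw [map_sub]; ring⟩

end Ramified

lemma valuation_eq_one_of_mul_sub_one {L Γ₀ : Type*} [Field L]
    [LinearOrderedCommGroupWithZero Γ₀] (V : Valuation L Γ₀) {θ : L} (h : V (θ * (θ - 1)) = 1) :
    V θ = 1 ∧ V (θ - 1) = 1 := by
  rw [map_mul] at h
  have hle : V θ ≤ 1 := by
    by_contra! hlt
    rw [Valuation.map_sub_eq_of_lt_left _ (by rwa [map_one]), ← sq] at h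
    exact hlt.ne' ((pow_eq_one_iff_of_nonneg zero_le two_ne_zero).mp h)
  have hle' : V (θ - 1) ≤ 1 := (V.map_sub _ _).trans (max_le hle V.map_one.le)
  have hθ : V θ = 1 := hle.antisymm (h ▸ mul_le_of_le_one_right' hle')
  exact ⟨hθ, by rwa [hθ, one_mul] at h⟩

section Unramified

variable (hv : Ideal.absNorm v.asIdeal = 2)
  (he : ∀ x, Valued.v (completionMap v w x) = Valued.v x) {θ : w.adicCompletion K}
include hv he

lemma valued_completionMap_add_eq_one (hθ : Valued.v (θ * (θ - 1)) = 1) {u : v.adicCompletion F}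
    (hu : Valued.v u ≤ 1) : Valued.v (completionMap v w u + θ) = 1 := by
  obtain ⟨hθ0, hθ1⟩ := valuation_eq_one_of_mul_sub_one _ hθ
  rcases valued_lt_one_or_of_absNorm_eq_two v hv (z := -u) (by rwa [Valuation.map_neg]) with h | h
  · rw [show completionMap v w u + θ = θ - completionMap v w (-u) by rw [map_neg]; ring,
      Valuation.map_sub_eq_of_lt_left _ (by rwa [he, hθ0]), hθ0]
  · rw [show completionMap v w u + θ = (θ - 1) - completionMap v w (-u - 1) by
      rw [map_sub, map_neg, map_one]; ring,
      Valuation.map_sub_eq_of_lt_left _ (by rwa [he, hθ1]), hθ1]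

lemma valued_localDiscriminant_of_sq_eq_add {N : ℤ} (hN : Valued.v (N : v.adicCompletion F) = 1)
    (hθ : θ ^ 2 = θ + N)
    (hspan : ∀ z, ∃ a b, z = completionMap v w a + completionMap v w b * θ) :
    Valued.v (localDiscriminant v w) = Valued.v ((1 + 4 * N : ℤ) : v.adicCompletion F) := by
  have valued_mul : Valued.v (θ * (θ - 1)) = 1 := by
    rw [show θ * (θ - 1) = completionMap v w N by rw [map_intCast]; linear_combination hθ, he, hN]
  rw [valued_localDiscriminant v w (t := 1) (N := ((-N : ℤ) : v.adicCompletion F)) (by simp)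
    (valued_intCast_le_one v _) (by rw [hθ]; simp) hspan
    (valued_le_one_of_unramified v w he fun u => valued_completionMap_add_eq_one hv he valued_mul)]
  congr 1
  push_cast
  ring

end Unramified

end LocalDiscriminantOfGenerator

section RationalValues

variable (v : HeightOneSpectrum (𝓞 ℚ))

lemma valued_intCast_of_not_dvd {n : ℤ} (h : ¬ (natGenerator v : ℤ) ∣ n) :
    Valued.v (n : v.adicCompletion ℚ) = 1 := by
  rw [valued_intCast, valuation_intCast_eq_one v h]

lemma valued_intCast_of_dvd {n : ℤ} (hn : Squarefree n) (h : (natGenerator v : ℤ) ∣ n) :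
    Valued.v (n : v.adicCompletion ℚ) = exp (-1) := by
  obtain ⟨m, rfl⟩ := h
  have hp := Nat.prime_iff_prime_int.mp (prime_natGenerator v)
  have hm : ¬ (natGenerator v : ℤ) ∣ m := fun ⟨k, hk⟩ =>
    hp.not_isUnit (hn _ ⟨k, by rw [hk, mul_assoc]⟩)
  rw [valued_intCast, Int.cast_mul, map_mul, valuation_intCast_eq_one v hm, mul_one,
    Int.cast_natCast, valuation_natGenerator]

lemma valued_intCast_of_odd (h2 : natGenerator v = 2) {n : ℤ} (hn : Odd n) :
    Valued.v (n : v.adicCompletion ℚ) = 1 :=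
  valued_intCast_of_not_dvd v fun h => Int.not_even_iff_odd.mpr hn
    (even_iff_two_dvd.mpr (by simpa only [h2, Nat.cast_ofNat] using h))

lemma valued_two_of_ne_two (h2 : natGenerator v ≠ 2) : Valued.v (2 : v.adicCompletion ℚ) = 1 := by
  refine mod_cast valued_intCast_of_not_dvd v (n := 2) fun h => h2 ?_
  exact (Nat.prime_dvd_prime_iff_eq (prime_natGenerator v) Nat.prime_two).mp (mod_cast h)

lemma valued_two (h2 : natGenerator v = 2) : Valued.v (2 : v.adicCompletion ℚ) = exp (-1) :=
  mod_cast valued_intCast_of_dvd v (n := 2) Int.prime_two.squarefree (by simp [h2])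

lemma norm_two (h2 : natGenerator v = 2) : ‖(2 : v.adicCompletion ℚ)‖ = 2⁻¹ := by
  rw [norm_eq_of_valued_eq v (valued_two v h2), absNorm_asIdeal, h2, zpow_neg_one, Nat.cast_ofNat]

end RationalValues

section QuadraticCompletion

variable {K : Type*} [Field K] [NumberField K] (hK : Module.finrank ℚ K = 2)
  (v : HeightOneSpectrum (𝓞 ℚ)) (w : HeightOneSpectrum (𝓞 K)) [w.asIdeal.LiesOver v.asIdeal]

include hK in
lemma exists_eq_completionMap_add_mul_of_notMem {x : K} (hx : x ∉ (algebraMap ℚ K).range)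
    (z : w.adicCompletion K) :
    ∃ a b, z = completionMap v w a + completionMap v w b * algebraMap K (w.adicCompletion K) x :=
  exists_eq_completionMap_add_mul v w (exists_eq_add_mul hK hx) z

section Ramified

variable (h : (natGenerator v : 𝓞 K) ∈ w.asIdeal ^ 2)
include hK h

lemma valued_completionMap_of_mem_sq (x : v.adicCompletion ℚ) :
    Valued.v (completionMap v w x) = Valued.v x ^ 2 :=
  valued_completionMap_eq_pow v w (valuation_natGenerator v)
    (valuation_natGenerator_of_sq_mem v w hK h) x

lemma norm_completionMap_of_mem_sq (x : v.adicCompletion ℚ) :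
    ‖completionMap v w x‖ = ‖x‖ ^ 2 :=
  norm_completionMap v w (valued_completionMap_of_mem_sq hK v w h) (f := 1)
    (by rw [pow_one, absNorm_of_sq_mem v w hK h, absNorm_asIdeal]) two_ne_zero one_ne_zero x

lemma valued_two_of_mem_sq (h2 : natGenerator v = 2) :
    Valued.v (2 : w.adicCompletion K) = exp (-2) := by
  rw [← map_ofNat (completionMap v w), valued_completionMap_of_mem_sq hK v w h, valued_two v h2,
    ← exp_nsmul]
  rfl

lemma valuation_two_of_mem_sq (h2 : natGenerator v = 2) :
    (IsDiscreteValuationRing.maximalIdeal (w.adicCompletionIntegers K)).valuation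
      (w.adicCompletion K) (2 : w.adicCompletion K) = exp (-2) :=
  valuation_maximalIdeal_eq_valued w ▸ valued_two_of_mem_sq hK v w h h2

omit [w.asIdeal.LiesOver v.asIdeal] in
lemma valuation_lt_one_or_of_mem_sq (h2 : natGenerator v = 2) (z : w.adicCompletion K)
    (hz : (IsDiscreteValuationRing.maximalIdeal (w.adicCompletionIntegers K)).valuation
      (w.adicCompletion K) z ≤ 1) :
    (IsDiscreteValuationRing.maximalIdeal (w.adicCompletionIntegers K)).valuation
        (w.adicCompletion K) z < 1 ∨
      (IsDiscreteValuationRing.maximalIdeal (w.adicCompletionIntegers K)).valuation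
        (w.adicCompletion K) (z - 1) < 1 := by
  rw [valuation_maximalIdeal_eq_valued] at hz ⊢
  exact valued_lt_one_or_of_absNorm_eq_two w ((absNorm_of_sq_mem v w hK h).trans h2) hz

end Ramified

section Inert

variable (h : IsInertIn K v)
include h

lemma valued_completionMap_of_isInertIn (x : v.adicCompletion ℚ) :
    Valued.v (completionMap v w x) = Valued.v x := by
  rw [valued_completionMap_eq_pow v w (valuation_natGenerator v)
    (valuation_natGenerator_of_isInertIn v w h) x, pow_one]

include hK in
lemma norm_completionMap_of_isInertIn (x : v.adicCompletion ℚ) :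
    ‖completionMap v w x‖ = ‖x‖ ^ 2 :=
  norm_completionMap v w (e := 1)
    (by simpa only [pow_one] using valued_completionMap_of_isInertIn v w h)
    (by rw [absNorm_of_isInertIn v w hK h, absNorm_asIdeal]) one_ne_zero two_ne_zero x

end Inert

end QuadraticCompletion

section Terms

variable {K : Type*} [Field K] [NumberField K] (hK : Module.finrank ℚ K = 2)
  (v : HeightOneSpectrum (𝓞 ℚ)) (w : HeightOneSpectrum (𝓞 K)) [w.asIdeal.LiesOver v.asIdeal]

include hK in
theorem localTerm_of_five_mod_eight (h2 : natGenerator v = 2) (hin : IsInertIn K v) {N : ℤ}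
    (hN : Odd N) {Θ : 𝓞 K} (hΘ : Θ ^ 2 = Θ + N) (hΘQ : (Θ : K) ∉ (algebraMap ℚ K).range) :
    localTerm v w curveE₁ (1 + 4 * N : ℤ) = 1 := by
  have hV2 := valued_two v h2
  have hVn := valued_intCast_of_odd v h2 (n := 1 + 4 * N) ⟨2 * N, by ring⟩
  have he := valued_completionMap_of_isInertIn v w hin
  have hV2w : Valued.v (2 : w.adicCompletion K) = exp (-1) := by
    rw [← map_ofNat (completionMap v w), he, hV2]
  have hd := valued_localDiscriminant_of_sq_eq_add ((absNorm_asIdeal v).trans h2) he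
    (valued_intCast_of_odd v h2 hN) (θ := algebraMap K _ (Θ : K))
    (by rw [← map_pow, ← map_pow, hΘ]; simp) (exists_eq_completionMap_add_mul_of_notMem hK v w hΘQ)
  have hnorm := norm_completionMap_of_isInertIn hK v w hin 2
  rw [map_ofNat] at hnorm
  rw [← valuation_maximalIdeal_eq_valued] at hV2 hVn hV2w
  have := isMinimal_congruentCurve_of_unit hV2 (map_one _)
  have := isMinimal_congruentCurve_of_unit hV2 hVn
  have := isMinimal_congruentCurve_of_unit hV2w (map_one _)
  have hc : localTamagawaFactor v 1 = 2 := tamagawaFactor_congruentCurve_of_unit hV2 (map_one _)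
  have hcn : localTamagawaFactor v (1 + 4 * N : ℤ) = 2 :=
    tamagawaFactor_congruentCurve_of_unit hV2 hVn
  have hcw : localTamagawaFactor w 1 = 2 := tamagawaFactor_congruentCurve_of_unit hV2w (map_one _)
  rw [localTerm_curveE₁_eq v w hnorm, hc, hcn, hcw, (norm_eq_norm_iff v).mpr hd, div_self]
  · norm_num
  · exact norm_ne_zero_iff.mpr fun h0 => by simp [h0] at hVn

variable {n : ℤ} {S : 𝓞 K} (hS : S ^ 2 = n)

include hS in
lemma sqrt_completion_sq : algebraMap K (w.adicCompletion K) (S : K) ^ 2 = n := by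
  rw [← map_pow, ← map_pow, hS, map_intCast, map_intCast]

lemma exists_sq_eq_of_valuation_lt_one (c : w.adicCompletion K)
    (hc : (IsDiscreteValuationRing.maximalIdeal (w.adicCompletionIntegers K)).valuation
      (w.adicCompletion K) c < 1) : ∃ q, q ^ 2 = 1 + 4 * c :=
  exists_sq_eq_one_add_four_mul w (valuation_maximalIdeal_eq_valued w ▸ hc)

variable (hn : Squarefree n) (hSQ : (S : K) ∉ (algebraMap ℚ K).range)
include hK hS hn hSQ

theorem localTerm_of_odd_dvd (h2 : natGenerator v ≠ 2) (h : (natGenerator v : ℤ) ∣ n) :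
    localTerm v w curveE₁ n = 2 := by
  have hram := natGenerator_mem_sq_of_dvd v w hn hS h
  have he := valued_completionMap_of_mem_sq hK v w hram
  have hV2 := valued_two_of_ne_two v h2
  have hVn := valued_intCast_of_dvd v hn h
  have hs := sqrt_completion_sq w hS
  have hV2w : Valued.v (2 : w.adicCompletion K) = 1 := by
    rw [← map_ofNat (completionMap v w), he, hV2, one_pow]
  have hs1 : Valued.v (algebraMap K (w.adicCompletion K) (S : K)) = exp (-1) := by
    have := congrArg Valued.v hs
    rw [← map_intCast (completionMap v w), he, hVn, map_pow] at this
    exact (pow_left_inj₀ zero_le zero_le two_ne_zero).mp this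
  have hd := valued_localDiscriminant_of_sqrt he hs
    (exists_eq_completionMap_add_mul_of_notMem hK v w hSQ) hs1
  have hnorm := norm_completionMap_of_mem_sq hK v w hram 2
  rw [map_ofNat] at hnorm
  have hnorm2 : ‖(2 : v.adicCompletion ℚ)‖ = 1 := by
    rw [← norm_one (α := v.adicCompletion ℚ), norm_eq_norm_iff, hV2, map_one]
  rw [← valuation_maximalIdeal_eq_valued] at hV2 hVn hV2w
  have := isMinimal_congruentCurve_of_good hV2 (map_one _)
  have := isMinimal_congruentCurve_of_odd hV2 hVn
  have := isMinimal_congruentCurve_of_good hV2w (map_one _)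
  have hc : localTamagawaFactor v 1 = 1 := tamagawaFactor_congruentCurve_of_good hV2 (map_one _)
  have hcn : localTamagawaFactor v n = 4 := tamagawaFactor_congruentCurve_of_odd hV2 hVn
  have hcw : localTamagawaFactor w 1 = 1 := tamagawaFactor_congruentCurve_of_good hV2w (map_one _)
  rw [localTerm_curveE₁_of_ramified v w hnorm hn.ne_zero hd, hnorm2, hc, hcn, hcw,
    show ((1 : ℕ) * (4 : ℕ) / (1 : ℕ) / 1 : ℝ) = 2 ^ (2 : ℝ) by norm_num,
    Real.logb_rpow two_pos (by norm_num)]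

variable (h2 : natGenerator v = 2)
include h2

lemma localTerm_of_three_mod_four {j : ℤ} (hj : n = 3 + 4 * j) :
    localTerm v w curveE₁ n = Real.logb 2 (8 / localTamagawaFactor w 1) := by
  have hram := natGenerator_mem_sq_of_three_mod_four v w h2 (hj ▸ hS)
  have hV2 := valued_two v h2
  have hVn := valued_intCast_of_odd v h2 (n := n) ⟨1 + 2 * j, by rw [hj]; ring⟩
  have hV2w := valued_two_of_mem_sq hK v w hram h2
  have hs := sqrt_completion_sq w hS
  have hnorm := norm_completionMap_of_mem_sq hK v w hram 2
  rw [map_ofNat] at hnorm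
  rw [← valuation_maximalIdeal_eq_valued] at hV2 hVn hV2w
  have hd := valued_localDiscriminant_of_one_add_sqrt (valued_completionMap_of_mem_sq hK v w hram)
    hs (exists_eq_completionMap_add_mul_of_notMem hK v w hSQ)
    (valuation_maximalIdeal_eq_valued w ▸ valuation_one_add_sqrt hV2w (hj ▸ hs))
  have := isMinimal_congruentCurve_of_unit hV2 (map_one _)
  have := isMinimal_congruentCurve_of_unit hV2 hVn
  have := isMinimal_congruentCurve_one_of_three_mod_four hV2w (hj ▸ hs)
  have hc : localTamagawaFactor v 1 = 2 := tamagawaFactor_congruentCurve_of_unit hV2 (map_one _)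
  have hcn : localTamagawaFactor v n = 2 := tamagawaFactor_congruentCurve_of_unit hV2 hVn
  rw [localTerm_curveE₁_of_ramified v w hnorm hn.ne_zero hd, norm_two v h2, hc, hcn]
  congr 1
  push_cast
  ring

lemma localTerm_of_two_mod_four {j : ℤ} (hj : n = 2 * (1 + 2 * j)) :
    localTerm v w curveE₁ n = Real.logb 2 (16 / localTamagawaFactor w 1) := by
  have hdvd : (natGenerator v : ℤ) ∣ n := ⟨1 + 2 * j, by rw [h2, hj]; rfl⟩
  have hram := natGenerator_mem_sq_of_dvd v w hn hS hdvd
  have hV2 := valued_two v h2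
  have hVn := valued_intCast_of_dvd v hn hdvd
  have hV2w := valued_two_of_mem_sq hK v w hram h2
  have hs := sqrt_completion_sq w hS
  have hnorm := norm_completionMap_of_mem_sq hK v w hram 2
  rw [map_ofNat] at hnorm
  rw [← valuation_maximalIdeal_eq_valued] at hV2 hVn hV2w
  have hd := valued_localDiscriminant_of_sqrt (valued_completionMap_of_mem_sq hK v w hram)
    hs (exists_eq_completionMap_add_mul_of_notMem hK v w hSQ)
    (valuation_maximalIdeal_eq_valued w ▸ valuation_sqrt_of_two_mul hV2w (hj ▸ hs))
  have := isMinimal_congruentCurve_of_unit hV2 (map_one _)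
  have := isMinimal_congruentCurve_of_two_mul hV2 hVn
  have := isMinimal_congruentCurve_one_of_two_mod_four hV2w (hj ▸ hs)
  have hc : localTamagawaFactor v 1 = 2 := tamagawaFactor_congruentCurve_of_unit hV2 (map_one _)
  have hcn : localTamagawaFactor v n = 4 := tamagawaFactor_congruentCurve_of_two_mul hV2 hVn
  rw [localTerm_curveE₁_of_ramified v w hnorm hn.ne_zero hd, norm_two v h2, hc, hcn]
  congr 1
  push_cast
  ring

theorem localTerm_of_seven_mod_eight {j : ℤ} (hj : n = 7 + 8 * j) :
    localTerm v w curveE₁ n = 1 := by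
  have hj' : n = 3 + 4 * (1 + 2 * j) := by rw [hj]; ring
  have hram := natGenerator_mem_sq_of_three_mod_four v w h2 (hj' ▸ hS)
  have hcw : localTamagawaFactor w 1 = 4 := tamagawaFactor_congruentCurve_one_of_seven_mod_eight
    (valuation_two_of_mem_sq hK v w hram h2) (exists_sq_eq_of_valuation_lt_one w)
    (hj ▸ sqrt_completion_sq w hS)
  rw [localTerm_of_three_mod_four hK v w hS hn hSQ h2 hj', hcw]
  norm_num

theorem localTerm_of_three_mod_eight {j : ℤ} (hj : n = 3 + 8 * j) :
    localTerm v w curveE₁ n = 2 := by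
  have hj' : n = 3 + 4 * (2 * j) := by rw [hj]; ring
  have hram := natGenerator_mem_sq_of_three_mod_four v w h2 (hj' ▸ hS)
  have hcw : localTamagawaFactor w 1 = 2 := tamagawaFactor_congruentCurve_one_of_three_mod_eight
    (valuation_two_of_mem_sq hK v w hram h2) (valuation_lt_one_or_of_mem_sq hK v w hram h2)
    (hj ▸ sqrt_completion_sq w hS)
  rw [localTerm_of_three_mod_four hK v w hS hn hSQ h2 hj', hcw,
    show (8 / (2 : ℕ) : ℝ) = 2 ^ (2 : ℝ) by norm_num, Real.logb_rpow two_pos (by norm_num)]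

theorem localTerm_of_two_mod_eight {j : ℤ} (hj : n = 2 + 8 * j) :
    localTerm v w curveE₁ n = 2 := by
  have hj' : n = 2 * (1 + 2 * (2 * j)) := by rw [hj]; ring
  have hram := natGenerator_mem_sq_of_dvd v w hn hS ⟨1 + 2 * (2 * j), by rw [h2, hj']; rfl⟩
  have hcw : localTamagawaFactor w 1 = 4 := tamagawaFactor_congruentCurve_one_of_two_mod_eight
    (valuation_two_of_mem_sq hK v w hram h2) (exists_sq_eq_of_valuation_lt_one w)
    (hj ▸ sqrt_completion_sq w hS)
  rw [localTerm_of_two_mod_four hK v w hS hn hSQ h2 hj', hcw,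
    show (16 / (4 : ℕ) : ℝ) = 2 ^ (2 : ℝ) by norm_num, Real.logb_rpow two_pos (by norm_num)]

theorem localTerm_of_six_mod_eight {j : ℤ} (hj : n = 6 + 8 * j) :
    localTerm v w curveE₁ n = 3 := by
  have hj' : n = 2 * (1 + 2 * (1 + 2 * j)) := by rw [hj]; ring
  have hram := natGenerator_mem_sq_of_dvd v w hn hS ⟨1 + 2 * (1 + 2 * j), by rw [h2, hj']; rfl⟩
  have hcw : localTamagawaFactor w 1 = 2 := tamagawaFactor_congruentCurve_one_of_six_mod_eight
    (valuation_two_of_mem_sq hK v w hram h2) (valuation_lt_one_or_of_mem_sq hK v w hram h2)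
    (hj ▸ sqrt_completion_sq w hS)
  rw [localTerm_of_two_mod_four hK v w hS hn hSQ h2 hj', hcw,
    show (16 / (2 : ℕ) : ℝ) = 2 ^ (3 : ℝ) by norm_num, Real.logb_rpow two_pos (by norm_num)]

end Terms

/-! ### Summing the local terms -/

lemma isBadAt_curveE₁_iff (v : HeightOneSpectrum (𝓞 ℚ)) :
    IsBadAt curveE₁ v ↔ natGenerator v = 2 := by
  have isBadAt_iff [(congruentCurve (1 : v.adicCompletion ℚ)).IsMinimal
      (v.adicCompletionIntegers ℚ)] :
      IsBadAt curveE₁ v ↔ Valued.v (2 : v.adicCompletion ℚ) ^ 6 ≠ 1 := by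
    have hΔ := (valuation_minimalDiscriminant (R := v.adicCompletionIntegers ℚ)
      (congruentCurve (1 : v.adicCompletion ℚ))).trans (valuation_congruentCurve_Δ _)
    rw [map_one, mul_one, valuation_maximalIdeal_eq_valued] at hΔ
    rw [IsBadAt, baseChange_curveE₁, not_iff_not, ← hΔ, ← valuation_maximalIdeal_eq_valued]
    exact ⟨fun h => h.goodReduction, fun h => ⟨h⟩⟩
  by_cases h2 : natGenerator v = 2
  · have hV2 := valued_two v h2
    have := isMinimal_congruentCurve_of_unit
      ((valuation_maximalIdeal_eq_valued v).symm ▸ hV2) (map_one _)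
    rw [isBadAt_iff, hV2]
    exact iff_of_true (pow_lt_one₀ zero_le (exp_lt_one (by norm_num)) (by norm_num)).ne h2
  · have hV2 := valued_two_of_ne_two v h2
    have := isMinimal_congruentCurve_of_good
      ((valuation_maximalIdeal_eq_valued v).symm ▸ hV2) (map_one _)
    rw [isBadAt_iff, hV2, one_pow]
    exact iff_of_false (· rfl) h2

section FiniteIndex

variable {K : Type*} [Field K] [NumberField K]

lemma deltaFinite_eq_sum {E : WeierstrassCurve ℚ} {D : ℚ} {T : Finset ℕ} {g : ℕ → ℝ}
    (hT : ∀ p ∈ T, p.Prime) (hS : ∀ v, v ∈ placesS₀ E K ↔ natGenerator v ∈ T)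
    (hg : ∀ v, natGenerator v ∈ T → localTerm v (placeAbove K v) E D = g (natGenerator v)) :
    deltaFinite E D K = ∑ p ∈ T, g p := by
  rw [deltaFinite, ← finsum_mem_coe_finset]
  refine finsum_mem_eq_of_bijOn natGenerator ⟨fun v hv => (hS v).mp hv,
    natGenerator_injective.injOn, fun p hp => ?_⟩ fun v hv => hg v ((hS v).mp hv)
  obtain ⟨v, rfl⟩ := exists_natGenerator_eq (hT p hp)
  exact ⟨v, (hS v).mpr hp, rfl⟩

lemma exists_half_one_add_sqrt {n N : ℤ} (hN : n = 1 + 4 * N) {s : K} (hs : s ^ 2 = n)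
    (hsQ : s ∉ (algebraMap ℚ K).range) :
    ∃ Θ : 𝓞 K, Θ ^ 2 = Θ + N ∧ (Θ : K) ∉ (algebraMap ℚ K).range := by
  have hθ : ((1 + s) / 2) ^ 2 = (1 + s) / 2 + N := by
    rw [hN] at hs
    push_cast at hs
    field_simp
    linear_combination hs
  have hint : (1 + s) / 2 ∈ integralClosure ℤ K := by
    refine ⟨.X ^ 2 - .X - .C N, by monicity!, ?_⟩
    rw [Polynomial.eval₂_sub, Polynomial.eval₂_sub, Polynomial.eval₂_pow, Polynomial.eval₂_X,
      Polynomial.eval₂_C, hθ]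
    simp
  obtain ⟨Θ, hΘ⟩ : ∃ Θ : 𝓞 K, algebraMap (𝓞 K) K Θ = (1 + s) / 2 := ⟨⟨_, hint⟩, rfl⟩
  refine ⟨Θ, RingOfIntegers.coe_injective ?_, ?_⟩
  · rw [map_pow, map_add, map_intCast, hΘ, hθ]
  · rintro ⟨q, hq⟩
    refine hsQ ⟨2 * q - 1, ?_⟩
    rw [map_sub, map_mul, hq.trans hΘ, map_one, map_ofNat]
    ring

/-- The contribution of the prime `2` to `deltaFinite curveE₁ n (ℚ(√n))`, for squarefree `n`. It is
`0` for `n ≡ 1 [ZMOD 8]` because `2` then splits in `ℚ(√n)`. -/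
def dyadicIndex (n : ℤ) : ℕ :=
  if n % 8 = 1 then 0 else if n % 8 = 5 ∨ n % 8 = 7 then 1 else if n % 8 = 6 then 3 else 2

lemma emod_eight_of_squarefree {n : ℤ} (hn : Squarefree n) : n % 8 = 1 ∨ n % 8 = 2 ∨ n % 8 = 3 ∨
    n % 8 = 5 ∨ n % 8 = 6 ∨ n % 8 = 7 := by
  have : ¬ (4 : ℤ) ∣ n := fun h => Int.prime_two.not_isUnit (hn 2 h)
  omega

section SqrtInteger

variable (hK : Module.finrank ℚ K = 2) {n : ℤ} {S : 𝓞 K} (hS : S ^ 2 = n) (hn : Squarefree n)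

include hS hn in
lemma natGenerator_mem_sq_of_not_one_mod_four (h : n % 4 = 2 ∨ n % 4 = 3)
    {v : HeightOneSpectrum (𝓞 ℚ)}
    (h2 : natGenerator v = 2) (w : HeightOneSpectrum (𝓞 K)) [w.asIdeal.LiesOver v.asIdeal] :
    (natGenerator v : 𝓞 K) ∈ w.asIdeal ^ 2 := by
  rcases h with h | h
  · exact natGenerator_mem_sq_of_dvd v w hn hS (by rw [h2, Nat.cast_ofNat]; omega)
  · exact natGenerator_mem_sq_of_three_mod_four v w h2 (j := n / 4) (by rw [hS]; congr 1; omega)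

variable (hSQ : (S : K) ∉ (algebraMap ℚ K).range)
include hK hS hn hSQ

lemma isRamifiedIn_iff_of_ne_two {v : HeightOneSpectrum (𝓞 ℚ)} (h2 : natGenerator v ≠ 2) :
    IsRamifiedIn K v ↔ (natGenerator v : ℤ) ∣ n := by
  refine ⟨fun h => ?_, fun h => isRamifiedIn_of_mem_sq v _
    (natGenerator_mem_sq_of_dvd v (placeAbove K v) hn hS h)⟩
  by_contra hdvd
  refine not_isRamifiedIn hK (x := S) (t := 0) (N := -n) (by rw [hS]; simp) hSQ v
    (fun hdisc => ?_) h
  have hp := Nat.prime_iff_prime_int.mp (prime_natGenerator v)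
  have hdvd' : (natGenerator v : ℤ) ∣ 2 ^ 2 * n := by convert hdisc using 1; ring
  have hdvd2 := hp.dvd_of_dvd_pow ((hp.dvd_or_dvd hdvd').resolve_right hdvd)
  exact h2 ((Nat.prime_dvd_prime_iff_eq (prime_natGenerator v) Nat.prime_two).mp
    (mod_cast hdvd2))

lemma isRamifiedIn_or_isInertIn_iff {v : HeightOneSpectrum (𝓞 ℚ)} (h2 : natGenerator v = 2) :
    IsRamifiedIn K v ∨ IsInertIn K v ↔ n % 8 ≠ 1 := by
  have hs : (S : K) ^ 2 = n := by rw [← map_pow, hS, map_intCast]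
  by_cases h4 : n % 4 = 1
  · obtain ⟨N, hN⟩ : ∃ N, n = 1 + 4 * N := ⟨n / 4, by omega⟩
    obtain ⟨Θ, hΘ, hΘQ⟩ := exists_half_one_add_sqrt hN hs hSQ
    have hram : ¬ IsRamifiedIn K v := not_isRamifiedIn hK (x := Θ) (t := 1) (N := -N)
      (by rw [hΘ]; push_cast; ring) hΘQ v (by rw [h2, Nat.cast_ofNat]; omega)
    rcases Int.even_or_odd N with hN2 | hN2
    · exact iff_of_false (not_or.mpr ⟨hram, not_isInertIn_of_one_mod_eight v hK h2 hN2 hΘ hΘQ⟩)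
        (by grind)
    · exact iff_of_true (.inr (isInertIn_of_five_mod_eight v hK h2 hN2 hΘ)) (by grind)
  · have hmod := emod_eight_of_squarefree hn
    exact iff_of_true (.inl (isRamifiedIn_of_mem_sq v _
      (natGenerator_mem_sq_of_not_one_mod_four hS hn (by omega) h2 (placeAbove K v)))) (by omega)

lemma mem_placesS₀_iff {v : HeightOneSpectrum (𝓞 ℚ)} : v ∈ placesS₀ curveE₁ K ↔
    (natGenerator v ≠ 2 ∧ (natGenerator v : ℤ) ∣ n) ∨ (natGenerator v = 2 ∧ n % 8 ≠ 1) := by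
  simp only [placesS₀, placesS, Set.mem_ofPred_eq, isBadAt_curveE₁_iff]
  by_cases h2 : natGenerator v = 2
  · simp only [h2, or_true, true_and, ne_eq, not_true, false_and, false_or]
    exact isRamifiedIn_or_isInertIn_iff hK hS hn hSQ h2
  · have := isRamifiedIn_iff_of_ne_two hK hS hn hSQ h2
    tauto

theorem localTerm_of_two {v : HeightOneSpectrum (𝓞 ℚ)} (h2 : natGenerator v = 2)
    (w : HeightOneSpectrum (𝓞 K)) [w.asIdeal.LiesOver v.asIdeal] (h1 : n % 8 ≠ 1) :
    localTerm v w curveE₁ n = dyadicIndex n := by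
  have hdiv : n = n % 8 + 8 * (n / 8) := (Int.emod_add_mul_ediv n 8).symm
  rcases emod_eight_of_squarefree hn with h | h | h | h | h | h <;> rw [h] at hdiv
  · exact absurd h h1
  · simp [dyadicIndex, h, localTerm_of_two_mod_eight hK v w hS hn hSQ h2 hdiv]
  · simp [dyadicIndex, h, localTerm_of_three_mod_eight hK v w hS hn hSQ h2 hdiv]
  · obtain ⟨N, hN⟩ : ∃ N, n = 1 + 4 * N := ⟨n / 4, by omega⟩
    have hN2 : Odd N := by grind
    obtain ⟨Θ, hΘ, hΘQ⟩ := exists_half_one_add_sqrt hN (by rw [← map_pow, hS, map_intCast]) hSQ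
    have hterm := localTerm_of_five_mod_eight hK v w h2 (isInertIn_of_five_mod_eight v hK h2 hN2 hΘ)
      hN2 hΘ hΘQ
    simp [dyadicIndex, h, hN ▸ hterm]
  · simp [dyadicIndex, h, localTerm_of_six_mod_eight hK v w hS hn hSQ h2 hdiv]
  · simp [dyadicIndex, h, localTerm_of_seven_mod_eight hK v w hS hn hSQ h2 hdiv]

theorem deltaFinite_curveE₁ : deltaFinite curveE₁ n K = dyadicIndex n + 2 * oddPrimeCount n := by
  have mem_oddPrimes (v : HeightOneSpectrum (𝓞 ℚ)) :
      natGenerator v ∈ n.natAbs.primeFactors.erase 2 ↔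
        natGenerator v ≠ 2 ∧ (natGenerator v : ℤ) ∣ n := by
    simp [Nat.mem_primeFactors, Int.natCast_dvd, prime_natGenerator v, hn.ne_zero]
  let T₂ : Finset ℕ := if n % 8 = 1 then ∅ else {2}
  have mem_T₂ (p : ℕ) : p ∈ T₂ ↔ p = 2 ∧ n % 8 ≠ 1 := by
    by_cases h : n % 8 = 1 <;> simp [T₂, h]
  rw [deltaFinite_eq_sum (T := n.natAbs.primeFactors.erase 2 ∪ T₂)
    (g := fun p => if p = 2 then (dyadicIndex n : ℝ) else 2) (fun p hp => ?_) (fun v => ?_)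
    (fun v hv => ?_)]
  · rw [Finset.sum_union (Finset.disjoint_left.mpr fun p hp hp' =>
        Finset.ne_of_mem_erase hp ((mem_T₂ p).mp hp').1),
      Finset.sum_congr rfl fun p hp => if_neg (Finset.ne_of_mem_erase hp), add_comm]
    by_cases h : n % 8 = 1 <;> simp [T₂, h, dyadicIndex, oddPrimeCount, mul_comm]
  · rcases Finset.mem_union.mp hp with hp | hp
    · exact Nat.prime_of_mem_primeFactors (Finset.mem_of_mem_erase hp)
    · exact ((mem_T₂ p).mp hp).1 ▸ Nat.prime_two
  · rw [mem_placesS₀_iff hK hS hn hSQ, Finset.mem_union, mem_oddPrimes, mem_T₂]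
  · rw [Finset.mem_union, mem_oddPrimes, mem_T₂] at hv
    rcases hv with ⟨h2, hdvd⟩ | ⟨h2, h1⟩
    · rw [if_neg h2, localTerm_of_odd_dvd hK v _ hS hn hSQ h2 hdvd]
    · rw [if_pos h2, localTerm_of_two hK hS hn hSQ h2 _ h1]

end SqrtInteger

end FiniteIndex

section InfiniteIndex

variable {K : Type*} [Field K] [NumberField K] {n : ℤ} {s : K} (hs : s ^ 2 = n)

lemma curveE₁_Δ : curveE₁.Δ = 64 := by
  norm_num [curveE₁, WeierstrassCurve.Δ, WeierstrassCurve.b₂, WeierstrassCurve.b₄,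
    WeierstrassCurve.b₆, WeierstrassCurve.b₈]

lemma isReal_infinitePlace_rat (v : InfinitePlace ℚ) : v.IsReal :=
  Subsingleton.elim Rat.infinitePlace v ▸ Rat.isReal_infinitePlace

include hs

lemma not_isUnramifiedIn_of_neg (hn : n < 0) (v : InfinitePlace ℚ) : ¬ v.IsUnramifiedIn K := by
  intro h
  obtain ⟨φ⟩ : Nonempty (InfinitePlace K) := inferInstance
  rcases InfinitePlace.isUnramified_iff.mp (h φ (Subsingleton.elim _ _)) with hφ | hφ
  · have hsq := congrArg (InfinitePlace.embedding_of_isReal hφ) hs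
    rw [map_pow, map_intCast] at hsq
    have hn' : (n : ℝ) < 0 := mod_cast hn
    exact (sq_nonneg _).not_gt (hsq ▸ hn')
  · exact InfinitePlace.not_isComplex_iff_isReal.mpr (isReal_infinitePlace_rat _) hφ

lemma isUnramifiedIn_of_nonneg (hK : Module.finrank ℚ K = 2) (hsQ : s ∉ (algebraMap ℚ K).range)
    (hn : 0 ≤ n) (v : InfinitePlace ℚ) : v.IsUnramifiedIn K := by
  intro φ _
  refine InfinitePlace.isUnramified_iff.mpr
    (.inl (InfinitePlace.isReal_iff.mpr (RingHom.ext fun x => ?_)))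
  obtain ⟨a, b, rfl⟩ := exists_eq_add_mul hK hsQ x
  have hsq : φ.embedding s ^ 2 = ((√n : ℝ) : ℂ) ^ 2 := by
    rw [← map_pow, hs, map_intCast, ← Complex.ofReal_pow, Real.sq_sqrt (mod_cast hn),
      Complex.ofReal_intCast]
  have hreal : starRingEnd ℂ (φ.embedding s) = φ.embedding s := by
    rcases sq_eq_sq_iff_eq_or_eq_neg.mp hsq with h | h <;> rw [h] <;> simp
  simp [ComplexEmbedding.conjugate_coe_eq, hreal]

theorem deltaInfinite_curveE₁ (hK : Module.finrank ℚ K = 2)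
    (hsQ : s ∉ (algebraMap ℚ K).range) : deltaInfinite curveE₁ K = if n < 0 then 1 else 0 := by
  rw [deltaInfinite]
  split_ifs with hn
  · refine Set.ncard_eq_one.mpr ⟨Rat.infinitePlace, Set.eq_singleton_iff_unique_mem.mpr
      ⟨⟨isReal_infinitePlace_rat _, not_isUnramifiedIn_of_neg hs hn _, ?_⟩,
        fun v _ => Subsingleton.elim _ _⟩⟩
    rw [curveE₁_Δ, map_ofNat]
    norm_num
  · rw [Set.ncard_eq_zero, Set.eq_empty_iff_forall_notMem]
    rintro v ⟨-, hv, -⟩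
    exact hv (isUnramifiedIn_of_nonneg hs hK hsQ (not_lt.mp hn) v)

end InfiniteIndex

lemma exists_sqrt_ringOfIntegers {K : Type*} [Field K] {n : ℤ} {s : K} (hs : s ^ 2 = n) :
    ∃ S : 𝓞 K, S ^ 2 = n := by
  have hint : s ∈ integralClosure ℤ K := by
    refine ⟨.X ^ 2 - .C n, by monicity!, ?_⟩
    rw [Polynomial.eval₂_sub, Polynomial.eval₂_pow, Polynomial.eval₂_X, Polynomial.eval₂_C, hs]
    simp
  obtain ⟨S, rfl⟩ : ∃ S : 𝓞 K, algebraMap (𝓞 K) K S = s := ⟨⟨s, hint⟩, rfl⟩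
  exact ⟨S, RingOfIntegers.coe_injective (by rw [map_pow, map_intCast, hs])⟩

theorem mktIndex_curveE₁ {K : Type*} [Field K] [NumberField K] (hK : Module.finrank ℚ K = 2)
    {n : ℤ} (hn : Squarefree n) (hn1 : n ≠ 1) {s : K} (hs : s ^ 2 = n) :
    mktIndex curveE₁ n K = (if n < 0 then 1 else 0) + dyadicIndex n + 2 * oddPrimeCount n := by
  obtain ⟨S, hS⟩ := exists_sqrt_ringOfIntegers hs
  have hS' : (S : K) ^ 2 = n := by rw [← map_pow, hS, map_intCast]
  have hSQ := sqrt_notMem_range hn hn1 hS'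
  rw [mktIndex, deltaInfinite_curveE₁ hS' hK hSQ, deltaFinite_curveE₁ hK hS hn hSQ, add_assoc]
  push_cast
  rfl

end MKT

theorem lemma4p2 (n : ℤ) (hn : Squarefree n) (hn1 : n ≠ 1)
    (K : Type*) [Field K] [NumberField K]
    (hK : Module.finrank ℚ K = 2) (hs : ∃ s : K, s ^ 2 = (n : K)) :
    (0 < n → n ≡ 1 [ZMOD 8] →
      MKT.mktIndex MKT.curveE₁ (n : ℚ) K = 2 * MKT.oddPrimeCount n) ∧
    (0 < n → (n ≡ 5 [ZMOD 8] ∨ n ≡ 7 [ZMOD 8]) →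
      MKT.mktIndex MKT.curveE₁ (n : ℚ) K = 1 + 2 * MKT.oddPrimeCount n) ∧
    (0 < n → n ≡ 6 [ZMOD 8] →
      MKT.mktIndex MKT.curveE₁ (n : ℚ) K = 3 + 2 * MKT.oddPrimeCount n) ∧
    (0 < n → (n ≡ 2 [ZMOD 8] ∨ n ≡ 3 [ZMOD 8]) →
      MKT.mktIndex MKT.curveE₁ (n : ℚ) K = 2 + 2 * MKT.oddPrimeCount n) ∧
    (n < 0 → n ≡ 1 [ZMOD 8] →
      MKT.mktIndex MKT.curveE₁ (n : ℚ) K = 1 + 2 * MKT.oddPrimeCount n) ∧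
    (n < 0 → (n ≡ 5 [ZMOD 8] ∨ n ≡ 7 [ZMOD 8]) →
      MKT.mktIndex MKT.curveE₁ (n : ℚ) K = 2 + 2 * MKT.oddPrimeCount n) ∧
    (n < 0 → (n ≡ 2 [ZMOD 8] ∨ n ≡ 3 [ZMOD 8]) →
      MKT.mktIndex MKT.curveE₁ (n : ℚ) K = 3 + 2 * MKT.oddPrimeCount n) ∧
    (n < 0 → n ≡ 6 [ZMOD 8] →
      MKT.mktIndex MKT.curveE₁ (n : ℚ) K = 4 + 2 * MKT.oddPrimeCount n) := by
  obtain ⟨s, hs⟩ := hs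
  rw [MKT.mktIndex_curveE₁ hK hn hn1 hs]
  simp only [MKT.dyadicIndex, Int.ModEq]
  refine ⟨?_, ?_, ?_, ?_, ?_, ?_, ?_, ?_⟩ <;> intro hsign hmod <;> split_ifs <;>
    first | omega | (push_cast; ring)
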